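/- Let $N$ be a set of $n$ agents and $M$ a non-empty set of $m$ indivisible chores (items). Agent $i$ has a cost $c_i(e)\ge 0$ for each item $e$, extended additively to bundles by $c_i(X)=\sum_{e\in X}c_i(e)$ for $X\subseteq M$. The instance is *bi-valued* if there are two numbers $a,b\ge 0$ such that $c_i(e)\in\{a,b\}$ for every agent $i$ and every item $e$. An *allocation* is a tuple $(X_i)_{i\in N}$ of pairwise disjoint (possibly empty) bundles with $\bigcup_{i\in N}X_i=M$; for $\alpha\ge 1$ it is *$\alpha$-EFX* if $c_i(X_i\setminus\{e\})\le\alpha\cdot c_i(X_j)$ for all $i,j\in N$ and all $e\in X_i$. **Theorem.** There exists an algorithm that, for every bi-valued instance with $n\ge 4$ agents and $m\ge 1$ items, computes an $(n-1)$-EFX allocation (in particular, one exists) in $O(nm)$ time. That is, there are a single program and a single constant $C$, independent of $n$, $m$, $a$, $b$ and the costs, such that on every such input the program halts after at most $C\,nm$ steps and outputs the receiver of each item in an $(n-1)$-EFX allocation. Time is counted on a unit-cost random access machine whose input consists of $n$, $m$ and the matrix of costs, whose operations on natural numbers are successor, predecessor, comparison and indexed memory access, and whose operations on real numbers (the costs)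 are addition, subtraction, comparison and indexed memory access. -/

import Mathlib

namespace ChoreDivision

section Fairness

variable {n m : ℕ}

/-- The additive extension of the item costs `c i e` of agent `i` to a bundle. -/
noncomputable def bundleCost (c : Fin n → Fin m → ℝ) (i : Fin n) (X : Finset (Fin m)) : ℝ :=
  ∑ e ∈ X, c i e

/-- An allocation: pairwise disjoint bundles, one per agent, that cover all items
(bundles may be empty). -/
def IsAllocation (X : Fin n → Finset (Fin m)) : Prop :=
  (∀ i j, i ≠ j → Disjoint (X i) (X j)) ∧ ∀ e, ∃ i, e ∈ X i

/-- `α`-approximate envy-freeness up to any item, for chores. -/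
def IsEFX (α : ℝ) (c : Fin n → Fin m → ℝ) (X : Fin n → Finset (Fin m)) : Prop :=
  ∀ i j, ∀ e ∈ X i, bundleCost c i ((X i).erase e) ≤ α * bundleCost c i (X j)

/-- Bi-valued costs: two nonnegative numbers, the same for all agents, are the only costs of
single items. -/
def IsBivalued (c : Fin n → Fin m → ℝ) : Prop :=
  ∃ a b : ℝ, 0 ≤ a ∧ 0 ≤ b ∧ ∀ i e, c i e = a ∨ c i e = b

end Fairness

/-! Machine model: a unit-cost random access machine with structured programs. Its memory
consists of cells for natural numbers and of cells for real numbers; a cell is addressed by the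
name of an array (fixed in the program) and two computed indices. On natural numbers there are
only successor, predecessor and comparison, so that no number exceeds the largest input number by
more than a constant times the number of steps (unit cost hides no arithmetic on long numbers); on
real numbers there are only addition, subtraction and comparison. -/

/-- The memory: a cell is given by an array name and two indices. -/
structure Store where
  nat : ℕ → ℕ → ℕ → ℕ
  real : ℕ → ℕ → ℕ → ℝ

/-- Expressions for natural numbers. -/
inductive NatExpr : Type
  | const (k : ℕ)
  | cell (a : ℕ) (i j : NatExpr)
  | succ (x : NatExpr)
  | pred (x : NatExpr)

/-- Expressions for real numbers. -/
inductive RealExpr : Type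
  | zero
  | cell (a : ℕ) (i j : NatExpr)
  | add (x y : RealExpr)
  | sub (x y : RealExpr)

/-- Tests. -/
inductive Test : Type
  | natLe (x y : NatExpr)
  | realLe (x y : RealExpr)
  | not (b : Test)
  | and (b b' : Test)

/-- Programs. -/
inductive Program : Type
  | skip
  | setNat (a : ℕ) (i j : NatExpr) (x : NatExpr)
  | setReal (a : ℕ) (i j : NatExpr) (x : RealExpr)
  | seq (p q : Program)
  | ite (b : Test) (p q : Program)
  | while (b : Test) (p : Program)

/-- Value of a natural number expression. -/
def NatExpr.eval (s : Store) : NatExpr → ℕ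
  | .const k => k
  | .cell a i j => s.nat a (i.eval s) (j.eval s)
  | .succ x => x.eval s + 1
  | .pred x => x.eval s - 1

/-- Number of steps for evaluating a natural number expression: one per node. -/
def NatExpr.cost : NatExpr → ℕ
  | .const _ => 1
  | .cell _ i j => i.cost + j.cost + 1
  | .succ x => x.cost + 1
  | .pred x => x.cost + 1

/-- Value of a real expression. -/
noncomputable def RealExpr.eval (s : Store) : RealExpr → ℝ
  | .zero => 0
  | .cell a i j => s.real a (i.eval s) (j.eval s)
  | .add x y => x.eval s + y.eval s
  | .sub x y => x.eval s - y.eval s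

/-- Number of steps for evaluating a real expression: one per node. -/
def RealExpr.cost : RealExpr → ℕ
  | .zero => 1
  | .cell _ i j => i.cost + j.cost + 1
  | .add x y => x.cost + y.cost + 1
  | .sub x y => x.cost + y.cost + 1

/-- Truth of a test. -/
def Test.Holds (s : Store) : Test → Prop
  | .natLe x y => x.eval s ≤ y.eval s
  | .realLe x y => x.eval s ≤ y.eval s
  | .not b => ¬ b.Holds s
  | .and b b' => b.Holds s ∧ b'.Holds s

/-- Number of steps for evaluating a test: one per node. -/
def Test.cost : Test → ℕ
  | .natLe x y => x.cost + y.cost + 1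
  | .realLe x y => x.cost + y.cost + 1
  | .not b => b.cost + 1
  | .and b b' => b.cost + b'.cost + 1

/-- Overwriting one cell for natural numbers. -/
def Store.writeNat (s : Store) (a i j v : ℕ) : Store :=
  { s with nat := fun a' i' j' => if a' = a ∧ i' = i ∧ j' = j then v else s.nat a' i' j' }

/-- Overwriting one cell for real numbers. -/
def Store.writeReal (s : Store) (a i j : ℕ) (v : ℝ) : Store :=
  { s with real := fun a' i' j' => if a' = a ∧ i' = i ∧ j' = j then v else s.real a' i' j' }

/-- `Exec p s t s'`: started in memory `s`, the program `p` halts after exactly `t` steps, in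
memory `s'`. -/
inductive Exec : Program → Store → ℕ → Store → Prop
  | skip (s : Store) : Exec .skip s 1 s
  | setNat (a : ℕ) (i j x : NatExpr) (s : Store) :
      Exec (.setNat a i j x) s (i.cost + j.cost + x.cost + 1)
        (s.writeNat a (i.eval s) (j.eval s) (x.eval s))
  | setReal (a : ℕ) (i j : NatExpr) (x : RealExpr) (s : Store) :
      Exec (.setReal a i j x) s (i.cost + j.cost + x.cost + 1)
        (s.writeReal a (i.eval s) (j.eval s) (x.eval s))
  | seq {p q : Program} {s s' s'' : Store} {t t' : ℕ} :
      Exec p s t s' → Exec q s' t' s'' → Exec (.seq p q) s (t + t') s''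
  | iteTrue {b : Test} {p q : Program} {s s' : Store} {t : ℕ} :
      b.Holds s → Exec p s t s' → Exec (.ite b p q) s (b.cost + t + 1) s'
  | iteFalse {b : Test} {p q : Program} {s s' : Store} {t : ℕ} :
      ¬ b.Holds s → Exec q s t s' → Exec (.ite b p q) s (b.cost + t + 1) s'
  | whileTrue {b : Test} {p : Program} {s s' s'' : Store} {t t' : ℕ} :
      b.Holds s → Exec p s t s' → Exec (.while b p) s' t' s'' →
        Exec (.while b p) s (b.cost + t + t' + 1) s''
  | whileFalse {b : Test} {p : Program} {s : Store} :
      ¬ b.Holds s → Exec (.while b p) s (b.cost + 1) s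

/-- Execution is deterministic, so the number of steps of a halting run and its result are
determined by the program and the initial memory. -/
theorem Exec.deterministic {p : Program} {s s₁ : Store} {t₁ : ℕ} (h₁ : Exec p s t₁ s₁) :
    ∀ {t₂ : ℕ} {s₂ : Store}, Exec p s t₂ s₂ → t₁ = t₂ ∧ s₁ = s₂ := by
  induction h₁ with
  | skip s => intro t₂ s₂ h; cases h; exact ⟨rfl, rfl⟩
  | setNat a i j x s => intro t₂ s₂ h; cases h; exact ⟨rfl, rfl⟩
  | setReal a i j x s => intro t₂ s₂ h; cases h; exact ⟨rfl, rfl⟩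
  | seq _ _ ih ih' =>
    intro t₂ s₂ h
    cases h with
    | seq g g' =>
      obtain ⟨rfl, rfl⟩ := ih g
      obtain ⟨rfl, rfl⟩ := ih' g'
      exact ⟨rfl, rfl⟩
  | iteTrue hb _ ih =>
    intro t₂ s₂ h
    cases h with
    | iteTrue _ g => obtain ⟨rfl, rfl⟩ := ih g; exact ⟨rfl, rfl⟩
    | iteFalse hb' _ => exact absurd hb hb'
  | iteFalse hb _ ih =>
    intro t₂ s₂ h
    cases h with
    | iteTrue hb' _ => exact absurd hb' hb
    | iteFalse _ g => obtain ⟨rfl, rfl⟩ := ih g; exact ⟨rfl, rfl⟩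
  | whileTrue hb _ _ ih ih' =>
    intro t₂ s₂ h
    cases h with
    | whileTrue _ g g' =>
      obtain ⟨rfl, rfl⟩ := ih g
      obtain ⟨rfl, rfl⟩ := ih' g'
      exact ⟨rfl, rfl⟩
    | whileFalse hb' => exact absurd hb hb'
  | whileFalse hb =>
    intro t₂ s₂ h
    cases h with
    | whileTrue hb' _ _ => exact absurd hb' hb
    | whileFalse _ => exact ⟨rfl, rfl⟩

/-- The input: the numbers `n` of agents and `m` of items are in the cells `(0, 0)` and `(0, 1)`
of array `0` of natural numbers, and the cost of item `e` to agent `i` is in the cell `(i, e)` of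
array `0` of real numbers. All other cells are zero. -/
noncomputable def inputStore {n m : ℕ} (c : Fin n → Fin m → ℝ) : Store where
  nat := fun a i j =>
    if a = 0 ∧ i = 0 ∧ j = 0 then n else if a = 0 ∧ i = 0 ∧ j = 1 then m else 0
  real := fun a i j =>
    if h : a = 0 ∧ i < n ∧ j < m then c ⟨i, h.2.1⟩ ⟨j, h.2.2⟩ else 0

/-- The output: the receiver of item `e` is in the cell `(0, e)` of array `1` of natural
numbers. -/
def Outputs {n m : ℕ} (s : Store) (X : Fin n → Finset (Fin m)) : Prop :=
  ∀ i e, e ∈ X i ↔ s.nat 1 0 (e : ℕ) = (i : ℕ)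

end ChoreDivision

/-! A round of picks, in which every agent takes a small item if one is free, and otherwise an item
that is large for everybody, keeps `(n - 1)`-EFX: an agent that finds no small item sees every
other bundle grow by a large item as well. For this to work from round to round, an agent may run
out of small items only between rounds. Hence an agent for which fewer than `n` (but some) free
items are small takes all of them at once; it has then at most `n - 1` items more than the others,
and all are small for it, so a factor `n - 1` absorbs the difference.

The rounds end when fewer than `n` items are free, all large for everybody. Call an agent poor if
it owns no such item; all items of a poor agent are small for it. If there are enough free items,
every poor agent gets one, and some others get one each. Otherwise, a non-poor agent with at least
two items got the last one in a round without small items, and can bear all free items. If every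
non-poor agent owns a single item, then each free item goes to a poor agent with a smallest bundle,
except when this agent finds a bundle of another poor agent cheaper than half a large item: it
takes over that bundle, and the free item replaces it.

Each pick searches a preference list for the first free item; as items never become free again,
these searches take `O(nm)` steps altogether. -/

namespace ChoreDivision

attribute [simp] NatExpr.eval NatExpr.cost RealExpr.eval RealExpr.cost Test.Holds Test.cost

/-! ### Time credits -/

/-- Started in memory `s` with a budget of `b` steps, the program halts within the budget, and the
final memory together with the remaining budget satisfies `Q`. -/
def Runs (p : Program) (s : Store) (b : ℕ) (Q : Store → ℕ → Prop) : Prop :=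
  ∃ t s' b', Exec p s t s' ∧ t + b' ≤ b ∧ Q s' b'

namespace Runs

variable {p q : Program} {s : Store} {b : ℕ} {Q Q' : Store → ℕ → Prop}

theorem mono (h : Runs p s b Q) (hQ : ∀ s' b', Q s' b' → Q' s' b') : Runs p s b Q' := by
  obtain ⟨t, s', b', hexec, hcost, hpost⟩ := h
  exact ⟨t, s', b', hexec, hcost, hQ _ _ hpost⟩

theorem skip (h : Q s (b - 1)) (hb : 1 ≤ b := by simp <;> omega) : Runs .skip s b Q :=
  ⟨1, s, b - 1, .skip s, by omega, h⟩

theorem setNat {a i' j' v : ℕ} {i j x : NatExpr} (hi : i.eval s = i') (hj : j.eval s = j')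
    (hx : x.eval s = v) (h : Q (s.writeNat a i' j' v) (b - (i.cost + j.cost + x.cost + 1)))
    (hb : i.cost + j.cost + x.cost + 1 ≤ b := by simp <;> omega) :
    Runs (.setNat a i j x) s b Q := by
  subst hi hj hx
  exact ⟨_, _, _, .setNat a i j x s, by omega, h⟩

theorem setReal {a i' j' : ℕ} {v : ℝ} {i j : NatExpr} {x : RealExpr} (hi : i.eval s = i')
    (hj : j.eval s = j') (hx : x.eval s = v)
    (h : Q (s.writeReal a i' j' v) (b - (i.cost + j.cost + x.cost + 1)))
    (hb : i.cost + j.cost + x.cost + 1 ≤ b := by simp <;> omega) :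
    Runs (.setReal a i j x) s b Q := by
  subst hi hj hx
  exact ⟨_, _, _, .setReal a i j x s, by omega, h⟩

theorem seq (h : Runs p s b fun s' b' => Runs q s' b' Q) : Runs (.seq p q) s b Q := by
  obtain ⟨t, s', b', hp, hcost, t', s'', b'', hq, hcost', hpost⟩ := h
  exact ⟨_, _, b'', .seq hp hq, by omega, hpost⟩

theorem ite {T : Test} {P : Prop} (hT : T.Holds s ↔ P)
    (htrue : P → Runs p s (b - (T.cost + 1)) Q) (hfalse : ¬ P → Runs q s (b - (T.cost + 1)) Q)
    (hb : T.cost + 1 ≤ b := by simp <;> omega) : Runs (.ite T p q) s b Q := by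
  by_cases hP : P
  · obtain ⟨t, s', b', hexec, hcost, hpost⟩ := htrue hP
    exact ⟨_, _, b', .iteTrue (hT.2 hP) hexec, by omega, hpost⟩
  · obtain ⟨t, s', b', hexec, hcost, hpost⟩ := hfalse hP
    exact ⟨_, _, b', .iteFalse (mt hT.1 hP) hexec, by omega, hpost⟩

/-- Termination of a loop comes for free, because every iteration uses up some budget. -/
theorem while_loop {T : Test} {I : Store → ℕ → Prop}
    (hstep : ∀ s b, I s b → T.Holds s → T.cost + 1 ≤ b ∧ Runs p s (b - (T.cost + 1)) I)
    (hend : ∀ s b, I s b → ¬ T.Holds s → T.cost + 1 ≤ b ∧ Q s (b - (T.cost + 1)))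
    (h : I s b) : Runs (.while T p) s b Q := by
  induction b using Nat.strong_induction_on generalizing s with
  | _ b ih =>
    by_cases hT : T.Holds s
    · obtain ⟨hb, t, s', b', hbody, hcost, hI⟩ := hstep s b h hT
      obtain ⟨t', s'', b'', hloop, hcost', hpost⟩ := ih b' (by omega) hI
      exact ⟨_, _, b'', .whileTrue hT hbody hloop, by omega, hpost⟩
    · obtain ⟨hb, hpost⟩ := hend s b h hT
      exact ⟨_, _, _, .whileFalse hT, by omega, hpost⟩

theorem ite_skip {T : Test} {P : Prop} (hT : T.Holds s ↔ P)
    (htrue : P → Runs p s (b - (T.cost + 1)) Q) (hfalse : ¬ P → Q s (b - (T.cost + 1) - 1))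
    (hb : T.cost + 2 ≤ b := by simp <;> omega) : Runs (.ite T p .skip) s b Q :=
  ite hT htrue (fun hP => skip (hfalse hP) (by omega)) (by omega)

theorem frame {C : ℕ} {P : Store → Prop} (h : Runs p s C fun s' _ => P s') (hb : C ≤ b)
    (hQ : ∀ s', P s' → Q s' (b - C)) : Runs p s b Q := by
  obtain ⟨t, s', b', hexec, hcost, hP⟩ := h
  exact ⟨t, s', b - C, hexec, by omega, hQ _ hP⟩

end Runs

/-! ### Scalars and counting loops -/

/-- The scalar kept in the cell `(0, 0)` of array `k`. -/
abbrev scalar (k : ℕ) : NatExpr := .cell k (.const 0) (.const 0)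

/-- Assignment to a scalar. -/
abbrev assign (k : ℕ) (x : NatExpr) : Program := .setNat k (.const 0) (.const 0) x

/-- The loop running `body` with scalar `k` equal to `0, 1, …, bound - 1`. -/
abbrev forLoop (k : ℕ) (bound : NatExpr) (body : Program) : Program :=
  .seq (assign k (.const 0))
    (.while (.natLe (.succ (scalar k)) bound) (.seq body (assign k (.succ (scalar k)))))

theorem Runs.assign {k v : ℕ} {x : NatExpr} {s : Store} {b : ℕ} {Q : Store → ℕ → Prop}
    (hx : x.eval s = v) (h : Q (s.writeNat k 0 0 v) (b - (x.cost + 3)))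
    (hb : x.cost + 3 ≤ b := by simp <;> omega) : Runs (assign k x) s b Q :=
  have hcost : 1 + 1 + x.cost + 1 = x.cost + 3 := by omega
  setNat rfl rfl hx (hcost ▸ h) (hcost ▸ hb)

namespace Store

variable {s : Store} {a a' i j : ℕ}

@[simp] theorem nat_writeNat_of_ne {v : ℕ} (h : a' ≠ a) :
    (s.writeNat a i j v).nat a' = s.nat a' := by
  funext i' j'
  simp [writeNat, h]

@[simp] theorem nat_writeNat_same {v : ℕ} (i' j' : ℕ) :
    (s.writeNat a i j v).nat a i' j' = if i' = i ∧ j' = j then v else s.nat a i' j' := by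
  simp [writeNat]

@[simp] theorem real_writeNat {v : ℕ} : (s.writeNat a i j v).real = s.real := rfl

@[simp] theorem nat_writeReal {v : ℝ} : (s.writeReal a i j v).nat = s.nat := rfl

@[simp] theorem real_writeReal_of_ne {v : ℝ} (h : a' ≠ a) :
    (s.writeReal a i j v).real a' = s.real a' := by
  funext i' j'
  simp [writeReal, h]

@[simp] theorem real_writeReal_same {v : ℝ} (i' j' : ℕ) :
    (s.writeReal a i j v).real a i' j' = if i' = i ∧ j' = j then v else s.real a i' j' := by
  simp [writeReal]

end Store

namespace Runs

variable {body : Program} {bound : NatExpr} {s : Store} {b k N : ℕ}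

theorem for_loop {I : ℕ → Store → ℕ → Prop} {Q : Store → ℕ → Prop}
    (hb : 4 ≤ b) (hinit : I 0 (s.writeNat k 0 0 0) (b - 4))
    (hbound : ∀ i s b, I i s b → bound.eval s = N)
    (hbody : ∀ i s b, i < N → s.nat k 0 0 = i → I i s b → bound.cost + 13 ≤ b ∧
      Runs body s (b - (bound.cost + 13)) fun s' b' =>
        s'.nat k 0 0 = i ∧ I (i + 1) (s'.writeNat k 0 0 (i + 1)) b')
    (hend : ∀ s b, s.nat k 0 0 = N → I N s b → bound.cost + 6 ≤ b ∧ Q s (b - (bound.cost + 6))) :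
    Runs (forLoop k bound body) s b Q := by
  have htest : (Test.natLe (NatExpr.succ (scalar k)) bound).cost + 1 = bound.cost + 6 := by
    simp only [Test.cost, NatExpr.cost]
    omega
  refine seq (assign rfl ?_ hb)
  refine while_loop (I := fun s b => s.nat k 0 0 ≤ N ∧ I (s.nat k 0 0) s b) ?_ ?_ ?_
  · rintro s b ⟨-, hI⟩ hT
    have hlt : s.nat k 0 0 < N := hbound _ _ _ hI ▸ hT
    obtain ⟨hcost, t, s', b', hexec, hbudget, hcounter, hI'⟩ := hbody _ s b hlt rfl hI
    rw [htest]
    refine ⟨by omega, seq ⟨t, s', b' + 7, hexec, by omega, assign (congrArg (· + 1) hcounter) ?_⟩⟩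
    simpa using ⟨hlt, hI'⟩
  · rintro s b ⟨hle, hI⟩ hT
    have hN : s.nat k 0 0 = N := hle.antisymm (not_lt.1 (hbound _ _ _ hI ▸ hT))
    rw [htest]
    exact hend s b hN (hN ▸ hI)
  · simpa using hinit

theorem for_loop_const {C : ℕ} {J : ℕ → Store → Prop} {P : Store → Prop}
    (hinit : J 0 (s.writeNat k 0 0 0))
    (hbound : ∀ i s, J i s → bound.eval s = N)
    (hbody : ∀ i s, i < N → s.nat k 0 0 = i → J i s →
      Runs body s C fun s' _ => s'.nat k 0 0 = i ∧ J (i + 1) (s'.writeNat k 0 0 (i + 1)))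
    (hend : ∀ s, J N s → P s) :
    Runs (forLoop k bound body) s (N * (C + (bound.cost + 13)) + (bound.cost + 10))
      fun s' _ => P s' := by
  refine for_loop (N := N)
    (I := fun i s b => J i s ∧ i ≤ N ∧ (N - i) * (C + (bound.cost + 13)) + (bound.cost + 6) ≤ b)
    (by omega) ⟨hinit, by omega, by rw [Nat.sub_zero]; omega⟩ (fun i s _ h => hbound i s h.1) ?_ ?_
  · rintro i s b hi hk ⟨hJ, -, hbudget⟩
    have hleft : N - i = (N - (i + 1)) + 1 := by omega
    rw [hleft, add_mul, one_mul] at hbudget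
    refine ⟨by omega, frame (hbody i s hi hk hJ) (by omega) ?_⟩
    rintro s' ⟨hcounter, hJ'⟩
    exact ⟨hcounter, hJ', by omega, by omega⟩
  · rintro s b - ⟨hJ, -, hbudget⟩
    exact ⟨by omega, hend s hJ⟩

end Runs

/-! ### Partial allocations

A partial allocation is a family `X` of bundles, where `X i` for `i < n` is the bundle of agent `i`
and `X n` is the set of free items. -/

/-- The cost of a set of items to agent `i`. -/
noncomputable def setCost (c : ℕ → ℕ → ℝ) (i : ℕ) (S : Finset ℕ) : ℝ := ∑ e ∈ S, c i e

/-- The preferences that are looked up by the algorithm: for `v < n`, item `e` is small for agent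
`v`; for `v = n`, it is large for all agents; for `v > n`, no condition. -/
def Hits (n : ℕ) (c : ℕ → ℕ → ℝ) (s : ℝ) (v e : ℕ) : Prop :=
  if v < n then c v e = s else v = n → ∀ i < n, c i e ≠ s

open Classical in
/-- The number of free items hit by `v`. -/
noncomputable def avail (n : ℕ) (c : ℕ → ℕ → ℝ) (s : ℝ) (X : ℕ → Finset ℕ) (v : ℕ) : ℕ :=
  ((X n).filter (Hits n c s v)).card

/-- Bi-valued costs for `n ≥ 4` agents, with a large value `l` exceeding twice the small one. -/
structure Separated (n m : ℕ) (c : ℕ → ℕ → ℝ) (s l : ℝ) : Prop where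
  four_le : 4 ≤ n
  nonneg : 0 ≤ s
  two_mul_lt : 2 * s < l
  small_or_large : ∀ i < n, ∀ e < m, c i e = s ∨ c i e = l

/-- Agent `i` would remain `(n - 1)`-envy-free up to any item if its bundle cost `x` more. -/
def Tolerates (n : ℕ) (c : ℕ → ℕ → ℝ) (X : ℕ → Finset ℕ) (i : ℕ) (x : ℝ) : Prop :=
  ∀ j < n, i ≠ j → ∀ e ∈ X i,
    setCost c i (X i) - c i e + x ≤ ((n : ℝ) - 1) * setCost c i (X j)

/-- Envy-freeness up to any item, with factor `n - 1`, of a partial allocation. -/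
def EFX (n : ℕ) (c : ℕ → ℕ → ℝ) (X : ℕ → Finset ℕ) : Prop :=
  ∀ i < n, Tolerates n c X i 0

/-- `X'` arises from `X` by giving the free item `f` to agent `i`. -/
structure Give (n i f : ℕ) (X X' : ℕ → Finset ℕ) : Prop where
  lt : i < n
  free : f ∈ X n
  notMem : f ∉ X i
  self : X' i = insert f (X i)
  rest : X' n = (X n).erase f
  other : ∀ j < n, j ≠ i → X' j = X j

section Basic

variable {n m : ℕ} {c : ℕ → ℕ → ℝ} {s l : ℝ} {X X' : ℕ → Finset ℕ}

theorem hits_agent {v e : ℕ} (hv : v < n) : Hits n c s v e ↔ c v e = s := by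
  simp [Hits, hv]

theorem hits_none {e : ℕ} : Hits n c s n e ↔ ∀ i < n, c i e ≠ s := by
  simp [Hits]

theorem hits_all {e : ℕ} : Hits n c s (n + 1) e := by
  simp [Hits]

theorem avail_pos_iff {v : ℕ} : 0 < avail n c s X v ↔ ∃ e ∈ X n, Hits n c s v e := by
  classical
  simp [avail, Finset.card_pos, Finset.Nonempty]

theorem avail_eq_zero_iff {v : ℕ} : avail n c s X v = 0 ↔ ∀ e ∈ X n, ¬ Hits n c s v e := by
  classical
  simp [avail, Finset.filter_eq_empty_iff]

theorem avail_mono {v : ℕ} (h : X' n ⊆ X n) : avail n c s X' v ≤ avail n c s X v := by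
  classical
  exact Finset.card_le_card (Finset.filter_subset_filter _ h)

theorem avail_all : avail n c s X (n + 1) = (X n).card := by
  classical
  simp [avail, hits_all]

theorem avail_le_all {v : ℕ} : avail n c s X v ≤ avail n c s X (n + 1) := by
  classical
  rw [avail_all]
  exact Finset.card_filter_le _ _

theorem setCost_singleton {i e : ℕ} : setCost c i {e} = c i e := Finset.sum_singleton _ _

theorem setCost_insert {i f : ℕ} {S : Finset ℕ} (h : f ∉ S) :
    setCost c i (insert f S) = setCost c i S + c i f := by
  rw [setCost, Finset.sum_insert h, add_comm, setCost]

theorem setCost_of_small {i : ℕ} {S : Finset ℕ} (h : ∀ e ∈ S, c i e = s) :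
    setCost c i S = S.card * s := by
  rw [setCost, Finset.sum_congr rfl h, Finset.sum_const, nsmul_eq_mul]

namespace Give

variable {i f : ℕ} (h : Give n i f X X')
include h

theorem avail_add_one {v : ℕ} (hv : Hits n c s v f) :
    avail n c s X' v + 1 = avail n c s X v := by
  classical
  have hmem : f ∈ (X n).filter (Hits n c s v) := by simp [h.free, hv]
  rw [avail, avail, h.rest, Finset.filter_erase, Finset.card_erase_add_one hmem]

theorem avail_eq {v : ℕ} (hv : ¬ Hits n c s v f) : avail n c s X' v = avail n c s X v := by
  classical
  have hmem : f ∉ (X n).filter (Hits n c s v) := by simp [hv]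
  rw [avail, avail, h.rest, Finset.filter_erase, Finset.erase_eq_of_notMem hmem]

theorem avail_le_add_one {v : ℕ} : avail n c s X v ≤ avail n c s X' v + 1 := by
  by_cases hv : Hits n c s v f
  · exact (h.avail_add_one hv).ge
  · exact (h.avail_eq hv).ge.trans (Nat.le_succ _)

theorem rest_subset : X' n ⊆ X n := by
  rw [h.rest]
  exact Finset.erase_subset _ _

theorem card_rest : (X' n).card + 1 = (X n).card := by
  rw [h.rest, Finset.card_erase_add_one h.free]

theorem card_self : (X' i).card = (X i).card + 1 := by
  rw [h.self, Finset.card_insert_of_notMem h.notMem]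

theorem subset {j : ℕ} (hj : j < n) : X j ⊆ X' j := by
  by_cases hji : j = i
  · subst hji
    rw [h.self]
    exact Finset.subset_insert _ _
  · rw [h.other j hj hji]

theorem subset_range (hX : ∀ j ≤ n, X j ⊆ Finset.range m) : ∀ j ≤ n, X' j ⊆ Finset.range m := by
  intro j hj
  rcases hj.lt_or_eq with hj | rfl
  · by_cases hji : j = i
    · subst hji
      rw [h.self]
      exact Finset.insert_subset (hX n le_rfl h.free) (hX j hj.le)
    · rw [h.other j hj hji]
      exact hX j hj.le
  · exact h.rest_subset.trans (hX j le_rfl)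

end Give

namespace Separated

variable (hI : Separated n m c s l)
include hI

theorem lt : s < l := by linarith [hI.nonneg, hI.two_mul_lt]

theorem pos : 0 < l := hI.nonneg.trans_lt hI.lt

theorem three_le : (3 : ℝ) ≤ (n : ℝ) - 1 := by
  have : (4 : ℝ) ≤ n := by exact_mod_cast hI.four_le
  linarith

theorem mul_small_le : ((n : ℝ) - 1) * s ≤ ((n : ℝ) - 2) * l := by
  nlinarith [hI.three_le, hI.nonneg, hI.two_mul_lt]

theorem eq_large_of_ne {i e : ℕ} (hi : i < n) (he : e < m) (h : c i e ≠ s) : c i e = l :=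
  (hI.small_or_large i hi e he).resolve_left h

theorem le_cost {i e : ℕ} (hi : i < n) (he : e < m) : s ≤ c i e := by
  rcases hI.small_or_large i hi e he with h | h <;> rw [h]
  exact hI.lt.le

theorem cost_le {i e : ℕ} (hi : i < n) (he : e < m) : c i e ≤ l := by
  rcases hI.small_or_large i hi e he with h | h <;> rw [h]
  exact hI.lt.le

theorem large_of_hits {i e : ℕ} (hi : i < n) (he : e < m) (h : Hits n c s n e) : c i e = l :=
  hI.eq_large_of_ne hi he (hits_none.1 h i hi)

section Bundle

variable {i : ℕ} {S : Finset ℕ} (hi : i < n) (hS : S ⊆ Finset.range m)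
include hi hS

theorem card_mul_le : S.card * s ≤ setCost c i S := by
  rw [setCost, ← nsmul_eq_mul, ← Finset.sum_const]
  exact Finset.sum_le_sum fun e he => hI.le_cost hi (Finset.mem_range.1 (hS he))

theorem setCost_nonneg : 0 ≤ setCost c i S :=
  le_trans (mul_nonneg (Nat.cast_nonneg _) hI.nonneg) (hI.card_mul_le hi hS)

theorem card_mul_add_le {f : ℕ} (hf : f ∈ S) (hl : c i f = l) :
    ((S.card : ℝ) - 1) * s + l ≤ setCost c i S := by
  have hrest := hI.card_mul_le hi ((Finset.erase_subset f S).trans hS)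
  have hsum : setCost c i (S.erase f) + c i f = setCost c i S := Finset.sum_erase_add _ _ hf
  rw [Finset.card_erase_of_mem hf, Nat.cast_pred (Finset.card_pos.2 ⟨f, hf⟩)] at hrest
  linarith

theorem large_le_setCost {f : ℕ} (hf : f ∈ S) (hl : c i f = l) : l ≤ setCost c i S := by
  have hbound := hI.card_mul_add_le hi hS hf hl
  have hcard : (1 : ℝ) ≤ S.card := by exact_mod_cast Finset.card_pos.2 ⟨f, hf⟩
  nlinarith [hI.nonneg]

theorem sub_cost_le {e : ℕ} (he : e ∈ S) : setCost c i S - c i e ≤ setCost c i S - s := by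
  linarith [hI.le_cost hi (Finset.mem_range.1 (hS he))]

end Bundle

theorem setCost_mono {i : ℕ} {S S' : Finset ℕ} (hi : i < n) (h : S ⊆ S')
    (hS : S' ⊆ Finset.range m) : setCost c i S ≤ setCost c i S' :=
  Finset.sum_le_sum_of_subset_of_nonneg h fun _ he _ =>
    hI.nonneg.trans (hI.le_cost hi (Finset.mem_range.1 (hS he)))

end Separated

namespace Tolerates

variable {i : ℕ} {x x' : ℝ}

theorem mono_left (h : Tolerates n c X i x) (hx : x' ≤ x) : Tolerates n c X i x' :=
  fun j hj hij e he => by linarith [h j hj hij e he]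

theorem of_sub_small (hI : Separated n m c s l) (hi : i < n) (hX : X i ⊆ Finset.range m)
    (h : ∀ j < n, i ≠ j → setCost c i (X i) - s + x ≤ ((n : ℝ) - 1) * setCost c i (X j)) :
    Tolerates n c X i x := fun j hj hij e he => by
  linarith [h j hj hij, hI.sub_cost_le hi hX he]

theorem sub_small_le (h : Tolerates n c X i x) (hne : (X i).Nonempty)
    (hsmall : ∀ e ∈ X i, c i e = s) {j : ℕ} (hj : j < n) (hij : i ≠ j) :
    setCost c i (X i) - s + x ≤ ((n : ℝ) - 1) * setCost c i (X j) := by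
  obtain ⟨e, he⟩ := hne
  simpa only [hsmall e he] using h j hj hij e he

theorem grow (hI : Separated n m c s l) (hi : i < n) (h : Tolerates n c X i x)
    (hself : X' i = X i) (hsub : ∀ j < n, X j ⊆ X' j) (hX' : ∀ j ≤ n, X' j ⊆ Finset.range m) :
    Tolerates n c X' i x := by
  intro j hj hij e he
  rw [hself] at he ⊢
  have henvy := h j hj hij e he
  have hgrow := hI.setCost_mono hi (hsub j hj) (hX' j hj.le)
  nlinarith [hI.three_le]

theorem give (hI : Separated n m c s l) {g f : ℕ} (hi : i < n) (hig : i ≠ g)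
    (h : Tolerates n c X i x) (hG : Give n g f X X') (hX : ∀ j ≤ n, X j ⊆ Finset.range m) :
    Tolerates n c X' i x :=
  h.grow hI hi (hG.other i hi hig) (fun _ hj => hG.subset hj) (hG.subset_range hX)

theorem insert_large (hI : Separated n m c s l) {f : ℕ} {g : ℝ} (hi : i < n)
    (h : Tolerates n c X i x) (hX : X i ⊆ Finset.range m) (hne : (X i).Nonempty)
    (hf : f ∉ X i) (hl : c i f = l) (hself : X' i = insert f (X i))
    (hg : ∀ j < n, i ≠ j → setCost c i (X j) + g ≤ setCost c i (X' j))
    (hx : x' + l ≤ x + ((n : ℝ) - 1) * g) : Tolerates n c X' i x' := by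
  intro j hj hij e he
  have hgain : ((n : ℝ) - 1) * (setCost c i (X j) + g) ≤ ((n : ℝ) - 1) * setCost c i (X' j) :=
    mul_le_mul_of_nonneg_left (hg j hj hij) (by linarith [hI.three_le])
  have hold : ∀ e ∈ X i,
      setCost c i (X i) - c i e + (x' + l) ≤ ((n : ℝ) - 1) * setCost c i (X' j) :=
    fun e he => by linarith [h j hj hij e he]
  rw [hself, setCost_insert hf, hl]
  rw [hself] at he
  rcases Finset.mem_insert.1 he with rfl | he
  · obtain ⟨e₀, he₀⟩ := hne
    linarith [hold e₀ he₀, hI.cost_le hi (Finset.mem_range.1 (hX he₀))]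
  · linarith [hold e he]

end Tolerates

end Basic

/-! ### Rounds of picks -/

section Rounds

variable {n m : ℕ} {c : ℕ → ℕ → ℝ} {s l : ℝ} {r : ℕ} {X X' X₀ : ℕ → Finset ℕ}

/-- All items in `S` are small for agent `i`, and they are so few that the agent does not envy
anybody who owns `r` items. -/
structure FewSmall (n : ℕ) (c : ℕ → ℕ → ℝ) (s : ℝ) (r i : ℕ) (S : Finset ℕ) : Prop where
  small : ∀ e ∈ S, c i e = s
  card_lt : S.card < r + n

/-- The invariant of the main phase, after `r` rounds in which every agent has picked an item.
The field `active` concerns the agents that still find small items: each has `r` items or is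
taking its last small items between rounds. The field `final` prepares the end of the phase and is
void while no free item is large for everybody. -/
structure MainInv (n m : ℕ) (c : ℕ → ℕ → ℝ) (s l : ℝ) (r : ℕ) (X : ℕ → Finset ℕ) : Prop where
  subset : ∀ j ≤ n, X j ⊆ Finset.range m
  pos : 1 ≤ r
  size : ∀ j < n, r ≤ (X j).card
  active : ∀ i < n, 0 < avail n c s X i →
    ((X i).card = r ∨ (X i).card + avail n c s X i < r + n) ∧ ∀ e ∈ X i, c i e = s
  efx : EFX n c X
  final : 0 < avail n c s X n → ∀ i < n, FewSmall n c s r i (X i) ∨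
    (∃ e ∈ X i, Hits n c s n e) ∧ ((X i).card = 1 ∨ Tolerates n c X i (((n : ℝ) - 2) * l))

/-- A pick `f` of agent `i` respects the preferences: a small item if one is free, else an item
that is large for everybody if one is free. -/
def Prefers (n : ℕ) (c : ℕ → ℕ → ℝ) (s : ℝ) (X : ℕ → Finset ℕ) (i f : ℕ) : Prop :=
  Hits n c s i f ∨ avail n c s X i = 0 ∧ (Hits n c s n f ∨ avail n c s X n = 0)

/-- In the course of a round leading from `X₀` to `X`, agent `i` has picked the item `f`. -/
structure Pick (n : ℕ) (c : ℕ → ℕ → ℝ) (s : ℝ) (X₀ X : ℕ → Finset ℕ) (i f : ℕ) : Prop where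
  free : f ∈ X₀ n
  notMem : f ∉ X₀ i
  bundle : X i = insert f (X₀ i)
  prefers : Prefers n c s X i f
  small : n ≤ avail n c s X₀ i → c i f = s

/-- `X` arises from `X₀` by picks of the agents `0, …, k - 1`. -/
structure Picked (n m : ℕ) (c : ℕ → ℕ → ℝ) (s : ℝ) (X₀ : ℕ → Finset ℕ) (k : ℕ)
    (X : ℕ → Finset ℕ) : Prop where
  pick : ∀ i < k, ∃ f, Pick n c s X₀ X i f
  untouched : ∀ i, k ≤ i → i < n → X i = X₀ i
  rest_subset : X n ⊆ X₀ n
  subset : ∀ j ≤ n, X j ⊆ Finset.range m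
  avail_le : ∀ v, avail n c s X₀ v ≤ avail n c s X v + k

namespace FewSmall

variable {i : ℕ} (h : FewSmall n c s r i (X i))
include h

theorem setCost_sub_le (hs : 0 ≤ s) :
    setCost c i (X i) - s ≤ ((r : ℝ) - 1) * s + ((n : ℝ) - 1) * s := by
  have hcard : ((X i).card : ℝ) + 1 ≤ r + n := by exact_mod_cast h.card_lt
  rw [setCost_of_small h.small]
  nlinarith

theorem tolerates (hI : Separated n m c s l) (hi : i < n) (hsub : ∀ j ≤ n, X j ⊆ Finset.range m)
    (hr : 1 ≤ r) (hsize : ∀ j < n, r ≤ (X j).card) : Tolerates n c X i 0 := by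
  refine .of_sub_small hI hi (hsub i hi.le) fun j hj _ => ?_
  have hr' : (1 : ℝ) ≤ r := by exact_mod_cast hr
  have hrj : (r : ℝ) ≤ (X j).card := by exact_mod_cast hsize j hj
  have hn := hI.three_le
  have hrounds : 0 ≤ ((r : ℝ) - 1) * s := mul_nonneg (by linarith) hI.nonneg
  calc setCost c i (X i) - s + 0
      ≤ ((r : ℝ) - 1) * s + ((n : ℝ) - 1) * s := by linarith [h.setCost_sub_le hI.nonneg]
    _ ≤ ((n : ℝ) - 1) * (r * s) := by nlinarith
    _ ≤ ((n : ℝ) - 1) * ((X j).card * s) :=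
        mul_le_mul_of_nonneg_left (mul_le_mul_of_nonneg_right hrj hI.nonneg) (by linarith)
    _ ≤ ((n : ℝ) - 1) * setCost c i (X j) :=
        mul_le_mul_of_nonneg_left (hI.card_mul_le hi (hsub j hj.le)) (by linarith)

end FewSmall

theorem MainInv.give (hI : Separated n m c s l) {g f : ℕ} (h : MainInv n m c s l r X)
    (hG : Give n g f X X') (hf : c g f = s) (hlt : avail n c s X g < n) :
    MainInv n m c s l r X' := by
  have hg := hG.lt
  have havail := hG.avail_add_one (c := c) (s := s) ((hits_agent hg).2 hf)
  obtain ⟨hcount, hsmall⟩ := h.active g hg (by omega)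
  have hsub' := hG.subset_range h.subset
  have hsize' : ∀ j < n, r ≤ (X' j).card := fun j hj =>
    (h.size j hj).trans (Finset.card_le_card (hG.subset hj))
  have hcount' : (X' g).card + avail n c s X' g < r + n := by
    rw [hG.card_self]
    omega
  have hsmall' : ∀ e ∈ X' g, c g e = s := by
    rw [hG.self, Finset.forall_mem_insert]
    exact ⟨hf, hsmall⟩
  have hfew : FewSmall n c s r g (X' g) := ⟨hsmall', by omega⟩
  have hmono : ∀ v, avail n c s X' v ≤ avail n c s X v := fun v => avail_mono hG.rest_subset
  refine ⟨hsub', h.pos, hsize', fun i hi hav => ?_, fun i hi => ?_, fun hav i hi => ?_⟩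
  · rcases eq_or_ne i g with rfl | hig
    · exact ⟨.inr hcount', hsmall'⟩
    · rw [hG.other i hi hig]
      exact (h.active i hi (hav.trans_le (hmono i))).imp_left
        (Or.imp_right (Nat.add_le_add_left (hmono i) _).trans_lt)
  · rcases eq_or_ne i g with rfl | hig
    · exact hfew.tolerates hI hi hsub' h.pos hsize'
    · exact (h.efx i hi).give hI hi hig hG h.subset
  · rcases eq_or_ne i g with rfl | hig
    · exact .inl hfew
    · rw [hG.other i hi hig]
      exact (h.final (hav.trans_le (hmono n)) i hi).imp_right
        (And.imp_right (Or.imp_right fun htol => htol.give hI hi hig hG h.subset))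

theorem Prefers.mono {i f : ℕ} (h : Prefers n c s X i f) (hX : X' n ⊆ X n) :
    Prefers n c s X' i f :=
  have hzero : ∀ v, avail n c s X v = 0 → avail n c s X' v = 0 := fun _ hv =>
    Nat.eq_zero_of_le_zero ((avail_mono hX).trans_eq hv)
  h.imp_right (And.imp (hzero i) (Or.imp_right (hzero n)))

theorem Pick.mono {i f : ℕ} (h : Pick n c s X₀ X i f) (hself : X' i = X i) (hX : X' n ⊆ X n) :
    Pick n c s X₀ X' i f :=
  ⟨h.free, h.notMem, hself.trans h.bundle, h.prefers.mono hX, h.small⟩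

theorem Pick.card {i f : ℕ} (h : Pick n c s X₀ X i f) : (X i).card = (X₀ i).card + 1 := by
  rw [h.bundle, Finset.card_insert_of_notMem h.notMem]

namespace Picked

theorem zero (h : ∀ j ≤ n, X j ⊆ Finset.range m) : Picked n m c s X 0 X :=
  ⟨by simp, fun _ _ _ => rfl, subset_rfl, h, by simp⟩

theorem succ {k f : ℕ} (h : Picked n m c s X₀ k X) (hG : Give n k f X X')
    (hf : Prefers n c s X k f) : Picked n m c s X₀ (k + 1) X' := by
  refine ⟨fun i hi => ?_, fun i hi hin => ?_, hG.rest_subset.trans h.rest_subset,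
    hG.subset_range h.subset, fun v => ?_⟩
  · rcases Nat.lt_succ_iff_lt_or_eq.1 hi with hik | rfl
    · obtain ⟨f', hpick⟩ := h.pick i hik
      exact ⟨f', hpick.mono (hG.other i (hik.trans hG.lt) hik.ne) hG.rest_subset⟩
    · have hX := h.untouched i le_rfl hG.lt
      refine ⟨f, h.rest_subset hG.free, hX ▸ hG.notMem, hX ▸ hG.self, hf.mono hG.rest_subset,
        fun hav => ?_⟩
      have := h.avail_le i
      have := hG.lt
      exact (hits_agent hG.lt).1 (hf.resolve_right (by omega))
  · rw [hG.other i hin (by omega)]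
    exact h.untouched i (by omega) hin
  · have := h.avail_le v
    have := hG.avail_le_add_one (c := c) (s := s) (v := v)
    omega

theorem mainInv_one (hI : Separated n m c s l) (h : Picked n m c s X₀ n X)
    (h₀ : ∀ i < n, X₀ i = ∅) : MainInv n m c s l 1 X := by
  have hsingle : ∀ i < n, ∃ f, X i = {f} ∧ Prefers n c s X i f := fun i hi => by
    obtain ⟨f, hpick⟩ := h.pick i hi
    exact ⟨f, by simpa [h₀ i hi] using hpick.bundle, hpick.prefers⟩
  have hcard : ∀ i < n, (X i).card = 1 := fun i hi => by
    obtain ⟨f, hf, -⟩ := hsingle i hi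
    rw [hf, Finset.card_singleton]
  refine ⟨h.subset, le_rfl, fun j hj => (hcard j hj).ge, fun i hi hav => ⟨.inl (hcard i hi), ?_⟩,
    fun i hi j hj _ e he => ?_, fun hav i hi => ?_⟩
  · obtain ⟨f, hf, hpref⟩ := hsingle i hi
    simpa [hf] using (hits_agent hi).1 (hpref.resolve_right (by omega))
  · obtain ⟨f, hf, -⟩ := hsingle i hi
    rw [hf, Finset.mem_singleton] at he
    rw [hf, he, setCost_singleton, sub_self, zero_add]
    exact mul_nonneg (by linarith [hI.three_le]) (hI.setCost_nonneg hi (h.subset j hj.le))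
  · have hn := hI.four_le
    obtain ⟨f, hf, hsmall | ⟨-, hlarge | hnone⟩⟩ := hsingle i hi
    · exact .inl ⟨by simpa [hf] using (hits_agent hi).1 hsmall, by rw [hcard i hi]; omega⟩
    · exact .inr ⟨⟨f, by simp [hf], hlarge⟩, .inl (hcard i hi)⟩
    · omega

theorem small_of_avail (hI : Separated n m c s l) (h : Picked n m c s X₀ n X)
    (hX₀ : MainInv n m c s l r X₀) {i : ℕ}
    (hi : i < n) (hav : n ≤ avail n c s X₀ i) : (X i).card = r + 1 ∧ ∀ e ∈ X i, c i e = s := by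
  obtain ⟨f, hpick⟩ := h.pick i hi
  obtain ⟨hcard, hsmall⟩ := hX₀.active i hi (by have := hI.four_le; omega)
  refine ⟨by have := hX₀.size i hi; rw [hpick.card]; omega, ?_⟩
  rw [hpick.bundle, Finset.forall_mem_insert]
  exact ⟨hpick.small hav, hsmall⟩

/-- Every bundle has grown by an item that is large for agent `i`. -/
theorem tolerates_of_avail_eq_zero (hI : Separated n m c s l) (h : Picked n m c s X₀ n X)
    (hX₀ : MainInv n m c s l r X₀) {i : ℕ} (hi : i < n) (hav : avail n c s X₀ i = 0) :
    Tolerates n c X i (((n : ℝ) - 2) * l) := by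
  have hlarge : ∀ j f, Pick n c s X₀ X j f → c i f = l := fun j f hpick =>
    hI.eq_large_of_ne hi (Finset.mem_range.1 (hX₀.subset n le_rfl hpick.free)) fun hs =>
      avail_eq_zero_iff.1 hav f hpick.free ((hits_agent hi).2 hs)
  obtain ⟨f, hpick⟩ := h.pick i hi
  refine (hX₀.efx i hi).insert_large hI hi (hX₀.subset i hi.le)
    (Finset.card_pos.1 (hX₀.pos.trans (hX₀.size i hi))) hpick.notMem (hlarge i f hpick)
    hpick.bundle (g := l) (fun j hj _ => ?_) (by linarith)
  obtain ⟨f', hpick'⟩ := h.pick j hj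
  rw [hpick'.bundle, setCost_insert hpick'.notMem, hlarge j f' hpick']

theorem exists_hits_of_avail_eq_zero (h : Picked n m c s X₀ n X) {i : ℕ} (hi : i < n)
    (hav : avail n c s X₀ i = 0) (hpos : 0 < avail n c s X n) : ∃ e ∈ X i, Hits n c s n e := by
  obtain ⟨f, hpick⟩ := h.pick i hi
  refine ⟨f, by simp [hpick.bundle], ?_⟩
  rcases hpick.prefers with hsmall | ⟨-, hlarge | hnone⟩
  · exact absurd hsmall (avail_eq_zero_iff.1 hav f hpick.free)
  · exact hlarge
  · omega

theorem mainInv_succ (hI : Separated n m c s l) (h : Picked n m c s X₀ n X)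
    (hX₀ : MainInv n m c s l r X₀)
    (hav : ∀ i < n, avail n c s X₀ i = 0 ∨ n ≤ avail n c s X₀ i) :
    MainInv n m c s l (r + 1) X := by
  have hsize : ∀ j < n, r + 1 ≤ (X j).card := fun j hj => by
    obtain ⟨f, hpick⟩ := h.pick j hj
    rw [hpick.card]
    exact Nat.succ_le_succ (hX₀.size j hj)
  have hfew : ∀ i < n, n ≤ avail n c s X₀ i → FewSmall n c s (r + 1) i (X i) := fun i hi hge => by
    obtain ⟨hcard, hsmall⟩ := h.small_of_avail hI hX₀ hi hge
    exact ⟨hsmall, by omega⟩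
  refine ⟨h.subset, by omega, hsize, fun i hi hpos => ?_, fun i hi => ?_,
    fun hpos i hi => ?_⟩
  · have : avail n c s X i ≤ avail n c s X₀ i := avail_mono h.rest_subset
    exact (h.small_of_avail hI hX₀ hi ((hav i hi).resolve_left (by omega))).imp_left .inl
  · rcases hav i hi with h0 | hge
    · refine (h.tolerates_of_avail_eq_zero hI hX₀ hi h0).mono_left ?_
      exact mul_nonneg (by linarith [hI.three_le]) hI.pos.le
    · exact (hfew i hi hge).tolerates hI hi h.subset (by omega) hsize
  · rcases hav i hi with h0 | hge
    · exact .inr ⟨h.exists_hits_of_avail_eq_zero hi h0 hpos,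
        .inr (h.tolerates_of_avail_eq_zero hI hX₀ hi h0)⟩
    · exact .inl (hfew i hi hge)

end Picked

end Rounds

/-! ### Distribution of the last items -/

section Endgame

variable {n m : ℕ} {c : ℕ → ℕ → ℝ} {s l : ℝ} {r : ℕ} {X X' X'' : ℕ → Finset ℕ}

/-- Agent `i` owns no item that is large for everybody. -/
def Poor (n : ℕ) (c : ℕ → ℕ → ℝ) (s : ℝ) (X : ℕ → Finset ℕ) (i : ℕ) : Prop :=
  ∀ e ∈ X i, ¬ Hits n c s n e

/-- The situation after the main phase, in which `r` rounds have been played and all free items are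
large for everybody. -/
structure Ready (n m : ℕ) (c : ℕ → ℕ → ℝ) (s l : ℝ) (r : ℕ) (X : ℕ → Finset ℕ) : Prop where
  subset : ∀ j ≤ n, X j ⊆ Finset.range m
  pos : 1 ≤ r
  size : ∀ j < n, r ≤ (X j).card
  efx : EFX n c X
  poor : ∀ i < n, Poor n c s X i → FewSmall n c s r i (X i)
  rich : ∀ i < n, ¬ Poor n c s X i → (X i).card = 1 ∨ Tolerates n c X i (((n : ℝ) - 2) * l)
  free : ∀ e ∈ X n, ∀ i < n, c i e = l

theorem MainInv.ready (hI : Separated n m c s l) (h : MainInv n m c s l r X)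
    (hav : ∀ i < n, avail n c s X i = 0) (hpos : 0 < avail n c s X (n + 1)) :
    Ready n m c s l r X := by
  have hfree : ∀ e ∈ X n, ∀ i < n, c i e ≠ s := fun e he i hi hs =>
    avail_eq_zero_iff.1 (hav i hi) e he ((hits_agent hi).2 hs)
  have hlarge : 0 < avail n c s X n := by
    obtain ⟨e, he, -⟩ := avail_pos_iff.1 hpos
    exact avail_pos_iff.2 ⟨e, he, hits_none.2 (hfree e he)⟩
  refine ⟨h.subset, h.pos, h.size, h.efx, fun i hi hpoor => ?_, fun i hi hrich => ?_,
    fun e he i hi =>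
      hI.eq_large_of_ne hi (Finset.mem_range.1 (h.subset n le_rfl he)) (hfree e he i hi)⟩
  · exact (h.final hlarge i hi).resolve_right fun ⟨⟨e, he, hhits⟩, _⟩ => hpoor e he hhits
  · refine ((h.final hlarge i hi).resolve_left fun hfew => hrich fun e he hhits => ?_).2
    exact hits_none.1 hhits i hi (hfew.small e he)

/-- Every agent in `D` has received one free item, and no other agent has received anything. -/
structure Gifts (n : ℕ) (D : Finset ℕ) (X X' : ℕ → Finset ℕ) : Prop where
  gift : ∀ i < n, i ∈ D → ∃ f ∈ X n, f ∉ X i ∧ X' i = insert f (X i)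
  keep : ∀ i < n, i ∉ D → X' i = X i
  rest : X' n ⊆ X n
  card : (X' n).card + D.card = (X n).card

namespace Gifts

theorem empty : Gifts n ∅ X X := ⟨by simp, by simp, subset_rfl, by simp⟩

theorem give {D : Finset ℕ} {i f : ℕ} (h : Gifts n D X X') (hi : i ∉ D)
    (hG : Give n i f X' X'') : Gifts n (insert i D) X X'' := by
  refine ⟨fun j hj hjD => ?_, fun j hj hjD => ?_, hG.rest_subset.trans h.rest, ?_⟩
  · rcases eq_or_ne j i with rfl | hji
    · have hX := h.keep j hj hi
      exact ⟨f, h.rest hG.free, hX ▸ hG.notMem, hX ▸ hG.self⟩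
    · rw [hG.other j hj hji]
      exact h.gift j hj ((Finset.mem_insert.1 hjD).resolve_left hji)
  · obtain ⟨hji, hjD⟩ := not_or.1 (mt Finset.mem_insert.2 hjD)
    rw [hG.other j hj hji]
    exact h.keep j hj hjD
  · rw [Finset.card_insert_of_notMem hi, ← h.card, ← hG.card_rest]
    omega

theorem subset {D : Finset ℕ} {j : ℕ} (h : Gifts n D X X') (hj : j < n) : X j ⊆ X' j := by
  by_cases hjD : j ∈ D
  · obtain ⟨f, -, -, hX'⟩ := h.gift j hj hjD
    rw [hX']
    exact Finset.subset_insert _ _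
  · rw [h.keep j hj hjD]

end Gifts

namespace Ready

theorem nonempty {i : ℕ} (h : Ready n m c s l r X) (hi : i < n) : (X i).Nonempty :=
  Finset.card_pos.1 (h.pos.trans (h.size i hi))

theorem large_of_not_poor (hI : Separated n m c s l) (h : Ready n m c s l r X) {i j : ℕ}
    (hi : i < n) (hj : j < n) (hp : ¬ Poor n c s X j) : ∃ e ∈ X j, c i e = l := by
  simp only [Poor, not_forall, not_not] at hp
  obtain ⟨e, he, hhits⟩ := hp
  exact ⟨e, he, hI.large_of_hits hi (Finset.mem_range.1 (h.subset j hj.le he)) hhits⟩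

theorem poor_rich (hI : Separated n m c s l) (h : Ready n m c s l r X) {i j : ℕ}
    (hi : i < n) (hj : j < n) (hpi : Poor n c s X i) (hpj : ¬ Poor n c s X j) :
    setCost c i (X i) - s + l ≤ ((n : ℝ) - 1) * setCost c i (X j) := by
  obtain ⟨e, he, hlarge⟩ := h.large_of_not_poor hI hi hj hpj
  have hr : (1 : ℝ) ≤ r := by exact_mod_cast h.pos
  have hrj : (r : ℝ) ≤ (X j).card := by exact_mod_cast h.size j hj
  have hn := hI.three_le
  have hrounds : 0 ≤ ((r : ℝ) - 1) * s := mul_nonneg (by linarith) hI.nonneg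
  have hj' : ((r : ℝ) - 1) * s + l ≤ setCost c i (X j) := by
    nlinarith [hI.card_mul_add_le hi (h.subset j hj.le) he hlarge, hI.nonneg]
  calc setCost c i (X i) - s + l
      ≤ ((r : ℝ) - 1) * s + ((n : ℝ) - 1) * s + l := by
        linarith [(h.poor i hi hpi).setCost_sub_le hI.nonneg]
    _ ≤ ((n : ℝ) - 1) * (((r : ℝ) - 1) * s + l) := by nlinarith [hI.mul_small_le]
    _ ≤ ((n : ℝ) - 1) * setCost c i (X j) := mul_le_mul_of_nonneg_left hj' (by linarith)

section Gifted

variable {D : Finset ℕ} {i f : ℕ}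

theorem tolerates_gifted_poor (hI : Separated n m c s l) (h : Ready n m c s l r X)
    (hD : ∀ i < n, Poor n c s X i → i ∈ D) (hG : Gifts n D X X')
    (hX' : ∀ j ≤ n, X' j ⊆ Finset.range m) (hi : i < n) (hf : f ∈ X n) (hfi : f ∉ X i)
    (hself : X' i = insert f (X i)) (hpoor : Poor n c s X i) : Tolerates n c X' i 0 := by
  refine .of_sub_small hI hi (hX' i hi.le) fun j hj hij => ?_
  have hn := hI.three_le
  rw [hself, setCost_insert hfi, h.free f hf i hi]
  by_cases hpj : Poor n c s X j
  · obtain ⟨f', hf', hfj, hX'j⟩ := hG.gift j hj (hD j hj hpj)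
    rw [hX'j, setCost_insert hfj, h.free f' hf' i hi]
    have := (h.efx i hi).sub_small_le (h.nonempty hi) (h.poor i hi hpoor).small hj hij
    nlinarith [hI.pos]
  · have hgrow := hI.setCost_mono hi (hG.subset hj) (hX' j hj.le)
    nlinarith [h.poor_rich hI hi hj hpoor hpj]

theorem large_le_setCost_gifted (hI : Separated n m c s l) (h : Ready n m c s l r X)
    (hD : ∀ i < n, Poor n c s X i → i ∈ D) (hG : Gifts n D X X')
    (hX' : ∀ j ≤ n, X' j ⊆ Finset.range m) {j : ℕ} (hi : i < n) (hj : j < n) :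
    l ≤ setCost c i (X' j) := by
  by_cases hpj : Poor n c s X j
  · obtain ⟨f, hf, -, hX'j⟩ := hG.gift j hj (hD j hj hpj)
    exact hI.large_le_setCost hi (hX' j hj.le) (by simp [hX'j]) (h.free f hf i hi)
  · obtain ⟨e, he, hlarge⟩ := h.large_of_not_poor hI hi hj hpj
    exact hI.large_le_setCost hi (hX' j hj.le) (hG.subset hj he) hlarge

/-- Of two large items one is removed, and everybody else owns a large item. -/
theorem tolerates_gifted_singleton (hI : Separated n m c s l) (h : Ready n m c s l r X)
    (hD : ∀ i < n, Poor n c s X i → i ∈ D) (hG : Gifts n D X X')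
    (hX' : ∀ j ≤ n, X' j ⊆ Finset.range m) (hi : i < n) (hf : f ∈ X n) (hfi : f ∉ X i)
    (hself : X' i = insert f (X i)) (hrich : ¬ Poor n c s X i) (hone : (X i).card = 1) :
    Tolerates n c X' i 0 := by
  intro j hj _ e he
  obtain ⟨e₀, hXi⟩ := Finset.card_eq_one.1 hone
  have he₀ : c i e₀ = l := by simpa [hXi] using h.large_of_not_poor hI hi hi hrich
  have hf_large := h.free f hf i hi
  have he_large : c i e = l := by
    rw [hself, hXi, Finset.mem_insert, Finset.mem_singleton] at he
    rcases he with rfl | rfl <;> assumption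
  rw [hself, setCost_insert hfi, hXi, setCost_singleton, he₀, hf_large, he_large]
  nlinarith [hI.three_le, hI.pos, h.large_le_setCost_gifted hI hD hG hX' hi hj]

theorem efx_of_gifts (hI : Separated n m c s l) (h : Ready n m c s l r X)
    (hD : ∀ i < n, Poor n c s X i → i ∈ D) (hG : Gifts n D X X')
    (hX' : ∀ j ≤ n, X' j ⊆ Finset.range m) : EFX n c X' := by
  intro i hi
  by_cases hiD : i ∈ D
  · obtain ⟨f, hf, hfi, hself⟩ := hG.gift i hi hiD
    by_cases hpoor : Poor n c s X i
    · exact h.tolerates_gifted_poor hI hD hG hX' hi hf hfi hself hpoor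
    rcases h.rich i hi hpoor with hone | htol
    · exact h.tolerates_gifted_singleton hI hD hG hX' hi hf hfi hself hpoor hone
    · refine htol.insert_large hI hi (g := 0) (h.subset i hi.le) (h.nonempty hi) hfi
        (h.free f hf i hi) hself (fun j hj _ => ?_) (by nlinarith [hI.three_le, hI.pos])
      rw [add_zero]
      exact hI.setCost_mono hi (hG.subset hj) (hX' j hj.le)
  · exact (h.efx i hi).grow hI hi (hG.keep i hi hiD) (fun _ hj => hG.subset hj) hX'

end Gifted

end Ready

/-- Agent `k` can receive all free items. -/
structure FeedInv (n m : ℕ) (c : ℕ → ℕ → ℝ) (l : ℝ) (k : ℕ) (X : ℕ → Finset ℕ) : Prop where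
  subset : ∀ j ≤ n, X j ⊆ Finset.range m
  nonempty : (X k).Nonempty
  efx : ∀ i < n, i ≠ k → Tolerates n c X i 0
  tolerates : Tolerates n c X k ((X n).card * l)
  free : ∀ e ∈ X n, c k e = l

theorem Ready.feed (hI : Separated n m c s l) {k : ℕ} (h : Ready n m c s l r X) (hk : k < n)
    (hp : ¬ Poor n c s X k) (hc : 2 ≤ (X k).card) (hR : (X n).card + 2 ≤ n) :
    FeedInv n m c l k X where
  subset := h.subset
  nonempty := h.nonempty hk
  efx i hi _ := h.efx i hi
  tolerates := by
    refine ((h.rich k hk hp).resolve_left (by omega)).mono_left ?_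
    have : ((X n).card : ℝ) + 2 ≤ n := by exact_mod_cast hR
    exact mul_le_mul_of_nonneg_right (by linarith) hI.pos.le
  free e he := h.free e he k hk

theorem FeedInv.give (hI : Separated n m c s l) {k f : ℕ} (h : FeedInv n m c l k X)
    (hG : Give n k f X X') : FeedInv n m c l k X' := by
  have hsub := hG.subset_range h.subset
  have hcard : ((X' n).card : ℝ) + 1 = (X n).card := by exact_mod_cast hG.card_rest
  refine ⟨hsub, h.nonempty.mono (hG.subset hG.lt),
    fun i hi hik => (h.efx i hi hik).give hI hi hik hG h.subset, ?_,
    fun e he => h.free e (hG.rest_subset he)⟩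
  refine h.tolerates.insert_large hI hG.lt (g := 0) (h.subset k hG.lt.le) h.nonempty hG.notMem
    (h.free f hG.free) hG.self (fun j hj _ => ?_) (by rw [← hcard]; linarith)
  rw [add_zero]
  exact hI.setCost_mono hG.lt (hG.subset hj) (hsub j hj.le)

end Endgame

section Split

variable {n m : ℕ} {c : ℕ → ℕ → ℝ} {s l : ℝ} {r : ℕ} {W : ℕ → Prop} {X X' : ℕ → Finset ℕ}

/-- The invariant while the free items are given one by one to agents in `W`, a set of agents all
of whose items are small for themselves; an agent that receives a free item leaves `W`. The last
three fields before `free` provide the slack that the next step needs. -/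
structure SplitInv (n m : ℕ) (c : ℕ → ℕ → ℝ) (s l : ℝ) (r : ℕ) (W : ℕ → Prop)
    (X : ℕ → Finset ℕ) : Prop where
  subset : ∀ j ≤ n, X j ⊆ Finset.range m
  pos : 1 ≤ r
  efx : EFX n c X
  small : ∀ i < n, W i → ∀ e ∈ X i, c i e = s
  size : ∀ i < n, W i → r ≤ (X i).card
  large : ∀ j < n, ¬ W j → ∀ i < n, l ≤ setCost c i (X j)
  tolerant : ∀ i < n, W i → ∀ j < n, ¬ W j →
    setCost c i (X i) - s + l ≤ ((n : ℝ) - 1) * setCost c i (X j)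
  light : 2 * (r * s) < l → ∀ i < n, ∀ e ∈ X i,
    setCost c i (X i) - c i e ≤ ((n : ℝ) - 1) * l
  lighter : 2 * (r * s) < l → ∀ i < n, W i →
    setCost c i (X i) - s ≤ ((n : ℝ) - 2) * l
  free : ∀ e ∈ X n, ∀ i < n, c i e = l

theorem FewSmall.setCost_sub_le_of_two_mul_lt (hI : Separated n m c s l) {i : ℕ} {S : Finset ℕ}
    (h : FewSmall n c s r i S) (hrs : 2 * (r * s) < l) :
    setCost c i S - s ≤ ((n : ℝ) - 2) * l := by
  have hn := hI.three_le
  have hcard : (S.card : ℝ) + 1 ≤ r + n := by exact_mod_cast h.card_lt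
  have hcost : (S.card : ℝ) * s ≤ (r + n - 1) * s :=
    mul_le_mul_of_nonneg_right (by linarith) hI.nonneg
  rw [setCost_of_small h.small]
  nlinarith [hI.two_mul_lt, hI.nonneg]

theorem Ready.split (hI : Separated n m c s l) (h : Ready n m c s l r X)
    (hc : ∀ i < n, ¬ Poor n c s X i → (X i).card < 2) :
    SplitInv n m c s l r (Poor n c s X) X := by
  have hl : 0 ≤ ((n : ℝ) - 1) * l := mul_nonneg (by linarith [hI.three_le]) hI.pos.le
  refine ⟨h.subset, h.pos, h.efx, fun i hi hp => (h.poor i hi hp).small, fun i hi _ => h.size i hi,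
    fun j hj hp i hi => ?_, fun i hi hpi j hj hpj => h.poor_rich hI hi hj hpi hpj,
    fun hrs i hi e he => ?_,
    fun hrs i hi hp => (h.poor i hi hp).setCost_sub_le_of_two_mul_lt hI hrs, h.free⟩
  · obtain ⟨e, he, hlarge⟩ := h.large_of_not_poor hI hi hj hp
    exact hI.large_le_setCost hi (h.subset j hj.le) he hlarge
  · by_cases hp : Poor n c s X i
    · have := (h.poor i hi hp).setCost_sub_le_of_two_mul_lt hI hrs
      linarith [hI.sub_cost_le hi (h.subset i hi.le) he, hI.pos]
    · have hcard : 0 < (X i).card := Finset.card_pos.2 ⟨e, he⟩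
      have hone : (X i).card = 1 := by
        have := hc i hi hp
        omega
      obtain ⟨e₀, hXi⟩ := Finset.card_eq_one.1 hone
      rw [hXi, Finset.mem_singleton] at he
      rwa [hXi, he, setCost_singleton, sub_self]

section Take

variable {i f : ℕ}

theorem SplitInv.tolerates_take (hI : Separated n m c s l) (h : SplitInv n m c s l r W X)
    (hW : W i) (hmin : ∀ j < n, W j → j ≠ i → (X i).card ≤ (X j).card)
    (hge : ∀ j < n, W j → j ≠ i → l ≤ 2 * setCost c i (X j)) (hG : Give n i f X X') :
    Tolerates n c X' i 0 := by
  have hi := hG.lt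
  refine .of_sub_small hI hi (hG.subset_range h.subset i hi.le) fun j hj hij => ?_
  rw [hG.self, setCost_insert hG.notMem, h.free f hG.free i hi, hG.other j hj hij.symm]
  by_cases hWj : W j
  · have hcard : ((X i).card : ℝ) ≤ (X j).card := by exact_mod_cast hmin j hj hWj hij.symm
    have hXi : setCost c i (X i) ≤ setCost c i (X j) := by
      rw [setCost_of_small (h.small i hi hW)]
      exact (mul_le_mul_of_nonneg_right hcard hI.nonneg).trans
        (hI.card_mul_le hi (h.subset j hj.le))
    have hthree := mul_le_mul_of_nonneg_right hI.three_le
      (hI.setCost_nonneg hi (h.subset j hj.le))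
    linarith [hge j hj hWj hij.symm, hI.nonneg]
  · linarith [h.tolerant i hi hW j hj hWj]

theorem SplitInv.take (hI : Separated n m c s l) (h : SplitInv n m c s l r W X) (hW : W i)
    (hmin : ∀ j < n, W j → j ≠ i → (X i).card ≤ (X j).card)
    (hge : ∀ j < n, W j → j ≠ i → l ≤ 2 * setCost c i (X j)) (hG : Give n i f X X') :
    SplitInv n m c s l r (fun j => W j ∧ j ≠ i) X' := by
  have hi := hG.lt
  have hsub := hG.subset_range h.subset
  have hgain : ∀ k < n, setCost c k (X' i) = setCost c k (X i) + l := fun k hk => by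
    rw [hG.self, setCost_insert hG.notMem, h.free f hG.free k hk]
  refine ⟨hsub, h.pos, fun k hk => ?_, ?_, ?_, fun j hj hWj k hk => ?_, ?_,
    fun hrs k hk e he => ?_, ?_, fun e he => h.free e (hG.rest_subset he)⟩
  · rcases eq_or_ne k i with rfl | hki
    · exact h.tolerates_take hI hW hmin hge hG
    · exact (h.efx k hk).give hI hk hki hG h.subset
  · rintro k hk ⟨hWk, hki⟩
    rw [hG.other k hk hki]
    exact h.small k hk hWk
  · rintro k hk ⟨hWk, hki⟩
    rw [hG.other k hk hki]
    exact h.size k hk hWk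
  · rcases eq_or_ne j i with rfl | hji
    · linarith [hgain k hk, hI.setCost_nonneg hk (h.subset j hj.le)]
    · rw [hG.other j hj hji]
      exact h.large j hj (fun hw => hWj ⟨hw, hji⟩) k hk
  · rintro k hk ⟨hWk, hki⟩ j hj hWj
    rw [hG.other k hk hki]
    rcases eq_or_ne j i with rfl | hji
    · have hne : (X k).Nonempty := Finset.card_pos.1 (h.pos.trans (h.size k hk hWk))
      have := (h.efx k hk).sub_small_le hne (h.small k hk hWk) hj hki
      rw [hgain k hk]
      nlinarith [hI.pos, hI.three_le]
    · rw [hG.other j hj hji]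
      exact h.tolerant k hk hWk j hj fun hw => hWj ⟨hw, hji⟩
  · rcases eq_or_ne k i with rfl | hki
    · have hself := hI.sub_cost_le hk (hsub k hk.le) he
      linarith [hgain k hk, h.lighter hrs k hk hW]
    · rw [hG.other k hk hki] at he ⊢
      exact h.light hrs k hk e he
  · rintro hrs k hk ⟨hWk, hki⟩
    rw [hG.other k hk hki]
    exact h.lighter hrs k hk hWk

end Take

/-- Agent `i` has taken over the bundle of agent `j`, which has received the free item `f`
instead. -/
structure Merge (n i j f : ℕ) (X X' : ℕ → Finset ℕ) : Prop where
  lt_left : i < n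
  lt_right : j < n
  free : f ∈ X n
  left : X' i = X i ∪ X j
  right : X' j = {f}
  rest : X' n ⊆ X n
  other : ∀ k < n, k ≠ i → k ≠ j → X' k = X k

/-- Agent `i` owns fewest items among the agents in `W`. For agent `i`, among the bundles of the
other agents in `W`, that of agent `j` is cheapest, and it costs less than half a large item. -/
structure Mergeable (n : ℕ) (c : ℕ → ℕ → ℝ) (l : ℝ) (W : ℕ → Prop) (X : ℕ → Finset ℕ)
    (i j : ℕ) : Prop where
  left : W i
  right : W j
  disjoint : Disjoint (X i) (X j)
  card_le : ∀ k < n, W k → (X i).card ≤ (X k).card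
  cheapest : ∀ k < n, W k → k ≠ i → setCost c i (X j) ≤ setCost c i (X k)
  cheap : 2 * setCost c i (X j) < l

namespace Mergeable

variable {i j : ℕ} (hI : Separated n m c s l) (hM : Mergeable n c l W X i j)
  (h : SplitInv n m c s l r W X) (hi : i < n) (hj : j < n)
include hI hM h hi hj

theorem small_right : ∀ e ∈ X j, c i e = s := fun e he => by
  by_contra hne
  have hsub := h.subset j hj.le
  have := hI.large_le_setCost hi hsub he
    (hI.eq_large_of_ne hi (Finset.mem_range.1 (hsub he)) hne)
  linarith [hM.cheap, hI.pos]

theorem two_mul_lt : 2 * (r * s) < l := by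
  have hr : (r : ℝ) ≤ (X j).card := by exact_mod_cast h.size j hj hM.right
  have hcard := hI.card_mul_le hi (h.subset j hj.le)
  linarith [hM.cheap, mul_le_mul_of_nonneg_right hr hI.nonneg]

theorem setCost_left_le : setCost c i (X i) ≤ setCost c i (X j) := by
  have hcard : ((X i).card : ℝ) ≤ (X j).card := by exact_mod_cast hM.card_le j hj hM.right
  rw [setCost_of_small (h.small i hi hM.left)]
  exact (mul_le_mul_of_nonneg_right hcard hI.nonneg).trans (hI.card_mul_le hi (h.subset j hj.le))

end Mergeable

namespace Merge

variable {i j f : ℕ}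

theorem subset (hG : Merge n i j f X X') (hX : ∀ k ≤ n, X k ⊆ Finset.range m) :
    ∀ k ≤ n, X' k ⊆ Finset.range m := by
  intro k hk
  rcases hk.lt_or_eq with hk | rfl
  · by_cases hki : k = i
    · rw [hki, hG.left]
      exact Finset.union_subset (hX i hG.lt_left.le) (hX j hG.lt_right.le)
    · by_cases hkj : k = j
      · rw [hkj, hG.right, Finset.singleton_subset_iff]
        exact hX n le_rfl hG.free
      · rw [hG.other k hk hki hkj]
        exact hX k hk.le
  · exact hG.rest.trans (hX k le_rfl)

theorem setCost_left (hG : Merge n i j f X X') (hd : Disjoint (X i) (X j)) (k : ℕ) :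
    setCost c k (X' i) = setCost c k (X i) + setCost c k (X j) := by
  rw [hG.left, setCost, Finset.sum_union hd, setCost, setCost]

section Invariant

variable (hI : Separated n m c s l) (h : SplitInv n m c s l r W X) (hM : Mergeable n c l W X i j)
  (hG : Merge n i j f X X')

theorem setCost_right (h : SplitInv n m c s l r W X) (hG : Merge n i j f X X') {k : ℕ}
    (hk : k < n) : setCost c k (X' j) = l := by
  rw [hG.right, setCost_singleton, h.free f hG.free k hk]

include hI h hG in
theorem tolerates_right : Tolerates n c X' j 0 := by
  intro k hk _ e he
  rw [hG.right, Finset.mem_singleton] at he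
  rw [hG.right, he, setCost_singleton, sub_self, zero_add]
  exact mul_nonneg (by linarith [hI.three_le])
    (hI.setCost_nonneg hG.lt_right (hG.subset h.subset k hk.le))

include hI h hM hG

theorem setCost_left_le : setCost c i (X' i) ≤ 2 * setCost c i (X j) := by
  linarith [hG.setCost_left (c := c) hM.disjoint i,
    hM.setCost_left_le hI h hG.lt_left hG.lt_right]

theorem tolerates_left : Tolerates n c X' i 0 := by
  have hi := hG.lt_left
  have hcost := hG.setCost_left_le hI h hM
  have hn := hI.three_le
  refine .of_sub_small hI hi (hG.subset h.subset i hi.le) fun k hk hik => ?_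
  by_cases hkj : k = j
  · rw [hkj, hG.setCost_right h hi]
    nlinarith [hM.cheap, hI.pos, hI.nonneg]
  · rw [hG.other k hk hik.symm hkj]
    by_cases hWk : W k
    · have hcheapest := hM.cheapest k hk hWk hik.symm
      have hnonneg := hI.setCost_nonneg hi (h.subset j hG.lt_right.le)
      nlinarith [hI.nonneg]
    · nlinarith [h.large k hk hWk i hi, hM.cheap, hI.nonneg, hI.pos]

theorem tolerates_other {k : ℕ} (hk : k < n) (hki : k ≠ i) (hkj : k ≠ j) :
    Tolerates n c X' k 0 := by
  intro k' hk' hne e he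
  rw [hG.other k hk hki hkj] at he ⊢
  have hold := h.efx k hk k' hk' hne e he
  by_cases hk'j : k' = j
  · rw [hk'j, hG.setCost_right h hk, add_zero]
    exact h.light (hM.two_mul_lt hI h hG.lt_left hG.lt_right) k hk e he
  · by_cases hk'i : k' = i
    · have hj := hI.setCost_nonneg hk (h.subset j hG.lt_right.le)
      rw [hk'i] at hold ⊢
      rw [hG.setCost_left hM.disjoint]
      nlinarith [hI.three_le]
    · rwa [hG.other k' hk' hk'i hk'j]

theorem tolerant {k : ℕ} (hk : k < n) (hWk : W k) (hkj : k ≠ j) {k' : ℕ} (hk' : k' < n)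
    (hWk' : ¬ (W k' ∧ k' ≠ j)) :
    setCost c k (X' k) - s + l ≤ ((n : ℝ) - 1) * setCost c k (X' k') := by
  have hcost := hG.setCost_left_le hI h hM
  have hn := hI.three_le
  have hmax : k = i → ∀ y, l ≤ y → setCost c k (X' k) - s + l ≤ ((n : ℝ) - 1) * y := by
    rintro rfl y hy
    nlinarith [hM.cheap, hI.pos, hI.nonneg]
  by_cases hk'j : k' = j
  · rw [hk'j, hG.setCost_right h hk]
    by_cases hki : k = i
    · exact hmax hki l le_rfl
    · rw [hG.other k hk hki hkj]
      linarith [h.lighter (hM.two_mul_lt hI h hG.lt_left hG.lt_right) k hk hWk]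
  · have hWk' : ¬ W k' := fun hw => hWk' ⟨hw, hk'j⟩
    rw [hG.other k' hk' (by rintro rfl; exact hWk' hM.left) hk'j]
    by_cases hki : k = i
    · exact hmax hki _ (h.large k' hk' hWk' k hk)
    · rw [hG.other k hk hki hkj]
      exact h.tolerant k hk hWk k' hk' hWk'

theorem light {k : ℕ} (hk : k < n) : ∀ e ∈ X' k,
    setCost c k (X' k) - c k e ≤ ((n : ℝ) - 1) * l := by
  intro e he
  have hn := hI.three_le
  have hl := hI.pos
  by_cases hkj : k = j
  · subst hkj
    rw [hG.right, Finset.mem_singleton] at he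
    rw [hG.right, he, setCost_singleton, sub_self]
    exact mul_nonneg (by linarith) hl.le
  · by_cases hki : k = i
    · subst hki
      have hself := hI.sub_cost_le hk (hG.subset h.subset k hk.le) he
      nlinarith [hG.setCost_left_le hI h hM, hM.cheap, hI.nonneg]
    · rw [hG.other k hk hki hkj] at he ⊢
      exact h.light (hM.two_mul_lt hI h hG.lt_left hG.lt_right) k hk e he

theorem lighter {k : ℕ} (hk : k < n) (hWk : W k) (hkj : k ≠ j) :
    setCost c k (X' k) - s ≤ ((n : ℝ) - 2) * l := by
  by_cases hki : k = i
  · subst hki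
    nlinarith [hG.setCost_left_le hI h hM, hM.cheap, hI.three_le, hI.nonneg, hI.pos]
  · rw [hG.other k hk hki hkj]
    exact h.lighter (hM.two_mul_lt hI h hG.lt_left hG.lt_right) k hk hWk

theorem splitInv : SplitInv n m c s l r (fun k => W k ∧ k ≠ j) X' := by
  have hi := hG.lt_left
  have hj := hG.lt_right
  refine ⟨hG.subset h.subset, h.pos, fun k hk => ?_, ?_, ?_, fun k hk hWk k' hk' => ?_,
    fun k hk hWk k' hk' => hG.tolerant hI h hM hk hWk.1 hWk.2 hk',
    fun _ k hk => hG.light hI h hM hk, fun _ k hk hWk => hG.lighter hI h hM hk hWk.1 hWk.2,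
    fun e he => h.free e (hG.rest he)⟩
  · by_cases hkj : k = j
    · exact hkj ▸ hG.tolerates_right hI h
    · by_cases hki : k = i
      · exact hki ▸ hG.tolerates_left hI h hM
      · exact hG.tolerates_other hI h hM hk hki hkj
  · rintro k hk ⟨hWk, hkj⟩ e he
    by_cases hki : k = i
    · subst hki
      rw [hG.left] at he
      exact (Finset.mem_union.1 he).elim (h.small k hk hWk e) (hM.small_right hI h hk hj e)
    · rw [hG.other k hk hki hkj] at he
      exact h.small k hk hWk e he
  · rintro k hk ⟨hWk, hkj⟩
    by_cases hki : k = i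
    · subst hki
      rw [hG.left]
      exact (h.size k hk hWk).trans (Finset.card_le_card Finset.subset_union_left)
    · rw [hG.other k hk hki hkj]
      exact h.size k hk hWk
  · by_cases hkj : k = j
    · rw [hkj, hG.setCost_right h hk']
    · have hWk' : ¬ W k := fun hw => hWk ⟨hw, hkj⟩
      rw [hG.other k hk (by rintro rfl; exact hWk' hM.left) hkj]
      exact h.large k hk hWk' k' hk'

end Invariant

end Merge

end Split

/-! ### Memory layout -/

/-- Array of the receivers of the items; `n` stands for a free item. -/
@[simp] abbrev owner : ℕ := 1

/-- Array holding the relation `Hits`. -/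
@[simp] abbrev hitTable : ℕ := 2

/-- Array of the numbers `avail`. -/
@[simp] abbrev availCount : ℕ := 3

/-- Array that gives, for every `v < n + 2`, an item before which nothing is free and hit by `v`. -/
@[simp] abbrev pointer : ℕ := 4

/-- Scalar: the agent that picks. -/
@[simp] abbrev agent : ℕ := 10

/-- Scalar: the preference with which the agent picks. -/
@[simp] abbrev target : ℕ := 11

/-- Scalar: the item that is picked. -/
@[simp] abbrev pickedItem : ℕ := 12

/-- Scalar: a loop counter of `pick`. -/
@[simp] abbrev pickLoop : ℕ := 13

/-- The number of agents. -/
abbrev numAgents : NatExpr := .cell 0 (.const 0) (.const 0)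

/-- The number of items. -/
abbrev numItems : NatExpr := .cell 0 (.const 0) (.const 1)

/-- The memories `σ` and `σ'` agree except for the natural number arrays in `A` and the real arrays
in `B`. -/
structure SameExcept (A : List ℕ) (σ σ' : Store) (B : List ℕ := []) : Prop where
  real : ∀ a, a ∉ B → σ'.real a = σ.real a
  nat : ∀ a, a ∉ A → σ'.nat a = σ.nat a

namespace SameExcept

variable {A A' B B' : List ℕ} {σ σ' σ'' : Store}

theorem refl : SameExcept A σ σ B := ⟨fun _ _ => rfl, fun _ _ => rfl⟩

theorem trans (h : SameExcept A σ σ' B) (h' : SameExcept A σ' σ'' B) : SameExcept A σ σ'' B :=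
  ⟨fun a ha => (h'.real a ha).trans (h.real a ha), fun a ha => (h'.nat a ha).trans (h.nat a ha)⟩

theorem mono (h : SameExcept A σ σ' B) (hA : A ⊆ A' := by simp) (hB : B ⊆ B' := by simp) :
    SameExcept A' σ σ' B' :=
  ⟨fun a ha => h.real a fun ha' => ha (hB ha'), fun a ha => h.nat a fun ha' => ha (hA ha')⟩

theorem write {a i j v : ℕ} (h : SameExcept A σ σ' B) (ha : a ∈ A := by simp) :
    SameExcept A σ (σ'.writeNat a i j v) B :=
  ⟨h.real, fun a' ha' => by
    rw [Store.nat_writeNat_of_ne (by rintro rfl; exact ha' ha)]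
    exact h.nat a' ha'⟩

theorem writeReal {a i j : ℕ} {v : ℝ} (h : SameExcept A σ σ' B) (ha : a ∈ B := by simp) :
    SameExcept A σ (σ'.writeReal a i j v) B :=
  ⟨fun a' ha' => by
    rw [Store.real_writeReal_of_ne (by rintro rfl; exact ha' ha)]
    exact h.real a' ha', h.nat⟩

end SameExcept

/-- The bundle of `j` under the owner function `o`. -/
def bundle (m : ℕ) (o : ℕ → ℕ) (j : ℕ) : Finset ℕ := {e ∈ Finset.range m | o e = j}

/-- The partial allocation recorded in the memory. -/
abbrev bundles (m : ℕ) (σ : Store) : ℕ → Finset ℕ := bundle m (σ.nat owner 0)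

theorem mem_bundle {m j e : ℕ} {o : ℕ → ℕ} : e ∈ bundle m o j ↔ e < m ∧ o e = j := by
  simp [bundle]

theorem bundle_subset {m j : ℕ} {o : ℕ → ℕ} : bundle m o j ⊆ Finset.range m :=
  Finset.filter_subset _ _

theorem give_update {n m i f : ℕ} {o : ℕ → ℕ} (hi : i < n) (hf : f < m) (ho : o f = n) :
    Give n i f (bundle m o) (bundle m (Function.update o f i)) where
  lt := hi
  free := mem_bundle.2 ⟨hf, ho⟩
  notMem hmem := by
    have := (mem_bundle.1 hmem).2
    omega
  self := by
    ext e
    rcases eq_or_ne e f with rfl | he <;> simp [mem_bundle, *]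
  rest := by
    ext e
    rcases eq_or_ne e f with rfl | he <;> simp [mem_bundle, hi.ne, *]
  other j hj hji := by
    ext e
    rcases eq_or_ne e f with rfl | he
    · simp [mem_bundle, ho, hj.ne', hji.symm]
    · simp [mem_bundle, he]

/-- The data structure used by the picking procedure. -/
structure State (n m : ℕ) (c : ℕ → ℕ → ℝ) (s : ℝ) (σ : Store) : Prop where
  agents : σ.nat 0 0 0 = n
  items : σ.nat 0 0 1 = m
  owner_le : ∀ e < m, σ.nat owner 0 e ≤ n
  hits : ∀ v < n + 2, ∀ e < m, 1 ≤ σ.nat hitTable v e ↔ Hits n c s v e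
  count : ∀ v < n + 2, σ.nat availCount v 0 = avail n c s (bundles m σ) v
  pointer_le : ∀ v < n + 2, σ.nat pointer v 0 ≤ m
  passed : ∀ v < n + 2, ∀ e < σ.nat pointer v 0, σ.nat owner 0 e = n → ¬ Hits n c s v e

/-- The potential that pays for picks. -/
def potential (n m : ℕ) (σ : Store) : ℕ :=
  n * (bundles m σ n).card + ∑ v ∈ Finset.range (n + 2), (m - σ.nat pointer v 0)

theorem SameExcept.bundles_eq {A B : List ℕ} {m : ℕ} {σ σ' : Store} (h : SameExcept A σ σ' B)
    (hA : owner ∉ A := by simp) : bundles m σ' = bundles m σ := by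
  rw [bundles, h.nat owner hA]

theorem SameExcept.potential_eq {A B : List ℕ} {n m : ℕ} {σ σ' : Store} (h : SameExcept A σ σ' B)
    (howner : owner ∉ A := by simp) (hpointer : pointer ∉ A := by simp) :
    potential n m σ' = potential n m σ := by
  rw [potential, h.bundles_eq howner, h.nat pointer hpointer, potential]

theorem State.congr {A B : List ℕ} {n m : ℕ} {c : ℕ → ℕ → ℝ} {s : ℝ} {σ σ' : Store}
    (h : State n m c s σ) (hA : SameExcept A σ σ' B) (hA' : ∀ a ∈ A, 5 ≤ a := by simp) :
    State n m c s σ' := by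
  have hnat : ∀ a < 5, σ'.nat a = σ.nat a := fun a ha =>
    hA.nat a fun hmem => absurd ha (hA' a hmem).not_gt
  constructor <;> simp only [bundles, hnat _ (by decide : 0 < 5), hnat owner (by decide),
    hnat hitTable (by decide), hnat availCount (by decide), hnat pointer (by decide)]
  exacts [h.agents, h.items, h.owner_le, h.hits, h.count, h.pointer_le, h.passed]

/-! ### The picking procedure -/

/-- Determines the preference with which the agent picks. -/
def chooseTarget : Program :=
  .seq (assign target (scalar agent))
    (.seq
      (.ite (.natLe (.cell availCount (scalar target) (.const 0)) (.const 0))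
        (assign target numAgents) .skip)
      (.ite (.natLe (.cell availCount (scalar target) (.const 0)) (.const 0))
        (assign target (.succ numAgents)) .skip))

/-- Finds the first free item hit by the target. -/
def scan : Program :=
  .seq (assign pickedItem (.cell pointer (scalar target) (.const 0)))
    (.while (.not (.and (.natLe numAgents (.cell owner (.const 0) (scalar pickedItem)))
        (.natLe (.const 1) (.cell hitTable (scalar target) (scalar pickedItem)))))
      (assign pickedItem (.succ (scalar pickedItem))))

/-- Hands over the picked item to the agent. -/
def handOver : Program :=
  .seq (.setNat pointer (scalar target) (.const 0) (scalar pickedItem))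
    (.seq (.setNat owner (.const 0) (scalar pickedItem) (scalar agent))
      (forLoop pickLoop (.succ (.succ numAgents))
        (.ite (.natLe (.const 1) (.cell hitTable (scalar pickLoop) (scalar pickedItem)))
          (.setNat availCount (scalar pickLoop) (.const 0)
            (.pred (.cell availCount (scalar pickLoop) (.const 0)))) .skip)))

/-- The agent in scalar `k` picks a free item it prefers. -/
def pick (k : ℕ) : Program :=
  .seq (assign agent (scalar k)) (.seq chooseTarget (.seq scan handOver))

/-- The arrays changed by `pick`. -/
abbrev pickArrays : List ℕ := [owner, availCount, pointer, agent, target, pickedItem, pickLoop]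

/-- `f` is the first free item hit by `v`. -/
structure FirstHit (n m : ℕ) (c : ℕ → ℕ → ℝ) (s : ℝ) (o : ℕ → ℕ) (v f : ℕ) : Prop where
  lt : f < m
  free : o f = n
  hits : Hits n c s v f
  first : ∀ e < f, o e = n → ¬ Hits n c s v e

/-- The effect of `handOver` on the memory. -/
structure HandedOver (n i v f : ℕ) (σ σ' : Store) : Prop where
  same : SameExcept [owner, availCount, pointer, pickLoop] σ σ'
  owner_eq : σ'.nat owner 0 = Function.update (σ.nat owner 0) f i
  pointer_eq : ∀ u, σ'.nat pointer u 0 = if u = v then f else σ.nat pointer u 0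
  count_eq : ∀ u < n + 2, σ'.nat availCount u 0 =
    if 1 ≤ σ.nat hitTable u f then σ.nat availCount u 0 - 1 else σ.nat availCount u 0

section Pick

variable {n m : ℕ} {c : ℕ → ℕ → ℝ} {s : ℝ} {σ σ' : Store} {i v f b x : ℕ}

theorem runs_chooseTarget (hσ : State n m c s σ) (hi : i < n) (hagent : σ.nat agent 0 0 = i)
    (hfree : 0 < avail n c s (bundles m σ) (n + 1)) :
    Runs chooseTarget σ 40 fun σ' _ => SameExcept [target] σ σ' ∧ ∃ v < n + 2,
      σ'.nat target 0 0 = v ∧ 0 < avail n c s (bundles m σ) v ∧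
      ∀ f, Hits n c s v f → Prefers n c s (bundles m σ) i f := by
  have hcount_i := hσ.count i (by omega)
  have hcount_n := hσ.count n (by omega)
  refine .seq (.assign hagent <| .seq ?_)
  have hsame : SameExcept [target] σ (σ.writeNat target 0 0 i) := SameExcept.refl.write
  refine .ite_skip (P := avail n c s (bundles m σ) i = 0) (by simp [hcount_i])
    (fun hnone => .assign hσ.agents ?_) fun hsome => ?_
  · refine .ite_skip (P := avail n c s (bundles m σ) n = 0) (by simp [hcount_n])
      (fun hnone' => .assign (congrArg (· + 1) hσ.agents) ⟨hsame.write.write, n + 1, by omega, ?_⟩)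
      fun hsome => ⟨hsame.write, n, by omega, ?_⟩
    · simpa using ⟨hfree, fun f _ => Or.inr ⟨hnone, .inr hnone'⟩⟩
    · simpa using ⟨Nat.pos_of_ne_zero hsome, fun f hf => Or.inr ⟨hnone, .inl hf⟩⟩
  · refine .ite_skip (P := avail n c s (bundles m σ) i = 0) (by simp [hcount_i])
      (fun hnone => absurd hnone hsome) fun _ => ⟨hsame, i, by omega, ?_⟩
    simpa using ⟨Nat.pos_of_ne_zero hsome, fun f hf => Or.inl hf⟩

theorem State.pointer_le_of_free (hσ : State n m c s σ) (hv : v < n + 2)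
    (hf : σ.nat owner 0 f = n) (hhits : Hits n c s v f) : σ.nat pointer v 0 ≤ f :=
  not_lt.1 fun hlt => hσ.passed v hv f hlt hf hhits

theorem runs_scan (hσ : State n m c s σ) (hv : v < n + 2) (htarget : σ.nat target 0 0 = v)
    (hfree : 0 < avail n c s (bundles m σ) v) (hb : 30 * (m - σ.nat pointer v 0) + 40 ≤ b) :
    Runs scan σ b fun σ' b' => SameExcept [pickedItem] σ σ' ∧
      FirstHit n m c s (σ.nat owner 0) v (σ'.nat pickedItem 0 0) ∧
      b ≤ b' + 30 * (σ'.nat pickedItem 0 0 - σ.nat pointer v 0) + 40 := by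
  obtain ⟨f₀, hf₀, hhits₀⟩ := avail_pos_iff.1 hfree
  obtain ⟨hf₀m, hown₀⟩ := mem_bundle.1 hf₀
  have hptr := hσ.pointer_le v hv
  refine .seq (.assign (congrArg (σ.nat pointer · 0) htarget) ?_)
  refine Runs.while_loop (I := fun σ₁ b₁ => SameExcept [pickedItem] σ σ₁ ∧
    σ.nat pointer v 0 ≤ σ₁.nat pickedItem 0 0 ∧
    (∀ e < σ₁.nat pickedItem 0 0, σ.nat owner 0 e = n → ¬ Hits n c s v e) ∧
    b ≤ b₁ + 30 * (σ₁.nat pickedItem 0 0 - σ.nat pointer v 0) + 9) ?_ ?_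
    ⟨SameExcept.refl.write, by simp, by simpa using hσ.passed v hv, by simp; omega⟩
  · rintro σ₁ b₁ ⟨hsame, hle, hfirst, hb₁⟩ hT
    have hlt : σ₁.nat pickedItem 0 0 ≤ f₀ := not_lt.1 fun hlt => hfirst f₀ hlt hown₀ hhits₀
    have hmiss : σ.nat owner 0 (σ₁.nat pickedItem 0 0) = n →
        ¬ Hits n c s v (σ₁.nat pickedItem 0 0) := fun hown hhits => hT <| by
      rw [← hσ.hits v hv _ (by omega)] at hhits
      simpa [hsame.nat, htarget, hσ.agents, hown] using hhits
    refine ⟨by simp; omega, .assign rfl ⟨hsame.write, ?_⟩⟩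
    simp only [NatExpr.eval, Store.nat_writeNat_same, and_self, if_true]
    refine ⟨by omega, fun e he => ?_, by simp only [NatExpr.cost, Test.cost]; omega⟩
    rcases Nat.lt_succ_iff_lt_or_eq.1 he with he | rfl
    exacts [hfirst e he, hmiss]
  · rintro σ₁ b₁ ⟨hsame, hle, hfirst, hb₁⟩ hT
    have hlt : σ₁.nat pickedItem 0 0 ≤ f₀ := not_lt.1 fun hlt => hfirst f₀ hlt hown₀ hhits₀
    have hfound : n ≤ σ.nat owner 0 (σ₁.nat pickedItem 0 0) ∧
        1 ≤ σ.nat hitTable v (σ₁.nat pickedItem 0 0) := by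
      simpa [hsame.nat, htarget, hσ.agents] using not_not.1 hT
    rw [hσ.hits v hv _ (by omega)] at hfound
    have hown := hσ.owner_le (σ₁.nat pickedItem 0 0) (by omega)
    exact ⟨by simp; omega, hsame, ⟨by omega, by omega, hfound.2, hfirst⟩,
      by simp only [NatExpr.cost, Test.cost]; omega⟩

theorem runs_handOver (hagents : σ.nat 0 0 0 = n) (hagent : σ.nat agent 0 0 = i)
    (htarget : σ.nat target 0 0 = v) (hitem : σ.nat pickedItem 0 0 = f) :
    Runs handOver σ (45 * (n + 2) + 40) fun σ' _ => HandedOver n i v f σ σ' := by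
  refine .seq (.setNat htarget rfl hitem <| .seq (.setNat rfl hitem hagent ?_))
  set σ₂ := (σ.writeNat pointer v 0 f).writeNat owner 0 f i
  have hsame : SameExcept [owner, pointer] σ σ₂ := SameExcept.refl.write.write
  refine .frame (.for_loop_const (N := n + 2) (C := 25)
    (J := fun j σ₃ => SameExcept [availCount, pickLoop] σ₂ σ₃ ∧ ∀ u, σ₃.nat availCount u 0 =
      if u < j ∧ 1 ≤ σ.nat hitTable u f then σ.nat availCount u 0 - 1 else σ.nat availCount u 0)
    ?_ ?_ ?_ fun σ₃ h => h) (by simp; omega) ?_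
  · exact ⟨SameExcept.refl.write, fun u => by simp⟩
  · rintro j σ₃ ⟨hsame₃, -⟩
    simp [hsame₃.nat, hsame.nat, hagents]
  · rintro j σ₃ hj hloop ⟨hsame₃, hcount⟩
    refine .ite_skip (P := 1 ≤ σ.nat hitTable j f)
      (by simp [hsame₃.nat, hsame.nat, hloop, hitem]) (fun hhit => .setNat hloop rfl rfl
        ⟨by simpa using hloop, hsame₃.write.write, fun u => ?_⟩)
      fun hmiss => ⟨hloop, hsame₃.write, fun u => ?_⟩
    · rcases eq_or_ne u j with rfl | huj
      · simp [hloop, hcount, hhit]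
      · have : u < j + 1 ↔ u < j := by omega
        simp [hcount, huj, this]
    · rcases eq_or_ne u j with rfl | huj
      · simp [hcount, hmiss]
      · have : u < j + 1 ↔ u < j := by omega
        simp [hcount, this]
  · rintro σ₃ ⟨hsame₃, hcount⟩
    refine ⟨hsame.mono.trans hsame₃.mono, ?_, fun u => ?_, fun u hu => ?_⟩
    · funext e
      simp [hsame₃.nat, σ₂, Function.update_apply]
    · simp [hsame₃.nat, σ₂]
    · simp [hcount, hu]

theorem HandedOver.give (hσ' : HandedOver n i v f σ σ') (hi : i < n)
    (hf : FirstHit n m c s (σ.nat owner 0) v f) : Give n i f (bundles m σ) (bundles m σ') := by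
  rw [bundles, bundles, hσ'.owner_eq]
  exact give_update hi hf.lt hf.free

theorem HandedOver.state (hσ' : HandedOver n i v f σ σ') (hσ : State n m c s σ) (hi : i < n)
    (hf : FirstHit n m c s (σ.nat owner 0) v f) : State n m c s σ' where
  agents := by rw [hσ'.same.nat 0 (by simp), hσ.agents]
  items := by rw [hσ'.same.nat 0 (by simp), hσ.items]
  owner_le e he := by
    rw [hσ'.owner_eq, Function.update_apply]
    split_ifs
    exacts [hi.le, hσ.owner_le e he]
  hits u hu e he := by rw [hσ'.same.nat hitTable (by simp), hσ.hits u hu e he]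
  count u hu := by
    have hG := hσ'.give hi hf
    rw [hσ'.count_eq u hu, hσ.count u hu]
    split_ifs with hhit <;> rw [hσ.hits u hu f hf.lt] at hhit
    · rw [← hG.avail_add_one hhit, Nat.add_sub_cancel]
    · rw [hG.avail_eq hhit]
  pointer_le u hu := by
    rw [hσ'.pointer_eq]
    split_ifs
    exacts [hf.lt.le, hσ.pointer_le u hu]
  passed u hu e he hown := by
    rw [hσ'.pointer_eq] at he
    rw [hσ'.owner_eq, Function.update_apply] at hown
    split_ifs at he hown with huv hef hef
    exacts [absurd hown hi.ne, huv ▸ hf.first e he hown, absurd hown hi.ne,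
      hσ.passed u hu e he hown]

theorem HandedOver.potential_eq (hσ' : HandedOver n i v f σ σ') (hi : i < n) (hv : v < n + 2)
    (hptr : σ.nat pointer v 0 ≤ f) (hf : FirstHit n m c s (σ.nat owner 0) v f) :
    potential n m σ' + n + (f - σ.nat pointer v 0) = potential n m σ := by
  have hcard := (hσ'.give hi hf).card_rest
  have hsum : ∑ u ∈ Finset.range (n + 2), (m - σ'.nat pointer u 0) + (f - σ.nat pointer v 0) =
      ∑ u ∈ Finset.range (n + 2), (m - σ.nat pointer u 0) := by
    have hmem : v ∈ Finset.range (n + 2) := Finset.mem_range.2 hv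
    have hlt := hf.lt
    rw [← Finset.add_sum_erase _ _ hmem, ← Finset.add_sum_erase _ _ hmem, hσ'.pointer_eq,
      if_pos rfl, Finset.sum_congr rfl fun u hu => by
        rw [hσ'.pointer_eq, if_neg (Finset.ne_of_mem_erase hu)]]
    omega
  rw [potential, potential, ← hsum, ← hcard]
  ring

/-- Every pick is paid for by the potential, with `100 * n` steps to spare. -/
theorem runs_pick {k : ℕ} (hn : 4 ≤ n) (hσ : State n m c s σ) (hi : i < n)
    (hk : σ.nat k 0 0 = i) (hfree : 0 < avail n c s (bundles m σ) (n + 1))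
    (hb : 200 * potential n m σ + x ≤ b) :
    Runs (pick k) σ b fun σ' b' => SameExcept pickArrays σ σ' ∧ State n m c s σ' ∧
      200 * potential n m σ' + 100 * n + x ≤ b' ∧
      ∃ f, Give n i f (bundles m σ) (bundles m σ') ∧ Prefers n c s (bundles m σ) i f := by
  have hpot_ge : n * 1 + ∑ v ∈ Finset.range (n + 2), (m - σ.nat pointer v 0) ≤ potential n m σ := by
    rw [avail_all] at hfree
    exact Nat.add_le_add_right (Nat.mul_le_mul_left n hfree) _
  have hsame₀ : SameExcept [agent] σ (σ.writeNat agent 0 0 i) := SameExcept.refl.write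
  refine .seq (.assign hk <| .seq <|
    .frame (runs_chooseTarget (hσ.congr hsame₀) hi (by simp) hfree) (by simp; omega) ?_)
  rintro σ₁ ⟨hsame₁, v, hv, htarget, havail, hpref⟩
  have hagent : σ₁.nat agent 0 0 = i := by simp [hsame₁.nat]
  replace hsame₁ : SameExcept [agent, target] σ σ₁ := hsame₀.mono.trans hsame₁.mono
  have hptr_le : m - σ.nat pointer v 0 ≤ ∑ v ∈ Finset.range (n + 2), (m - σ.nat pointer v 0) :=
    Finset.single_le_sum (f := fun v => m - σ.nat pointer v 0) (fun _ _ => Nat.zero_le _)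
      (Finset.mem_range.2 hv)
  rw [hsame₀.bundles_eq, ← hsame₁.bundles_eq] at havail
  refine .seq (.mono (runs_scan (hσ.congr hsame₁) hv htarget havail
    (by rw [hsame₁.nat pointer (by simp)]; simp only [NatExpr.cost]; omega)) ?_)
  rintro σ₂ b₂ ⟨hsame₂, hfirst, hb₂⟩
  have hsame : SameExcept [agent, target, pickedItem] σ σ₂ := hsame₁.mono.trans hsame₂.mono
  have hσ₂ := hσ.congr hsame
  rw [← hsame₂.nat owner (by simp)] at hfirst
  rw [hsame₁.nat pointer (by simp)] at hb₂
  have hptr := hσ₂.pointer_le_of_free hv hfirst.free hfirst.hits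
  have hlt := hfirst.lt
  simp only [NatExpr.cost] at hb₂
  refine .frame (runs_handOver (i := i) (v := v) hσ₂.agents (by simp [hsame₂.nat, hagent])
    (by simp [hsame₂.nat, htarget]) rfl) (by omega) ?_
  rintro σ₃ hhand
  have hpot := hhand.potential_eq hi hv hptr hfirst
  have hG := hhand.give hi hfirst
  rw [hsame.bundles_eq] at hG
  rw [hsame.potential_eq, hsame.nat pointer (by simp)] at hpot
  exact ⟨hsame.mono.trans hhand.same.mono, hhand.state hσ₂ hi hfirst, by omega, _, hG,
    hpref _ hfirst.hits⟩

end Pick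

/-! ### Loops over the agents -/

/-- Scalar: a loop counter. -/
@[simp] abbrev counter : ℕ := 14

/-- Scalar: an agent that finds few small items. -/
@[simp] abbrev taker : ℕ := 15

/-- Scalar `t` becomes an agent that is best among those for which `candidate` holds, or `n` if
there is none. The tests refer to the scalar `counter`; `atLeastAsGood` compares `t` with it. -/
def argmin (t : ℕ) (candidate atLeastAsGood : Test) : Program :=
  .seq (assign t numAgents) (forLoop counter numAgents
    (.ite (.and candidate (.not (.and (.natLe (.succ (scalar t)) numAgents) atLeastAsGood)))
      (assign t (scalar counter)) .skip))

/-- Scalar `t` becomes an agent for which `candidate` holds, or `n` if there is none. -/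
abbrev search (t : ℕ) (candidate : Test) : Program :=
  argmin t candidate (.natLe (.const 0) (.const 0))

/-- The number `j` minimizes `key` among the numbers below `k` that satisfy `p`; it is `n` if there
are none. -/
structure ArgMin {α : Type*} [LE α] (n : ℕ) (p : ℕ → Prop) (key : ℕ → α) (k j : ℕ) : Prop where
  le : j ≤ n
  of_lt : j < n → p j ∧ ∀ i < k, p i → key j ≤ key i
  of_eq : j = n → ∀ i < k, ¬ p i

section ArgMin

variable {α : Type*} [LinearOrder α] {n : ℕ} {p : ℕ → Prop} {key : ℕ → α} {k j t : ℕ}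
  {candidate atLeastAsGood : Test} {σ : Store}

theorem ArgMin.zero : ArgMin n p key 0 n := ⟨le_rfl, by simp, by simp⟩

theorem ArgMin.replace (h : ArgMin n p key k j) (hk : k < n) (hp : p k)
    (hbest : ¬ (j < n ∧ key j ≤ key k)) : ArgMin n p key (k + 1) k := by
  refine ⟨hk.le, fun _ => ⟨hp, fun i hi hpi => ?_⟩, fun h => absurd h hk.ne⟩
  rcases Nat.lt_succ_iff_lt_or_eq.1 hi with hi | rfl
  · have hj : j < n := h.le.lt_of_ne fun hj => h.of_eq hj i hi hpi
    exact (lt_of_not_ge fun hle => hbest ⟨hj, hle⟩).le.trans ((h.of_lt hj).2 i hi hpi)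
  · exact le_rfl

theorem ArgMin.keep (h : ArgMin n p key k j) (hbest : p k → j < n ∧ key j ≤ key k) :
    ArgMin n p key (k + 1) j := by
  refine ⟨h.le, fun hj => ⟨(h.of_lt hj).1, fun i hi hpi => ?_⟩, fun hj i hi hpi => ?_⟩ <;>
    rcases Nat.lt_succ_iff_lt_or_eq.1 hi with hi | rfl
  exacts [(h.of_lt hj).2 i hi hpi, (hbest hpi).2, h.of_eq hj i hi hpi, (hbest hpi).1.ne hj]

theorem runs_argmin (hn : σ.nat 0 0 0 = n)
    (hcandidate : ∀ σ', SameExcept [t, counter] σ σ' → σ'.nat counter 0 0 < n →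
      (candidate.Holds σ' ↔ p (σ'.nat counter 0 0)))
    (hgood : ∀ σ', SameExcept [t, counter] σ σ' → σ'.nat counter 0 0 < n → σ'.nat t 0 0 < n →
      (atLeastAsGood.Holds σ' ↔ key (σ'.nat t 0 0) ≤ key (σ'.nat counter 0 0)))
    (ht : t ≠ 0 := by simp) (ht' : t ≠ counter := by simp) :
    Runs (argmin t candidate atLeastAsGood) σ
      (n * (candidate.cost + atLeastAsGood.cost + 34) + 19) fun σ' _ =>
        SameExcept [t, counter] σ σ' ∧ ArgMin n p key n (σ'.nat t 0 0) := by
  refine .seq (.assign hn (.frame (.for_loop_const (N := n)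
    (C := candidate.cost + atLeastAsGood.cost + 18) (J := fun k σ₁ =>
      SameExcept [t, counter] σ σ₁ ∧ ArgMin n p key k (σ₁.nat t 0 0)) ?_ ?_ ?_ fun _ h => h)
    (by simp only [NatExpr.cost]; ring_nf; omega) fun _ h => h) (by simp))
  · exact ⟨SameExcept.refl.write.write, by simpa [ht'] using ArgMin.zero⟩
  · rintro k σ₁ ⟨hsame, -⟩
    simpa [hsame.nat, ht.symm] using hn
  · rintro k σ₁ hk hcounter ⟨hsame, hmin⟩
    have hlt : σ₁.nat counter 0 0 < n := hcounter.trans_lt hk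
    have hT : (Test.and candidate
        (.not (.and (.natLe (.succ (scalar t)) numAgents) atLeastAsGood))).Holds σ₁ ↔
        p k ∧ ¬ (σ₁.nat t 0 0 < n ∧ key (σ₁.nat t 0 0) ≤ key k) := by
      have h0 : (NatExpr.eval σ₁ numAgents) = n := by simpa [hsame.nat, ht.symm] using hn
      rw [Test.Holds, hcandidate σ₁ hsame hlt, hcounter, Test.Holds, Test.Holds, Test.Holds, h0,
        NatExpr.eval, Nat.succ_le_iff]
      refine and_congr_right' (not_congr (and_congr_right fun hj => ?_))
      rw [hgood σ₁ hsame hlt hj, hcounter]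
    refine .ite_skip hT (fun h => .assign hcounter ?_ ?_) (fun h => ?_) ?_
    · exact ⟨by simpa [ht'.symm] using hcounter, hsame.write.write,
        by simpa [ht'] using hmin.replace hk h.1 h.2⟩
    · simp only [Test.cost, NatExpr.cost]; omega
    · exact ⟨hcounter, hsame.write,
        by simpa [ht'] using hmin.keep fun hp => not_not.1 fun hbest => h ⟨hp, hbest⟩⟩
    · simp only [Test.cost, NatExpr.cost]; omega

theorem runs_search (hn : σ.nat 0 0 0 = n)
    (hcandidate : ∀ σ', SameExcept [t, counter] σ σ' → σ'.nat counter 0 0 < n →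
      (candidate.Holds σ' ↔ p (σ'.nat counter 0 0)))
    (ht : t ≠ 0 := by simp) (ht' : t ≠ counter := by simp) :
    Runs (search t candidate) σ (n * (candidate.cost + 37) + 19) fun σ' _ =>
      SameExcept [t, counter] σ σ' ∧ ArgMin n p (fun _ => 0) n (σ'.nat t 0 0) :=
  runs_argmin hn hcandidate (by simp) ht ht'

end ArgMin

/-- The arrays changed by a loop over picking agents. -/
abbrev roundArrays : List ℕ := counter :: pickArrays

section Main

variable {n m : ℕ} {c : ℕ → ℕ → ℝ} {s l : ℝ} {σ : Store} {b x : ℕ}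

/-- In a loop over the agents, the body may change the partial allocation. In every iteration it
costs at most `d` more steps, and yields at least `g` steps, than the potential pays for. -/
theorem runs_forAgents {J : ℕ → (ℕ → Finset ℕ) → Prop} {body : Program} (d g : ℕ)
    (hσ : State n m c s σ) (hJ : J 0 (bundles m σ))
    (hb : 200 * potential n m σ + n * (d + 16) + x + 13 ≤ b)
    (hbody : ∀ σ₁ b₁ i x, SameExcept roundArrays σ σ₁ → State n m c s σ₁ → i < n →
      σ₁.nat counter 0 0 = i → J i (bundles m σ₁) → 200 * potential n m σ₁ + d + x ≤ b₁ →
      Runs body σ₁ b₁ fun σ₂ b₂ => SameExcept pickArrays σ₁ σ₂ ∧ State n m c s σ₂ ∧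
        J (i + 1) (bundles m σ₂) ∧ 200 * potential n m σ₂ + g + x ≤ b₂) :
    Runs (forLoop counter numAgents body) σ b fun σ' b' => SameExcept roundArrays σ σ' ∧
      State n m c s σ' ∧ J n (bundles m σ') ∧ 200 * potential n m σ' + n * g + x ≤ b' := by
  have hwrite : ∀ (σ₁ : Store) (v : ℕ), SameExcept [counter] σ₁ (σ₁.writeNat counter 0 0 v) :=
    fun _ _ => SameExcept.refl.write
  refine .for_loop (N := n) (I := fun i σ₁ b₁ => SameExcept roundArrays σ σ₁ ∧ State n m c s σ₁ ∧
    J i (bundles m σ₁) ∧ i ≤ n ∧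
    200 * potential n m σ₁ + (n - i) * (d + 16) + i * g + x + 9 ≤ b₁) (by omega)
    ⟨(hwrite _ _).mono, hσ.congr (hwrite _ _), ?_, by simp, ?_⟩ ?_ ?_ ?_
  · rwa [(hwrite _ _).bundles_eq]
  · rw [(hwrite _ _).potential_eq]
    simp only [Nat.sub_zero, zero_mul]
    omega
  · exact fun i σ₁ b₁ h => h.2.1.agents
  · rintro i σ₁ b₁ hi hcounter ⟨hsame, hσ₁, hJ₁, -, hb₁⟩
    have hleft : n - i = n - (i + 1) + 1 := by omega
    rw [hleft, add_mul, one_mul] at hb₁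
    refine ⟨by simp only [NatExpr.cost]; omega, .mono (hbody σ₁ _ i
      ((n - (i + 1)) * (d + 16) + i * g + x + 9) hsame hσ₁ hi hcounter hJ₁
      (by simp only [NatExpr.cost]; omega)) ?_⟩
    rintro σ₂ b₂ ⟨hsame₂, hσ₂, hJ₂, hb₂⟩
    refine ⟨by simpa [hsame₂.nat] using hcounter, (hsame.trans hsame₂.mono).write,
      hσ₂.congr (hwrite _ _), ?_, hi, ?_⟩
    · rwa [(hwrite _ _).bundles_eq]
    · rw [(hwrite _ _).potential_eq, add_mul i, one_mul]
      omega
  · rintro σ₁ b₁ - ⟨hsame, hσ₁, hJ₁, -, hb₁⟩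
    simp only [NatExpr.cost]
    exact ⟨by omega, hsame, hσ₁, hJ₁, by omega⟩

/-! ### The main phase -/

/-- The number of free items. -/
abbrev numFree : NatExpr := .cell availCount (.succ numAgents) (.const 0)

/-- Every agent picks one item. -/
def pickRound : Program := forLoop counter numAgents (pick counter)

/-- Searches an agent for which some free items are small, but fewer than `n`. -/
def findTaker : Program :=
  search taker (.and (.natLe (.const 1) (.cell availCount (scalar counter) (.const 0)))
    (.natLe (.succ (.cell availCount (scalar counter) (.const 0))) numAgents))

/-- Ends when fewer than `n` items are free, all of them large for everybody. -/
def mainPhase : Program :=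
  .seq pickRound (.seq findTaker (.while
    (.not (.and (.natLe numAgents (scalar taker)) (.natLe (.succ numFree) numAgents)))
    (.seq (.ite (.natLe (.succ (scalar taker)) numAgents) (pick taker) pickRound) findTaker)))

/-- The arrays changed by the main phase. -/
abbrev mainArrays : List ℕ := taker :: roundArrays

/-- Agent `j` finds some small items, but fewer than `n`, or there is no such agent and `j = n`. -/
abbrev Taker (n : ℕ) (c : ℕ → ℕ → ℝ) (s : ℝ) (X : ℕ → Finset ℕ) (j : ℕ) : Prop :=
  ArgMin n (fun i => 0 < avail n c s X i ∧ avail n c s X i < n) (fun _ => 0) n j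

theorem runs_pickRound (hn : 4 ≤ n) (hσ : State n m c s σ)
    (hfree : n ≤ avail n c s (bundles m σ) (n + 1))
    (hb : 200 * potential n m σ + 16 * n + x + 13 ≤ b) :
    Runs pickRound σ b fun σ' b' => SameExcept roundArrays σ σ' ∧ State n m c s σ' ∧
      Picked n m c s (bundles m σ) n (bundles m σ') ∧
      200 * potential n m σ' + 400 * n + x ≤ b' := by
  refine .mono (runs_forAgents (x := x) (J := Picked n m c s (bundles m σ)) 0 400 hσ
    (Picked.zero fun _ _ => bundle_subset) (by omega) ?_) fun σ' b' => by
      rw [mul_comm n 400]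
      exact id
  rintro σ₁ b₁ i x - hσ₁ hi hcounter hJ hb₁
  have hpos : 0 < avail n c s (bundles m σ₁) (n + 1) := by
    have := hJ.avail_le (n + 1)
    omega
  refine .mono (runs_pick (x := x) hn hσ₁ hi hcounter hpos (by omega)) ?_
  rintro σ₂ b₂ ⟨hsame₂, hσ₂, hb₂, f, hG, hpref⟩
  exact ⟨hsame₂, hσ₂, hJ.succ hG hpref, by omega⟩

theorem runs_findTaker (hσ : State n m c s σ) (hb : 200 * potential n m σ + 55 * n + x + 19 ≤ b) :
    Runs findTaker σ b fun σ' b' => SameExcept [taker, counter] σ σ' ∧ State n m c s σ' ∧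
      bundles m σ' = bundles m σ ∧ Taker n c s (bundles m σ) (σ'.nat taker 0 0) ∧
      200 * potential n m σ' + x ≤ b' := by
  refine .frame (runs_search (p := fun i => 0 < avail n c s (bundles m σ) i ∧
    avail n c s (bundles m σ) i < n) hσ.agents fun σ' hsame hlt => ?_)
    (by simp only [Test.cost, NatExpr.cost]; omega) ?_
  · simp [hsame.nat, hσ.agents, hσ.count _ (hlt.trans (Nat.lt_add_of_pos_right two_pos)),
      Nat.succ_le_iff]
  · rintro σ' ⟨hsame, hmin⟩
    refine ⟨hsame, hσ.congr hsame, hsame.bundles_eq, hmin, ?_⟩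
    rw [hsame.potential_eq]
    simp only [Test.cost, NatExpr.cost]
    omega

theorem Taker.eq_zero_or_le {X : ℕ → Finset ℕ} (h : Taker n c s X n) {i : ℕ} (hi : i < n) :
    avail n c s X i = 0 ∨ n ≤ avail n c s X i := by
  have := h.of_eq rfl i hi
  omega

theorem runs_mainStep (hI : Separated n m c s l) (hσ : State n m c s σ) {r : ℕ}
    (hM : MainInv n m c s l r (bundles m σ)) (ht : Taker n c s (bundles m σ) (σ.nat taker 0 0))
    (hmore : ¬ (n ≤ σ.nat taker 0 0 ∧ avail n c s (bundles m σ) (n + 1) < n))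
    (hb : 200 * potential n m σ + 16 * n + x + 22 ≤ b) :
    Runs (.ite (.natLe (.succ (scalar taker)) numAgents) (pick taker) pickRound) σ b
      fun σ' b' => SameExcept roundArrays σ σ' ∧ State n m c s σ' ∧
        (∃ r', MainInv n m c s l r' (bundles m σ')) ∧
        200 * potential n m σ' + 100 * n + x ≤ b' := by
  have hn := hI.four_le
  refine .ite (P := σ.nat taker 0 0 < n) (by simp [hσ.agents]) (fun hlt => ?_)
    fun hge => ?_
  · obtain ⟨hpos, hfew⟩ := (ht.of_lt hlt).1
    refine .mono (runs_pick (x := x) hn hσ hlt rfl (hpos.trans_le avail_le_all)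
      (by simp only [Test.cost, NatExpr.cost]; omega)) ?_
    rintro σ' b' ⟨hsame, hσ', hb', f, hG, hpref⟩
    have hsmall := (hits_agent hlt).1 (hpref.resolve_right fun h => hpos.ne' h.1)
    exact ⟨hsame.mono, hσ', ⟨r, hM.give hI hG hsmall hfew⟩, hb'⟩
  · have htaker : σ.nat taker 0 0 = n := ht.le.antisymm (not_lt.1 hge)
    refine .mono (runs_pickRound (x := x) hn hσ
      (not_lt.1 fun hlt => hmore ⟨htaker.ge, hlt⟩)
      (by simp only [Test.cost, NatExpr.cost]; omega)) ?_
    rintro σ' b' ⟨hsame, hσ', hpicked, hb'⟩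
    rw [htaker] at ht
    exact ⟨hsame, hσ', ⟨r + 1, hpicked.mainInv_succ hI hM fun i => ht.eq_zero_or_le⟩, by omega⟩

theorem runs_mainPhase (hI : Separated n m c s l) (hσ : State n m c s σ)
    (hempty : ∀ i < n, bundles m σ i = ∅) (hfree : n ≤ avail n c s (bundles m σ) (n + 1))
    (hb : 200 * potential n m σ + 16 * n + x + 40 ≤ b) :
    Runs mainPhase σ b fun σ' b' => SameExcept mainArrays σ σ' ∧ State n m c s σ' ∧
      (∃ r, MainInv n m c s l r (bundles m σ')) ∧
      (∀ i < n, avail n c s (bundles m σ') i = 0) ∧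
      avail n c s (bundles m σ') (n + 1) < n ∧ 200 * potential n m σ' + x ≤ b' := by
  have hn := hI.four_le
  refine .seq (.mono (runs_pickRound (x := x + 27) hn hσ hfree (by omega)) ?_)
  rintro σ₁ b₁ ⟨hsame₁, hσ₁, hpicked, hb₁⟩
  refine .seq (.mono (runs_findTaker (x := x + 16 * n + 50) hσ₁ (by omega)) ?_)
  rintro σ₂ b₂ ⟨hsame₂, hσ₂, hX₂, ht₂, hb₂⟩
  rw [← hX₂] at ht₂ hpicked
  refine .while_loop (I := fun σ b => SameExcept mainArrays σ₂ σ ∧ State n m c s σ ∧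
    (∃ r, MainInv n m c s l r (bundles m σ)) ∧ Taker n c s (bundles m σ) (σ.nat taker 0 0) ∧
    200 * potential n m σ + x + 16 * n + 50 ≤ b) ?_ ?_
    ⟨.refl, hσ₂, ⟨1, hpicked.mainInv_one hI hempty⟩, ht₂, by omega⟩
  · rintro σ₃ b₃ ⟨hsame₃, hσ₃, ⟨r, hM⟩, ht, hb₃⟩ hT
    refine ⟨by simp only [Test.cost, NatExpr.cost]; omega, .seq (.mono
      (runs_mainStep (x := x) hI hσ₃ hM ht ?_ ?_) ?_)⟩
    · simpa [hσ₃.agents, hσ₃.count, Nat.succ_le_iff] using hT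
    · simp only [Test.cost, NatExpr.cost]; omega
    rintro σ₄ b₄ ⟨hsame₄, hσ₄, hM₄, hb₄⟩
    refine .mono (runs_findTaker (x := x + 16 * n + 50) hσ₄ (by omega)) ?_
    rintro σ₅ b₅ ⟨hsame₅, hσ₅, hX₅, ht₅, hb₅⟩
    rw [← hX₅] at hM₄ ht₅
    exact ⟨(hsame₃.trans hsame₄.mono).trans hsame₅.mono, hσ₅, hM₄, ht₅, by omega⟩
  · rintro σ₃ b₃ ⟨hsame₃, hσ₃, hM, ht, hb₃⟩ hT
    obtain ⟨hge, hlt⟩ : n ≤ σ₃.nat taker 0 0 ∧ avail n c s (bundles m σ₃) (n + 1) < n := by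
      simpa [hσ₃.agents, hσ₃.count, Nat.succ_le_iff] using hT
    rw [ht.le.antisymm hge] at ht
    refine ⟨by simp only [Test.cost, NatExpr.cost]; omega,
      (hsame₁.mono.trans hsame₂.mono).trans hsame₃, hσ₃, hM, fun i hi => ?_, hlt,
      by simp only [Test.cost, NatExpr.cost]; omega⟩
    exact (ht.eq_zero_or_le hi).resolve_right (avail_le_all.trans_lt hlt).not_ge

end Main

/-! ### The end phase -/

/-- Array that marks the agents having an item that is large for everybody. -/
@[simp] abbrev marks : ℕ := 6

/-- Array of the sizes of the bundles. -/
@[simp] abbrev sizes : ℕ := 7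

/-- Scalar: the number of unmarked agents. -/
@[simp] abbrev numUnmarked : ℕ := 17

/-- Scalar: a marked agent with at least two items. -/
@[simp] abbrev rich : ℕ := 18

/-- The receiver of the item with which a loop over the items deals. -/
abbrev ownerOfCounter : NatExpr := .cell owner (.const 0) (scalar counter)

/-- Marks the agents that own an item that is large for everybody. -/
def markRich : Program :=
  forLoop counter numItems (.ite (.natLe (.const 1) (.cell hitTable numAgents (scalar counter)))
    (.setNat marks ownerOfCounter (.const 0) (.const 1)) .skip)

/-- Computes the sizes of the bundles of the agents. -/
def countSizes : Program :=
  .seq (forLoop counter (.succ numAgents) (.setNat sizes (scalar counter) (.const 0) (.const 0)))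
    (forLoop counter numItems (.setNat sizes ownerOfCounter (.const 0)
      (.succ (.cell sizes ownerOfCounter (.const 0)))))

/-- The agent in scalar `counter` is unmarked. -/
abbrev isUnmarked : Test := .natLe (.cell marks (scalar counter) (.const 0)) (.const 0)

/-- Counts the unmarked agents. -/
def countUnmarked : Program :=
  .seq (assign numUnmarked (.const 0)) (forLoop counter numAgents
    (.ite isUnmarked (assign numUnmarked (.succ (scalar numUnmarked))) .skip))

/-- Searches a marked agent with at least two items. -/
def findRich : Program :=
  search rich (.and (.not isUnmarked)
    (.natLe (.const 2) (.cell sizes (scalar counter) (.const 0))))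

/-- Every agent for which the test holds picks one item. -/
def pickIf (T : Test) : Program := forLoop counter numAgents (.ite T (pick counter) .skip)

/-- Some item is free. -/
abbrev someFree : Test := .natLe (.const 1) numFree

/-- Every unmarked agent and then, while items last, every marked agent picks one item. -/
def giveEach : Program :=
  .seq (pickIf isUnmarked) (pickIf (.and (.not isUnmarked) someFree))

/-- The agent in scalar `rich` receives all free items. -/
def feed : Program := .while someFree (pick rich)

section Inspect

variable {n m : ℕ} {c : ℕ → ℕ → ℝ} {s : ℝ} {σ : Store}

theorem bundle_succ {k j : ℕ} {o : ℕ → ℕ} :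
    bundle (k + 1) o j = if o k = j then insert k (bundle k o j) else bundle k o j := by
  rw [bundle, Finset.range_add_one, Finset.filter_insert, bundle]

theorem card_bundle_succ {k j : ℕ} {o : ℕ → ℕ} :
    (bundle (k + 1) o j).card = (bundle k o j).card + if o k = j then 1 else 0 := by
  rw [bundle_succ]
  split_ifs
  · exact Finset.card_insert_of_notMem fun h => lt_irrefl _ (mem_bundle.1 h).1
  · rfl

theorem runs_markRich (hσ : State n m c s σ) (hmarks : ∀ i, σ.nat marks i 0 = 0) :
    Runs markRich σ (m * 43 + 13) fun σ' _ => SameExcept [marks, counter] σ σ' ∧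
      ∀ i, σ'.nat marks i 0 = 0 ↔ Poor n c s (bundles m σ) i := by
  refine .frame (.for_loop_const (N := m) (C := 27) (J := fun k σ₁ =>
    SameExcept [marks, counter] σ σ₁ ∧ ∀ i, σ₁.nat marks i 0 = 0 ↔
      Poor n c s (bundle k (σ.nat owner 0)) i) ?_ ?_ ?_ fun _ h => h) (by simp) fun _ h => h
  · exact ⟨SameExcept.refl.write, fun i => by simp [hmarks, Poor, bundle]⟩
  · rintro k σ₁ ⟨hsame, -⟩
    simpa [hsame.nat] using hσ.items
  · rintro k σ₁ hk hcounter ⟨hsame, hpoor⟩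
    have hsucc : ∀ i, Poor n c s (bundle (k + 1) (σ.nat owner 0)) i ↔
        Poor n c s (bundle k (σ.nat owner 0)) i ∧ (σ.nat owner 0 k = i → ¬ Hits n c s n k) := by
      intro i
      rw [Poor, bundle_succ]
      split_ifs with h <;> simp [h, Poor, and_comm]
    refine .ite_skip (P := Hits n c s n k) ?_ (fun hhits => .setNat rfl rfl rfl
      ⟨by simpa using hcounter, hsame.write.write, fun i => ?_⟩)
      fun hmiss => ⟨hcounter, hsame.write, fun i => ?_⟩
    · rw [← hσ.hits n (by omega) k hk]
      simp [hsame.nat, hσ.agents, hcounter]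
    · rcases eq_or_ne i (σ.nat owner 0 k) with rfl | hi
      · simp [hsame.nat, hcounter, hsucc, hhits]
      · simp [hsame.nat, hcounter, hsucc, hpoor, hi, hi.symm]
    · simp [hsucc, hpoor, hmiss]

theorem runs_countSizes (hσ : State n m c s σ) :
    Runs countSizes σ (n * 100 + m * 100 + 100) fun σ' _ => SameExcept [sizes, counter] σ σ' ∧
      ∀ i < n, σ'.nat sizes i 0 = (bundles m σ i).card := by
  refine .seq (.frame (.for_loop_const (N := n + 1) (C := 10) (J := fun k σ₁ =>
    SameExcept [sizes, counter] σ σ₁ ∧ ∀ i < k, σ₁.nat sizes i 0 = 0) ?_ ?_ ?_ fun _ h => h)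
    (by simp; omega) ?_)
  · exact ⟨SameExcept.refl.write, by simp⟩
  · rintro k σ₁ ⟨hsame, -⟩
    simpa [hsame.nat] using hσ.agents
  · rintro k σ₁ - hcounter ⟨hsame, hzero⟩
    refine .setNat hcounter rfl rfl ⟨by simpa using hcounter, hsame.write.write, fun i hi => ?_⟩
    rcases Nat.lt_succ_iff_lt_or_eq.1 hi with hi | rfl
    · simp [hzero i hi, hi.ne]
    · simp
  rintro σ₁ ⟨hsame₁, hzero⟩
  refine .frame (.for_loop_const (N := m) (C := 20) (J := fun k σ₂ =>
    SameExcept [sizes, counter] σ σ₂ ∧ ∀ i ≤ n, σ₂.nat sizes i 0 =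
      (bundle k (σ.nat owner 0) i).card) ?_ ?_ ?_ fun _ h => h) (by simp; omega)
    fun σ₂ h => ⟨h.1, fun i hi => h.2 i hi.le⟩
  · exact ⟨hsame₁.write, fun i hi => by simp [hzero i (by omega), bundle]⟩
  · rintro k σ₂ ⟨hsame, -⟩
    simpa [hsame.nat] using hσ.items
  · rintro k σ₂ - hcounter ⟨hsame, hsize⟩
    refine .setNat rfl rfl rfl ⟨by simpa using hcounter, hsame.write.write, fun i hi => ?_⟩
    rw [card_bundle_succ]
    rcases eq_or_ne i (σ.nat owner 0 k) with rfl | hik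
    · simp [hsame.nat, hcounter, hsize _ hi]
    · simp [hsame.nat, hcounter, hsize _ hi, hik, hik.symm]

/-- The unmarked agents among the first `k` agents. -/
def unmarked (σ : Store) (k : ℕ) : Finset ℕ := {i ∈ Finset.range k | σ.nat marks i 0 = 0}

theorem mem_unmarked {k i : ℕ} : i ∈ unmarked σ k ↔ i < k ∧ σ.nat marks i 0 = 0 := by
  simp [unmarked]

theorem unmarked_succ {k : ℕ} : unmarked σ (k + 1) =
    if σ.nat marks k 0 = 0 then insert k (unmarked σ k) else unmarked σ k := by
  rw [unmarked, Finset.range_add_one, Finset.filter_insert, unmarked]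

theorem runs_countUnmarked (hn : σ.nat 0 0 0 = n) :
    Runs countUnmarked σ (n * 34 + 17) fun σ' _ => SameExcept [numUnmarked, counter] σ σ' ∧
      σ'.nat numUnmarked 0 0 = (unmarked σ n).card := by
  refine .seq (.assign rfl (.frame (.for_loop_const (N := n) (C := 18) (J := fun k σ₁ =>
    SameExcept [numUnmarked, counter] σ σ₁ ∧ σ₁.nat numUnmarked 0 0 = (unmarked σ k).card)
    ?_ ?_ ?_ fun _ h => h) (by simp) fun _ h => h))
  · exact ⟨SameExcept.refl.write.write, by simp [unmarked]⟩
  · rintro k σ₁ ⟨hsame, -⟩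
    simpa [hsame.nat] using hn
  · rintro k σ₁ - hcounter ⟨hsame, hcard⟩
    refine .ite_skip (P := σ.nat marks k 0 = 0) (by simp [hsame.nat, hcounter])
      (fun h => .assign rfl ⟨by simpa using hcounter, hsame.write.write, ?_⟩)
      fun h => ⟨hcounter, hsame.write, ?_⟩
    · rw [unmarked_succ, if_pos h, Finset.card_insert_of_notMem (by simp [mem_unmarked])]
      simp [hcard]
    · simp [unmarked_succ, h, hcard]

end Inspect

section Endgame

variable {n m : ℕ} {c : ℕ → ℕ → ℝ} {s l : ℝ} {r : ℕ} {σ : Store} {b x : ℕ}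

/-- All items have been given away, and the resulting allocation is as desired. -/
structure Solved (n m : ℕ) (c : ℕ → ℕ → ℝ) (σ : Store) : Prop where
  owner_lt : ∀ e < m, σ.nat owner 0 e < n
  efx : EFX n c (bundles m σ)

theorem State.solved (hσ : State n m c s σ) (hfree : bundles m σ n = ∅)
    (hefx : EFX n c (bundles m σ)) : Solved n m c σ where
  owner_lt e he := (hσ.owner_le e he).lt_of_ne fun h =>
    Finset.notMem_empty e (hfree ▸ mem_bundle.2 ⟨he, h⟩)
  efx := hefx

theorem State.someFree_iff (hσ : State n m c s σ) :
    someFree.Holds σ ↔ (bundles m σ n).Nonempty := by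
  rw [← Finset.card_pos, ← avail_all (c := c) (s := s)]
  simp [hσ.agents, hσ.count, Nat.succ_le_iff]

theorem runs_pickIf {J : ℕ → (ℕ → Finset ℕ) → Prop} {T : Test} {p : ℕ → (ℕ → Finset ℕ) → Prop}
    (hn : 4 ≤ n) (hσ : State n m c s σ)
    (hT : ∀ σ₁, SameExcept roundArrays σ σ₁ → State n m c s σ₁ →
      (T.Holds σ₁ ↔ p (σ₁.nat counter 0 0) (bundles m σ₁)))
    (hJ : J 0 (bundles m σ))
    (hfree : ∀ i < n, ∀ X, J i X → p i X → (X n).Nonempty)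
    (hgive : ∀ i X X' f, J i X → p i X → Give n i f X X' → J (i + 1) X')
    (hkeep : ∀ i < n, ∀ X, J i X → ¬ p i X → J (i + 1) X)
    (hb : 200 * potential n m σ + n * (T.cost + 18) + x + 13 ≤ b) :
    Runs (pickIf T) σ b fun σ' b' => SameExcept roundArrays σ σ' ∧ State n m c s σ' ∧
      J n (bundles m σ') ∧ 200 * potential n m σ' + x ≤ b' := by
  refine .mono (runs_forAgents (x := x) (J := J) (T.cost + 2) 0 hσ hJ (by omega) ?_)
    fun σ' b' => by rw [mul_zero, add_zero]; exact id
  intro σ₁ b₁ i x hsame hσ₁ hi hcounter hJ₁ hb₁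
  refine .ite_skip (hcounter ▸ hT σ₁ hsame hσ₁) (fun hp => ?_)
    (fun hp => ⟨.refl, hσ₁, hkeep i hi _ hJ₁ hp, by omega⟩) (by omega)
  have hpos := Finset.card_pos.2 (hfree i hi _ hJ₁ hp)
  rw [← avail_all (c := c) (s := s)] at hpos
  refine .mono (runs_pick (x := x) hn hσ₁ hi hcounter hpos (by omega)) ?_
  rintro σ₂ b₂ ⟨hsame₂, hσ₂, hb₂, f, hG, -⟩
  exact ⟨hsame₂, hσ₂, hgive i _ _ f hJ₁ hp hG, by omega⟩

/-- Apart from the agents in `P`, who have received one free item each, the first `k` agents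
have received one each, as long as there were any. -/
def HandedOut (n : ℕ) (P : Finset ℕ) (X : ℕ → Finset ℕ) (k : ℕ) (X' : ℕ → Finset ℕ) : Prop :=
  ∃ D, Gifts n D X X' ∧ P ⊆ D ∧ D ⊆ P ∪ Finset.range k ∧ (X' n = ∅ ∨ Finset.range k ⊆ D)

theorem HandedOut.give {P : Finset ℕ} {X X' X'' : ℕ → Finset ℕ} {k f : ℕ}
    (h : HandedOut n P X k X') (hk : k ∉ P) (hG : Give n k f X' X'') :
    HandedOut n P X (k + 1) X'' := by
  obtain ⟨D, hD, hPD, hDP, hor⟩ := h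
  have hkD : k ∉ D := fun hkD => by simpa [hk] using hDP hkD
  have hrange : Finset.range k ⊆ D :=
    hor.resolve_left fun hempty => Finset.notMem_empty f (hempty ▸ hG.free)
  refine ⟨insert k D, hD.give hkD hG, hPD.trans (Finset.subset_insert _ _), ?_, .inr ?_⟩
  · rw [Finset.range_add_one, Finset.union_insert]
    exact Finset.insert_subset_insert k hDP
  · rw [Finset.range_add_one]
    exact Finset.insert_subset_insert k hrange

theorem HandedOut.keep {P : Finset ℕ} {X X' : ℕ → Finset ℕ} {k : ℕ} (h : HandedOut n P X k X')
    (hk : k ∈ P ∨ X' n = ∅) : HandedOut n P X (k + 1) X' := by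
  obtain ⟨D, hD, hPD, hDP, hor⟩ := h
  refine ⟨D, hD, hPD, hDP.trans (Finset.union_subset_union_right (by simp)), ?_⟩
  rcases hk with hk | hempty
  · rw [Finset.range_add_one]
    exact hor.imp_right (Finset.insert_subset (hPD hk))
  · exact .inl hempty

theorem runs_giveEach (hI : Separated n m c s l) (hσ : State n m c s σ)
    (hR : Ready n m c s l r (bundles m σ))
    (hpoor : ∀ i < n, σ.nat marks i 0 = 0 ↔ Poor n c s (bundles m σ) i)
    (hcard : (unmarked σ n).card ≤ (bundles m σ n).card) (hlt : (bundles m σ n).card < n)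
    (hb : 200 * potential n m σ + 100 * n + 50 ≤ b) :
    Runs giveEach σ b fun σ' _ => Solved n m c σ' := by
  have hn := hI.four_le
  refine .seq (.mono (runs_pickIf (x := n * 40 + 13) (p := fun i _ => σ.nat marks i 0 = 0)
    (J := fun i => Gifts n (unmarked σ i) (bundles m σ)) hn hσ
    (fun σ₁ hsame _ => by simp [hsame.nat]) (by simpa [unmarked] using Gifts.empty)
    (fun i hi X hG hp => ?_) (fun i X X' f hG hp => ?_) (fun i _ X hG hp => ?_)
    (by simp only [Test.cost, NatExpr.cost]; omega)) ?_)
  · have hsub : insert i (unmarked σ i) ⊆ unmarked σ n := by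
      intro j
      simp only [Finset.mem_insert, mem_unmarked]
      rintro (rfl | hj)
      exacts [⟨hi, hp⟩, ⟨hj.1.trans hi, hj.2⟩]
    have hle := Finset.card_le_card hsub
    rw [Finset.card_insert_of_notMem (by simp [mem_unmarked])] at hle
    have := hG.card
    exact Finset.card_pos.1 (by omega)
  · rw [unmarked_succ, if_pos hp]
    exact hG.give (by simp [mem_unmarked])
  · rwa [unmarked_succ, if_neg hp]
  rintro σ₁ b₁ ⟨hsame₁, hσ₁, hG₁, hb₁⟩
  refine .mono (runs_pickIf (x := 0) (p := fun i X => σ.nat marks i 0 ≠ 0 ∧ (X n).Nonempty)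
    (J := HandedOut n (unmarked σ n) (bundles m σ)) hn hσ₁ (fun σ₂ hsame₂ hσ₂ => ?_)
    ⟨_, hG₁, by simp⟩ (fun _ _ _ _ hp => hp.2) (fun i X X' f hJ hp => hJ.give ?_)
    (fun i hi X hJ hp => hJ.keep ?_) (by simp only [Test.cost, NatExpr.cost]; omega)) ?_
  · rw [Test.Holds, hσ₂.someFree_iff]
    simp [hsame₂.nat, hsame₁.nat]
  · simp [mem_unmarked, hp.1]
  · rw [← Finset.not_nonempty_iff_eq_empty, mem_unmarked]
    tauto
  rintro σ₂ b₂ ⟨-, hσ₂, ⟨D, hD, hPD, -, hor⟩, -⟩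
  refine hσ₂.solved (hor.resolve_right fun hrange => ?_) (hR.efx_of_gifts hI
    (fun i hi hp => hPD (mem_unmarked.2 ⟨hi, (hpoor i hi).2 hp⟩)) hD fun _ _ => bundle_subset)
  have hle := Finset.card_le_card hrange
  have := hD.card
  rw [Finset.card_range] at hle
  omega

theorem FeedInv.efx_of_empty {k : ℕ} {X : ℕ → Finset ℕ} (h : FeedInv n m c l k X)
    (hempty : X n = ∅) : EFX n c X := by
  intro i hi
  rcases eq_or_ne i k with rfl | hik
  · simpa [hempty] using h.tolerates
  · exact h.efx i hi hik

theorem runs_feed (hI : Separated n m c s l) (hσ : State n m c s σ) {k : ℕ} (hk : k < n)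
    (hrich : σ.nat rich 0 0 = k) (hF : FeedInv n m c l k (bundles m σ))
    (hb : 200 * potential n m σ + 50 ≤ b) :
    Runs feed σ b fun σ' _ => Solved n m c σ' := by
  have hn := hI.four_le
  refine .while_loop (I := fun σ₁ b₁ => State n m c s σ₁ ∧ σ₁.nat rich 0 0 = k ∧
    FeedInv n m c l k (bundles m σ₁) ∧ 200 * potential n m σ₁ + 30 ≤ b₁) ?_ ?_
    ⟨hσ, hrich, hF, by omega⟩
  · rintro σ₁ b₁ ⟨hσ₁, hrich₁, hF₁, hb₁⟩ hT
    have hpos := Finset.card_pos.2 (hσ₁.someFree_iff.1 hT)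
    rw [← avail_all (c := c) (s := s)] at hpos
    simp only [Test.cost, NatExpr.cost]
    refine ⟨by omega, .mono (runs_pick (x := 16) hn hσ₁ hk hrich₁ hpos (by omega)) ?_⟩
    rintro σ₂ b₂ ⟨hsame, hσ₂, hb₂, f, hG, -⟩
    exact ⟨hσ₂, by simp [hsame.nat, hrich₁], hF₁.give hI hG, by omega⟩
  · rintro σ₁ b₁ ⟨hσ₁, -, hF₁, hb₁⟩ hT
    have hempty := Finset.not_nonempty_iff_eq_empty.1 (mt hσ₁.someFree_iff.2 hT)
    exact ⟨by simp only [Test.cost, NatExpr.cost]; omega,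
      hσ₁.solved hempty (hF₁.efx_of_empty hempty)⟩

end Endgame

/-! ### Splitting the last items -/

/-- Scalar: an unmarked agent that owns fewest items. -/
@[simp] abbrev fewest : ℕ := 19

/-- Scalar: another unmarked agent, whose bundle is cheapest for the agent in scalar `fewest`. -/
@[simp] abbrev cheapest : ℕ := 20

/-- Scalar: the agent that receives the next item. -/
@[simp] abbrev receiver : ℕ := 21

/-- Real scalar: the larger one of the two costs. -/
@[simp] abbrev largeCost : ℕ := 2

/-- Real array of the costs of the bundles for the agent in scalar `fewest`. -/
@[simp] abbrev bundleCosts : ℕ := 3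

/-- The values of two expressions are equal. -/
def natEq (x y : NatExpr) : Test := .and (.natLe x y) (.natLe y x)

@[simp] theorem natEq_holds {x y : NatExpr} {σ : Store} :
    (natEq x y).Holds σ ↔ x.eval σ = y.eval σ :=
  le_antisymm_iff.symm

@[simp] theorem natEq_cost {x y : NatExpr} : (natEq x y).cost = 2 * (x.cost + y.cost) + 3 := by
  simp only [natEq, Test.cost]
  omega

/-- Computes the costs of the bundles for the agent in scalar `fewest`. -/
def sumCosts : Program :=
  .seq (forLoop counter (.succ numAgents) (.setReal bundleCosts (scalar counter) (.const 0) .zero))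
    (forLoop counter numItems (.setReal bundleCosts ownerOfCounter (.const 0)
      (.add (.cell bundleCosts ownerOfCounter (.const 0))
        (.cell 0 (scalar fewest) (scalar counter)))))

/-- Searches an unmarked agent that owns fewest items. -/
def findFewest : Program :=
  argmin fewest isUnmarked
    (.natLe (.cell sizes (scalar fewest) (.const 0)) (.cell sizes (scalar counter) (.const 0)))

/-- Searches an unmarked agent, other than the one in scalar `fewest`, with a cheapest bundle. -/
def findCheapest : Program :=
  argmin cheapest
    (.and isUnmarked (.not (natEq (scalar counter) (scalar fewest))))
    (.realLe (.cell bundleCosts (scalar cheapest) (.const 0))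
      (.cell bundleCosts (scalar counter) (.const 0)))

/-- Determines the two agents in the scalars `fewest` and `cheapest`. -/
def selectPair : Program :=
  .seq countSizes (.seq findFewest (.seq sumCosts findCheapest))

/-- The agent in scalar `fewest` takes over the bundle of the agent in scalar `cheapest`. -/
def takeOver : Program :=
  forLoop counter numItems
    (.ite (natEq ownerOfCounter (scalar cheapest))
      (.setNat owner (.const 0) (scalar counter) (scalar fewest)) .skip)

/-- Determines the receiver of the next item; it may have to hand over its bundle before. -/
def chooseReceiver : Program :=
  .ite (.realLe (.cell largeCost (.const 0) (.const 0))
      (.add (.cell bundleCosts (scalar cheapest) (.const 0))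
        (.cell bundleCosts (scalar cheapest) (.const 0))))
    (assign receiver (scalar fewest)) (.seq takeOver (assign receiver (scalar cheapest)))

/-- Gives away one item. -/
def splitStep : Program :=
  .seq selectPair (.seq chooseReceiver
    (.seq (pick receiver) (.setNat marks (scalar receiver) (.const 0) (.const 1))))

/-- Gives away the free items, each one to an unmarked agent, which is then marked. -/
def split : Program := .while someFree splitStep

/-- Agent `i` owns fewest items among the agents in `W`. For agent `i`, among the bundles of the
other agents in `W`, that of agent `j` is cheapest. -/
structure Selected (n : ℕ) (c : ℕ → ℕ → ℝ) (W : ℕ → Prop) (X : ℕ → Finset ℕ) (i j : ℕ) :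
    Prop where
  left_lt : i < n
  right_lt : j < n
  left : W i
  right : W j
  ne : j ≠ i
  card_le : ∀ k < n, W k → (X i).card ≤ (X k).card
  cost_le : ∀ k < n, W k → k ≠ i → setCost c i (X j) ≤ setCost c i (X k)

section SelectPair

variable {n m : ℕ} {c : ℕ → ℕ → ℝ} {s : ℝ} {σ : Store}

theorem setCost_bundle_succ {i j k : ℕ} {o : ℕ → ℕ} : setCost c i (bundle (k + 1) o j) =
    setCost c i (bundle k o j) + if o k = j then c i k else 0 := by
  rw [bundle_succ]
  split_ifs
  · exact setCost_insert fun h => lt_irrefl _ (mem_bundle.1 h).1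
  · exact (add_zero _).symm

theorem runs_sumCosts (hσ : State n m c s σ) (hc : σ.real 0 = c) {i : ℕ}
    (hi : σ.nat fewest 0 0 = i) :
    Runs sumCosts σ (n * 100 + m * 100 + 100) fun σ' _ =>
      SameExcept [counter] σ σ' [bundleCosts] ∧
      ∀ j < n, σ'.real bundleCosts j 0 = setCost c i (bundles m σ j) := by
  refine .seq (.frame (.for_loop_const (N := n + 1) (C := 10) (J := fun k σ₁ =>
    SameExcept [counter] σ σ₁ [bundleCosts] ∧ ∀ j < k, σ₁.real bundleCosts j 0 = 0)
    ?_ ?_ ?_ fun _ h => h) (by simp; omega) ?_)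
  · exact ⟨SameExcept.refl.write, by simp⟩
  · rintro k σ₁ ⟨hsame, -⟩
    simpa [hsame.nat] using hσ.agents
  · rintro k σ₁ - hcounter ⟨hsame, hzero⟩
    refine .setReal hcounter rfl rfl
      ⟨by simpa using hcounter, hsame.writeReal.write, fun j hj => ?_⟩
    rcases Nat.lt_succ_iff_lt_or_eq.1 hj with hj | rfl
    · simp [hzero j hj]
    · simp
  rintro σ₁ ⟨hsame₁, hzero⟩
  refine .frame (.for_loop_const (N := m) (C := 30) (J := fun k σ₂ =>
    SameExcept [counter] σ σ₂ [bundleCosts] ∧ ∀ j ≤ n, σ₂.real bundleCosts j 0 =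
      setCost c i (bundle k (σ.nat owner 0) j)) ?_ ?_ ?_ fun _ h => h) (by simp; omega)
    fun σ₂ h => ⟨h.1, fun j hj => h.2 j hj.le⟩
  · exact ⟨hsame₁.write, fun j hj => by simp [hzero j (by omega), bundle, setCost]⟩
  · rintro k σ₂ ⟨hsame, -⟩
    simpa [hsame.nat] using hσ.items
  · rintro k σ₂ - hcounter ⟨hsame, hcost⟩
    refine .setReal rfl rfl rfl
      ⟨by simpa using hcounter, hsame.writeReal.write, fun j hj => ?_⟩
    rw [setCost_bundle_succ]
    rcases eq_or_ne j (σ.nat owner 0 k) with rfl | hjk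
    · simp [hsame.nat, hsame.real, hcounter, hcost _ hj, hc, hi]
    · simp [hsame.nat, hcounter, hcost _ hj, hjk, hjk.symm]

theorem runs_findFewest (hn : σ.nat 0 0 0 = n) :
    Runs findFewest σ (n * 52 + 19) fun σ' _ => SameExcept [fewest, counter] σ σ' ∧
      ArgMin n (fun i => σ.nat marks i 0 = 0) (σ.nat sizes · 0) n (σ'.nat fewest 0 0) :=
  runs_argmin hn (fun σ' hsame _ => by simp [hsame.nat]) fun σ' hsame _ _ => by simp [hsame.nat]

theorem runs_findCheapest (hn : σ.nat 0 0 0 = n) {i : ℕ} (hi : σ.nat fewest 0 0 = i) :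
    Runs findCheapest σ (n * 69 + 19) fun σ' _ => SameExcept [cheapest, counter] σ σ' ∧
      ArgMin n (fun j => σ.nat marks j 0 = 0 ∧ j ≠ i) (σ.real bundleCosts · 0) n
        (σ'.nat cheapest 0 0) :=
  runs_argmin hn
    (fun σ' hsame _ => by simp [hsame.nat, hi])
    fun σ' hsame _ _ => by simp [hsame.real]

theorem ArgMin.lt_of_exists {p : ℕ → Prop} {α : Type*} [LE α] {key : ℕ → α} {j : ℕ}
    (h : ArgMin n p key n j) (hp : ∃ i < n, p i) : j < n :=
  h.le.lt_of_ne fun hj => by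
    obtain ⟨i, hi, hpi⟩ := hp
    exact h.of_eq hj i hi hpi

theorem runs_selectPair (hσ : State n m c s σ) (hc : σ.real 0 = c)
    (hcard : 1 < (unmarked σ n).card) :
    Runs selectPair σ (n * 400 + m * 200 + 300) fun σ' _ =>
      SameExcept [sizes, counter, fewest, cheapest] σ σ' [bundleCosts] ∧
      Selected n c (fun k => σ.nat marks k 0 = 0) (bundles m σ) (σ'.nat fewest 0 0)
        (σ'.nat cheapest 0 0) ∧
      σ'.real bundleCosts (σ'.nat cheapest 0 0) 0 =
        setCost c (σ'.nat fewest 0 0) (bundles m σ (σ'.nat cheapest 0 0)) := by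
  refine .seq (.frame (runs_countSizes hσ) (by omega) ?_)
  rintro σ₁ ⟨hsame₁, hsize⟩
  refine .seq (.frame (runs_findFewest (hσ.congr hsame₁).agents) (by omega) ?_)
  rintro σ₂ ⟨hsame₂, hfew⟩
  have hsame₁₂ : SameExcept [sizes, counter, fewest, cheapest] σ σ₂ [bundleCosts] :=
    hsame₁.mono.trans hsame₂.mono
  have hσ₂ := hσ.congr hsame₁₂
  refine .seq (.frame (runs_sumCosts hσ₂ (by simp [hsame₁₂.real, hc]) rfl) (by omega) ?_)
  rintro σ₃ ⟨hsame₃, hcost⟩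
  refine .frame (runs_findCheapest (hσ₂.congr hsame₃).agents
    (by rw [hsame₃.nat fewest (by simp)])) (by omega) ?_
  rintro σ₄ ⟨hsame₄, hcheap⟩
  have hfewest : σ₄.nat fewest 0 0 = σ₂.nat fewest 0 0 := by simp [hsame₄.nat, hsame₃.nat]
  simp only [hsame₁.nat marks (by simp)] at hfew
  simp only [hsame₃.nat marks (by simp), hsame₁₂.nat marks (by simp)] at hcheap
  rw [hsame₁₂.bundles_eq] at hcost
  rw [hfewest]
  generalize σ₂.nat fewest 0 0 = i at *
  generalize σ₄.nat cheapest 0 0 = j at *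
  have hi : i < n := hfew.lt_of_exists <| by
    obtain ⟨k, hk⟩ := Finset.card_pos.1 (zero_lt_one.trans hcard)
    exact ⟨k, mem_unmarked.1 hk⟩
  have hj : j < n := hcheap.lt_of_exists <| by
    obtain ⟨k, hk, hki⟩ := Finset.exists_mem_ne hcard i
    exact ⟨k, (mem_unmarked.1 hk).1, (mem_unmarked.1 hk).2, hki⟩
  obtain ⟨hWi, hmin⟩ := hfew.of_lt hi
  obtain ⟨⟨hWj, hji⟩, hmin'⟩ := hcheap.of_lt hj
  refine ⟨hsame₁₂.trans (hsame₃.mono.trans hsame₄.mono), ⟨hi, hj, hWi, hWj, hji,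
    fun k hk hWk => hsize i hi ▸ hsize k hk ▸ hmin k hk hWk,
    fun k hk hWk hki => hcost j hj ▸ hcost k hk ▸ hmin' k hk ⟨hWk, hki⟩⟩, ?_⟩
  rw [hsame₄.real _ (by simp), hcost j hj]

end SelectPair

section TakeOver

variable {n m : ℕ} {c : ℕ → ℕ → ℝ} {s : ℝ} {σ σ' : Store} {i j : ℕ}

/-- Agent `i` takes over the bundle of agent `j`. -/
def relabel (i j : ℕ) (o : ℕ → ℕ) (e : ℕ) : ℕ := if o e = j then i else o e

theorem bundle_relabel_left {o : ℕ → ℕ} :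
    bundle m (relabel i j o) i = bundle m o i ∪ bundle m o j := by
  ext e
  simp only [mem_bundle, relabel, Finset.mem_union]
  split_ifs <;> tauto

theorem bundle_relabel_right {o : ℕ → ℕ} (hji : j ≠ i) : bundle m (relabel i j o) j = ∅ := by
  ext e
  simp only [mem_bundle, relabel, Finset.notMem_empty, iff_false, not_and]
  split_ifs with h
  exacts [fun _ => hji.symm, fun _ => h]

theorem bundle_relabel_of_ne {o : ℕ → ℕ} {k : ℕ} (hki : k ≠ i) (hkj : k ≠ j) :
    bundle m (relabel i j o) k = bundle m o k := by
  ext e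
  simp only [mem_bundle, relabel]
  split_ifs with h
  · simp [h, hki.symm, hkj.symm]
  · rfl

theorem bundle_congr {o o' : ℕ → ℕ} (h : ∀ e < m, o' e = o e) : bundle m o' = bundle m o := by
  funext k
  exact Finset.filter_congr fun e he => by rw [h e (Finset.mem_range.1 he)]

theorem runs_takeOver (hm : σ.nat 0 0 1 = m) (hi : σ.nat fewest 0 0 = i)
    (hj : σ.nat cheapest 0 0 = j) :
    Runs takeOver σ (m * 50 + 13) fun σ' _ => SameExcept [owner, counter] σ σ' ∧
      ∀ e < m, σ'.nat owner 0 e = relabel i j (σ.nat owner 0) e := by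
  refine .frame (.for_loop_const (N := m) (C := 34) (J := fun k σ₁ =>
    SameExcept [owner, counter] σ σ₁ ∧ ∀ e, σ₁.nat owner 0 e =
      if e < k then relabel i j (σ.nat owner 0) e else σ.nat owner 0 e) ?_ ?_ ?_ fun _ h => h)
    (by simp) fun σ₁ h => ⟨h.1, fun e he => by rw [h.2, if_pos he]⟩
  · exact ⟨SameExcept.refl.write, by simp⟩
  · rintro k σ₁ ⟨hsame, -⟩
    simpa [hsame.nat] using hm
  · rintro k σ₁ - hcounter ⟨hsame, howner⟩
    refine .ite_skip (P := σ.nat owner 0 k = j)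
      (by simp [hsame.nat, hcounter, howner, hj])
      (fun hk => .setNat rfl hcounter rfl
        ⟨by simpa using hcounter, hsame.write.write, fun e => ?_⟩)
      fun hk => ⟨hcounter, hsame.write, fun e => ?_⟩ <;>
    rcases eq_or_ne e k with rfl | hek
    · simp [relabel, hsame.nat, hi, hk]
    · simp [howner, hek, hek.le_iff_lt]
    · simp [howner, relabel, hk]
    · simp [howner, hek.le_iff_lt]

theorem State.of_relabel (hσ : State n m c s σ) (hsame : SameExcept [owner, counter] σ σ')
    (howner : ∀ e < m, σ'.nat owner 0 e = relabel i j (σ.nat owner 0) e) (hi : i < n)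
    (hj : j < n) : State n m c s σ' := by
  have hfree : bundles m σ' n = bundles m σ n := by
    rw [bundles, bundle_congr howner, bundle_relabel_of_ne hi.ne' hj.ne']
  refine ⟨?_, ?_, fun e he => ?_, ?_, fun v hv => ?_, ?_, fun v hv e he hoe => ?_⟩
  · simpa [hsame.nat] using hσ.agents
  · simpa [hsame.nat] using hσ.items
  · rw [howner e he, relabel]
    split_ifs
    exacts [hi.le, hσ.owner_le e he]
  · simpa [hsame.nat] using hσ.hits
  · rw [hsame.nat availCount (by simp), hσ.count v hv, avail, avail, hfree]
  · simpa [hsame.nat] using hσ.pointer_le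
  · rw [hsame.nat pointer (by simp)] at he
    refine hσ.passed v hv e he ?_
    rw [howner e (he.trans_le (hσ.pointer_le v hv)), relabel] at hoe
    split_ifs at hoe
    exacts [absurd hoe hi.ne, hoe]

theorem merge_of_relabel {o o' : ℕ → ℕ} (ho : ∀ e < m, o' e = relabel i j o e)
    (hi : i < n) (hj : j < n) (hji : j ≠ i) {f : ℕ} {X : ℕ → Finset ℕ}
    (hG : Give n j f (bundle m o') X) : Merge n i j f (bundle m o) X := by
  rw [bundle_congr ho] at hG
  have hfree : bundle m (relabel i j o) n = bundle m o n :=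
    bundle_relabel_of_ne hi.ne' hj.ne'
  refine ⟨hi, hj, hfree ▸ hG.free, ?_, ?_, hfree ▸ hG.rest_subset, fun k hk hki hkj => ?_⟩
  · rw [hG.other i hi hji.symm, bundle_relabel_left]
  · rw [hG.self, bundle_relabel_right hji]
    rfl
  · rw [hG.other k hk hkj, bundle_relabel_of_ne hki hkj]

end TakeOver

section Split

variable {n m : ℕ} {c : ℕ → ℕ → ℝ} {s l : ℝ} {r : ℕ} {W : ℕ → Prop} {σ : Store} {b x : ℕ}

theorem disjoint_bundle {i j : ℕ} {o : ℕ → ℕ} (hji : j ≠ i) :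
    Disjoint (bundle m o i) (bundle m o j) :=
  Finset.disjoint_left.2 fun _ hi hj => hji ((mem_bundle.1 hj).2.symm.trans (mem_bundle.1 hi).2)

theorem Selected.take {X X' : ℕ → Finset ℕ} {i j f : ℕ} (hI : Separated n m c s l)
    (h : Selected n c W X i j) (hX : SplitInv n m c s l r W X)
    (hge : l ≤ 2 * setCost c i (X j)) (hG : Give n i f X X') :
    SplitInv n m c s l r (fun k => W k ∧ k ≠ i) X' :=
  hX.take hI h.left (fun k hk hWk _ => h.card_le k hk hWk)
    (fun k hk hWk hki => by linarith [h.cost_le k hk hWk hki]) hG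

theorem Selected.merge {X X' : ℕ → Finset ℕ} {i j f : ℕ} (hI : Separated n m c s l)
    (h : Selected n c W X i j) (hX : SplitInv n m c s l r W X) (hdisj : Disjoint (X i) (X j))
    (hlt : 2 * setCost c i (X j) < l) (hM : Merge n i j f X X') :
    SplitInv n m c s l r (fun k => W k ∧ k ≠ j) X' :=
  hM.splitInv hI hX ⟨h.left, h.right, hdisj, h.card_le, h.cost_le, hlt⟩

theorem runs_chooseReceiver (hI : Separated n m c s l) (hσ : State n m c s σ) {i j : ℕ}
    (hi : σ.nat fewest 0 0 = i) (hj : σ.nat cheapest 0 0 = j)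
    (hX : SplitInv n m c s l r W (bundles m σ)) (hsel : Selected n c W (bundles m σ) i j)
    (hl : σ.real largeCost 0 0 = l)
    (hcost : σ.real bundleCosts j 0 = setCost c i (bundles m σ j)) :
    Runs chooseReceiver σ (m * 50 + 60) fun σ' _ =>
      SameExcept [owner, counter, receiver] σ σ' ∧ State n m c s σ' ∧
      bundles m σ' n = bundles m σ n ∧ ∃ p < n, σ'.nat receiver 0 0 = p ∧ W p ∧
        ∀ f X', Give n p f (bundles m σ') X' → SplitInv n m c s l r (fun k => W k ∧ k ≠ p) X' := by
  refine .ite (P := l ≤ 2 * setCost c i (bundles m σ j))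
    (by simp [hl, hj, hcost, two_mul]) (fun hge => .assign rfl ?_) fun hlt => ?_
  · have hsame : SameExcept [owner, counter, receiver] σ
        (σ.writeNat receiver 0 0 ((scalar fewest).eval σ)) := SameExcept.refl.write
    have hsame' : SameExcept [receiver] σ (σ.writeNat receiver 0 0 ((scalar fewest).eval σ)) :=
      SameExcept.refl.write
    refine ⟨hsame, hσ.congr hsame', by rw [hsame'.bundles_eq], i, hsel.left_lt, by simp [hi],
      hsel.left, fun f X' hG => hsel.take (f := f) hI hX hge ?_⟩
    rwa [hsame'.bundles_eq] at hG
  · refine .seq (.frame (runs_takeOver hσ.items hi hj) (by simp) ?_)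
    rintro σ₁ ⟨hsame₁, howner⟩
    have hσ₁ := hσ.of_relabel hsame₁ howner hsel.left_lt hsel.right_lt
    have hsame₂ : SameExcept [receiver] σ₁
        (σ₁.writeNat receiver 0 0 ((scalar cheapest).eval σ₁)) := SameExcept.refl.write
    refine .assign rfl ⟨hsame₁.mono.trans hsame₂.mono, hσ₁.congr hsame₂, ?_, j, hsel.right_lt,
      by simp [hsame₁.nat, hj], hsel.right, fun f X' hG => ?_⟩
    · rw [hsame₂.bundles_eq, bundles, bundle_congr howner,
        bundle_relabel_of_ne hsel.left_lt.ne' hsel.right_lt.ne']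
    · rw [hsame₂.bundles_eq] at hG
      exact hsel.merge hI hX (disjoint_bundle hsel.ne) (not_le.1 hlt)
        (merge_of_relabel howner hsel.left_lt hsel.right_lt hsel.ne hG)

theorem SplitInv.congr {W' : ℕ → Prop} {X : ℕ → Finset ℕ} (h : SplitInv n m c s l r W X)
    (hW : ∀ i < n, W i ↔ W' i) : SplitInv n m c s l r W' X where
  subset := h.subset
  pos := h.pos
  efx := h.efx
  small i hi hWi := h.small i hi ((hW i hi).2 hWi)
  size i hi hWi := h.size i hi ((hW i hi).2 hWi)
  large j hj hWj := h.large j hj (mt (hW j hj).1 hWj)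
  tolerant i hi hWi j hj hWj := h.tolerant i hi ((hW i hi).2 hWi) j hj (mt (hW j hj).1 hWj)
  light := h.light
  lighter hrs i hi hWi := h.lighter hrs i hi ((hW i hi).2 hWi)
  free := h.free

/-- The memory while the remaining items are split. -/
structure SplitState (n m : ℕ) (c : ℕ → ℕ → ℝ) (s l : ℝ) (r : ℕ) (σ : Store) : Prop where
  state : State n m c s σ
  inv : SplitInv n m c s l r (fun j => σ.nat marks j 0 = 0) (bundles m σ)
  lt : (bundles m σ n).card < (unmarked σ n).card
  costs : σ.real 0 = c
  large : σ.real largeCost 0 0 = l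

/-- The arrays changed by the program `splitStep`. -/
abbrev splitArrays : List ℕ := marks :: sizes :: fewest :: cheapest :: receiver :: roundArrays

theorem unmarked_mark {σ' : Store} {p k : ℕ} (h : ∀ j, σ'.nat marks j 0 = 0 ↔
    σ.nat marks j 0 = 0 ∧ j ≠ p) : unmarked σ' k = (unmarked σ k).erase p := by
  ext j
  simp only [mem_unmarked, h, Finset.mem_erase]
  tauto

theorem SplitState.give {σ' : Store} {p : ℕ} (h : SplitState n m c s l r σ)
    (hsame : SameExcept splitArrays σ σ' [bundleCosts]) (hσ' : State n m c s σ') (hp : p < n)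
    (hunmarked : σ.nat marks p 0 = 0)
    (hmarks : ∀ j, σ'.nat marks j 0 = 0 ↔ σ.nat marks j 0 = 0 ∧ j ≠ p)
    (hcard : (bundles m σ' n).card + 1 = (bundles m σ n).card)
    (hX : SplitInv n m c s l r (fun k => σ.nat marks k 0 = 0 ∧ k ≠ p) (bundles m σ')) :
    SplitState n m c s l r σ' where
  state := hσ'
  inv := hX.congr fun j _ => (hmarks j).symm
  lt := by
    rw [unmarked_mark hmarks, Finset.card_erase_of_mem (mem_unmarked.2 ⟨hp, hunmarked⟩)]
    have := h.lt
    omega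
  costs := by rw [hsame.real 0 (by simp), h.costs]
  large := by rw [hsame.real largeCost (by simp), h.large]

theorem runs_splitStep (hI : Separated n m c s l) (h : SplitState n m c s l r σ)
    (hfree : (bundles m σ n).Nonempty)
    (hb : 200 * potential n m σ + 400 * n + 250 * m + 380 + x ≤ b) :
    Runs splitStep σ b fun σ' b' => SplitState n m c s l r σ' ∧
      (bundles m σ' n).card + 1 = (bundles m σ n).card ∧ 200 * potential n m σ' + x ≤ b' := by
  have hpos := Finset.card_pos.2 hfree
  refine .seq (.frame (runs_selectPair h.state h.costs (Nat.lt_of_le_of_lt hpos h.lt))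
    (by omega) ?_)
  rintro σ₁ ⟨hsame₁, hsel, hcost⟩
  have hX₁ := hsame₁.bundles_eq (m := m)
  rw [← hX₁] at hsel hcost
  refine .seq (.frame (runs_chooseReceiver hI (h.state.congr hsame₁) rfl rfl (hX₁ ▸ h.inv) hsel
    (by rw [hsame₁.real _ (by simp), h.large]) hcost) (by omega) ?_)
  rintro σ₂ ⟨hsame₂, hσ₂, hfree₂, p, hp, hreceiver, hunmarked, hgive⟩
  rw [hX₁] at hfree₂
  have hpot : potential n m σ₂ = potential n m σ := by
    rw [potential, hfree₂, hsame₂.nat pointer (by simp), hsame₁.nat pointer (by simp), potential]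
  refine .seq (.mono (runs_pick (x := x + 20) hI.four_le hσ₂ hp hreceiver
    (by rwa [avail_all, hfree₂]) (by omega)) ?_)
  rintro σ₃ b₃ ⟨hsame₃, hσ₃, hb₃, f, hG, -⟩
  have hreceiver₃ : (scalar receiver).eval σ₃ = p := by simp [hsame₃.nat, hreceiver]
  refine .setNat hreceiver₃ (rfl : _ = 0) (rfl : _ = 1) ?_
    (by simp only [NatExpr.cost]; omega)
  have hsame₄ : SameExcept [marks] σ₃ (σ₃.writeNat marks p 0 1) := SameExcept.refl.write
  have hcard : (bundles m σ₃ n).card + 1 = (bundles m σ n).card := by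
    rw [← hfree₂]
    exact hG.card_rest
  rw [hsame₄.bundles_eq, hsame₄.potential_eq]
  refine ⟨h.give (hsame₁.mono.trans (hsame₂.mono.trans (hsame₃.mono.trans hsame₄.mono)))
    (hσ₃.congr hsame₄) hp hunmarked (fun j => ?_) ?_ ?_, hcard,
    by simp only [NatExpr.cost]; omega⟩
  · rcases eq_or_ne j p with rfl | hj <;> simp [hsame₁.nat, hsame₂.nat, hsame₃.nat, *]
  · rwa [hsame₄.bundles_eq]
  · rw [hsame₄.bundles_eq]
    exact hgive f _ hG

theorem runs_split (hI : Separated n m c s l) (h : SplitState n m c s l r σ)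
    (hb : 200 * potential n m σ + 600 * (n + m) * (bundles m σ n).card + 20 ≤ b) :
    Runs split σ b fun σ' _ => Solved n m c σ' := by
  have hn := hI.four_le
  refine .while_loop (I := fun σ₁ b₁ => SplitState n m c s l r σ₁ ∧
    200 * potential n m σ₁ + 600 * (n + m) * (bundles m σ₁ n).card + 20 ≤ b₁) ?_ ?_ ⟨h, hb⟩
  · rintro σ₁ b₁ ⟨h₁, hb₁⟩ hT
    have hfree := h₁.state.someFree_iff.1 hT
    obtain ⟨k, hk⟩ := Nat.exists_eq_succ_of_ne_zero (Finset.card_pos.2 hfree).ne'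
    rw [hk, Nat.mul_succ] at hb₁
    simp only [Test.cost, NatExpr.cost]
    refine ⟨by omega, .mono (runs_splitStep (x := 600 * (n + m) * k + 20) hI h₁ hfree
      (by omega)) ?_⟩
    rintro σ₂ b₂ ⟨h₂, hcard, hb₂⟩
    obtain rfl : (bundles m σ₂ n).card = k := by omega
    exact ⟨h₂, by omega⟩
  · rintro σ₁ b₁ ⟨h₁, hb₁⟩ hT
    exact ⟨by simp only [Test.cost, NatExpr.cost]; omega, h₁.state.solved
      (Finset.not_nonempty_iff_eq_empty.1 (mt h₁.state.someFree_iff.2 hT)) h₁.inv.efx⟩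

end Split

/-- Determines the marks, the sizes of the bundles, and the scalars `numUnmarked` and `rich`. -/
def inspect : Program := .seq markRich (.seq countSizes (.seq countUnmarked findRich))

/-- Gives away the free items by the method that the results of `inspect` suggest. -/
def distribute : Program :=
  .ite (.natLe (scalar numUnmarked) numFree) giveEach
    (.ite (.natLe (.succ (scalar rich)) numAgents) feed split)

/-- Gives away the items that the main phase leaves. -/
def endPhase : Program := .ite someFree (.seq inspect distribute) .skip

section EndPhase

variable {n m : ℕ} {c : ℕ → ℕ → ℝ} {s l : ℝ} {r : ℕ} {σ : Store} {b : ℕ}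

/-- The memory after the program `inspect`. -/
structure Inspected (n m : ℕ) (c : ℕ → ℕ → ℝ) (s : ℝ) (σ : Store) : Prop where
  unmarked_iff : ∀ i, σ.nat marks i 0 = 0 ↔ Poor n c s (bundles m σ) i
  numUnmarked_eq : σ.nat numUnmarked 0 0 = (unmarked σ n).card
  rich_argMin : ArgMin n (fun i => ¬ Poor n c s (bundles m σ) i ∧ 2 ≤ (bundles m σ i).card)
    (fun _ => 0) n (σ.nat rich 0 0)

theorem runs_inspect (hσ : State n m c s σ) (hmarks : ∀ i, σ.nat marks i 0 = 0) :
    Runs inspect σ (n * 300 + m * 150 + 200) fun σ' _ =>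
      SameExcept [marks, sizes, numUnmarked, rich, counter] σ σ' ∧ Inspected n m c s σ' := by
  refine .seq (.frame (runs_markRich hσ hmarks) (by omega) ?_)
  rintro σ₁ ⟨hsame₁, hpoor⟩
  have hσ₁ := hσ.congr hsame₁
  refine .seq (.frame (runs_countSizes hσ₁) (by omega) ?_)
  rintro σ₂ ⟨hsame₂, hsize⟩
  have hσ₂ := hσ₁.congr hsame₂
  refine .seq (.frame (runs_countUnmarked hσ₂.agents) (by omega) ?_)
  rintro σ₃ ⟨hsame₃, hcount⟩
  have hσ₃ := hσ₂.congr hsame₃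
  rw [← hsame₁.bundles_eq, ← hsame₂.bundles_eq, ← hsame₃.bundles_eq] at hpoor
  rw [← hsame₂.bundles_eq, ← hsame₃.bundles_eq] at hsize
  refine .frame (runs_search (p := fun i => ¬ Poor n c s (bundles m σ₃) i ∧
    2 ≤ (bundles m σ₃ i).card) hσ₃.agents fun σ' hsame hlt => ?_)
    (by simp only [Test.cost, NatExpr.cost]; omega) ?_
  · simp [hsame.nat, hsame₃.nat, hsame₂.nat, hpoor, hsize _ hlt]
  · rintro σ₄ ⟨hsame₄, hrich⟩
    refine ⟨hsame₁.mono.trans (hsame₂.mono.trans (hsame₃.mono.trans hsame₄.mono)), ?_, ?_, ?_⟩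
    · simpa [hsame₄.nat, hsame₃.nat, hsame₂.nat, hsame₄.bundles_eq] using hpoor
    · simpa [hsame₄.nat, hsame₃.nat, unmarked] using hcount
    · rwa [hsame₄.bundles_eq]

theorem runs_distribute (hI : Separated n m c s l) (hσ : State n m c s σ)
    (h : Inspected n m c s σ) (hR : Ready n m c s l r (bundles m σ))
    (hlt : (bundles m σ n).card < n) (hc : σ.real 0 = c) (hl : σ.real largeCost 0 0 = l)
    (hb : 200 * potential n m σ + 600 * (n + m) * n + 100 * n + 100 ≤ b) :
    Runs distribute σ b fun σ' _ => Solved n m c σ' := by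
  have hfree : numFree.eval σ = (bundles m σ n).card := by
    simp [hσ.agents, hσ.count, avail_all]
  refine .ite (P := (unmarked σ n).card ≤ (bundles m σ n).card)
    (by rw [Test.Holds, hfree, ← h.numUnmarked_eq]; rfl) (fun hcard => ?_) (fun hcard => ?_)
    (by simp only [Test.cost, NatExpr.cost]; omega)
  · exact runs_giveEach hI hσ hR (fun i _ => h.unmarked_iff i) hcard hlt
      (by simp only [Test.cost, NatExpr.cost]; omega)
  refine .ite (P := σ.nat rich 0 0 < n) (by simp [hσ.agents])
    (fun hrich => ?_) (fun hrich => ?_) (by simp only [Test.cost, NatExpr.cost]; omega)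
  · obtain ⟨⟨hp, htwo⟩, -⟩ := h.rich_argMin.of_lt hrich
    have hsub : unmarked σ n ⊆ (Finset.range n).erase (σ.nat rich 0 0) := fun i hi =>
      Finset.mem_erase.2 ⟨fun hi' => hp (hi' ▸ (h.unmarked_iff i).1 (mem_unmarked.1 hi).2),
        Finset.mem_range.2 (mem_unmarked.1 hi).1⟩
    have hle := Finset.card_le_card hsub
    rw [Finset.card_erase_of_mem (Finset.mem_range.2 hrich), Finset.card_range] at hle
    exact runs_feed hI hσ hrich rfl (hR.feed hI hrich hp htwo (by omega))
      (by simp only [Test.cost, NatExpr.cost]; omega)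
  · have hnone := h.rich_argMin.of_eq (h.rich_argMin.le.antisymm (not_lt.1 hrich))
    have hinv := hR.split hI fun i hi hp => not_le.1 fun htwo => hnone i hi ⟨hp, htwo⟩
    have hmul := Nat.mul_le_mul_left (600 * (n + m)) hlt.le
    exact runs_split hI ⟨hσ, hinv.congr fun i _ => (h.unmarked_iff i).symm, not_le.1 hcard, hc, hl⟩
      (by simp only [Test.cost, NatExpr.cost]; omega)

theorem runs_endPhase (hI : Separated n m c s l) (hσ : State n m c s σ)
    (hM : MainInv n m c s l r (bundles m σ))
    (hav : ∀ i < n, avail n c s (bundles m σ) i = 0)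
    (hlt : avail n c s (bundles m σ) (n + 1) < n)
    (hmarks : ∀ i, σ.nat marks i 0 = 0) (hc : σ.real 0 = c) (hl : σ.real largeCost 0 0 = l)
    (hb : 200 * potential n m σ + 600 * (n + m) * n + 400 * (n + m) + 400 ≤ b) :
    Runs endPhase σ b fun σ' _ => Solved n m c σ' := by
  refine .ite hσ.someFree_iff (fun hfree => ?_) (fun hfree => ?_)
    (by simp only [Test.cost, NatExpr.cost]; omega)
  · have hR := hM.ready hI hav (by rw [avail_all]; exact Finset.card_pos.2 hfree)
    rw [avail_all] at hlt
    refine .seq (.frame (runs_inspect hσ hmarks)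
      (by simp only [Test.cost, NatExpr.cost]; omega) ?_)
    rintro σ₁ ⟨hsame, hinspected⟩
    refine runs_distribute hI (hσ.congr hsame) hinspected (hsame.bundles_eq ▸ hR)
      (by rwa [hsame.bundles_eq]) (by rw [hsame.real 0 (by simp), hc])
      (by rw [hsame.real _ (by simp), hl]) ?_
    rw [hsame.potential_eq]
    simp only [Test.cost, NatExpr.cost]
    omega
  · exact .skip (hσ.solved (Finset.not_nonempty_iff_eq_empty.1 hfree) hM.efx)
      (by simp only [Test.cost, NatExpr.cost]; omega)

end EndPhase

/-! ### The least and the greatest cost -/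

/-- Scalar: the loop counter of loops over the agents that contain a loop over the items. -/
@[simp] abbrev row : ℕ := 22

/-- Real scalar: the smaller one of the two costs. -/
@[simp] abbrev smallCost : ℕ := 1

/-- The cost of the item in scalar `counter` to the agent in scalar `row`. -/
abbrev currentCost : RealExpr := .cell 0 (scalar row) (scalar counter)

/-- Takes the current cost into account in `smallCost` and `largeCost`. -/
def updateExtremes : Program :=
  .seq (.ite (.realLe currentCost (.cell smallCost (.const 0) (.const 0)))
      (.setReal smallCost (.const 0) (.const 0) currentCost) .skip)
    (.ite (.realLe (.cell largeCost (.const 0) (.const 0)) currentCost)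
      (.setReal largeCost (.const 0) (.const 0) currentCost) .skip)

/-- Computes the least and the greatest cost. -/
def findExtremes : Program :=
  .seq (.setReal smallCost (.const 0) (.const 0) (.cell 0 (.const 0) (.const 0)))
    (.seq (.setReal largeCost (.const 0) (.const 0) (.cell 0 (.const 0) (.const 0)))
      (forLoop row numAgents (forLoop counter numItems updateExtremes)))

/-- The least and the greatest cost `c i e` of the pairs `(i, e)` in `T` are `s` and `l`. -/
structure Extremes (c : ℕ → ℕ → ℝ) (T : Set (ℕ × ℕ)) (s l : ℝ) : Prop where
  least : IsLeast (Function.uncurry c '' T) s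
  greatest : IsGreatest (Function.uncurry c '' T) l

/-- The pairs considered by `findExtremes` when row `i` has been read up to column `e`. -/
def scanned (m i e : ℕ) : Set (ℕ × ℕ) :=
  insert (0, 0) {p | p.1 < i ∧ p.2 < m ∨ p.1 = i ∧ p.2 < e}

section Extremes

variable {n m : ℕ} {c : ℕ → ℕ → ℝ} {s l : ℝ} {σ : Store} {i e : ℕ}

theorem Extremes.insert {T : Set (ℕ × ℕ)} (h : Extremes c T s l) :
    Extremes c (insert (i, e) T) (min (c i e) s) (max (c i e) l) := by
  constructor <;> rw [Set.image_insert_eq]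
  exacts [h.least.insert _, h.greatest.insert _]

theorem Extremes.bounds (h : Extremes c (Set.Iio n ×ˢ Set.Iio m) s l) (hi : i < n) (he : e < m) :
    s ≤ c i e ∧ c i e ≤ l :=
  have hmem : c i e ∈ Function.uncurry c '' (Set.Iio n ×ˢ Set.Iio m) := ⟨(i, e), ⟨hi, he⟩, rfl⟩
  ⟨h.least.2 hmem, h.greatest.2 hmem⟩

theorem scanned_zero_zero : scanned m 0 0 = {(0, 0)} := by
  simp [scanned]

theorem scanned_succ_column : scanned m i (e + 1) = insert (i, e) (scanned m i e) := by
  ext ⟨i', e'⟩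
  simp only [scanned, Set.mem_insert_iff, Set.mem_ofPred_eq, Prod.mk.injEq]
  omega

theorem scanned_succ_row : scanned m (i + 1) 0 = scanned m i m := by
  ext ⟨i', e'⟩
  simp only [scanned, Set.mem_insert_iff, Set.mem_ofPred_eq, Prod.mk.injEq]
  omega

theorem scanned_all (hn : 0 < n) (hm : 0 < m) : scanned m n 0 = Set.Iio n ×ˢ Set.Iio m := by
  ext ⟨i', e'⟩
  simp only [scanned, Set.mem_insert_iff, Set.mem_ofPred_eq, Prod.mk.injEq, Set.mem_prod,
    Set.mem_Iio]
  omega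

theorem runs_updateExtremes (hc : σ.real 0 = c) (hrow : σ.nat row 0 0 = i)
    (hcounter : σ.nat counter 0 0 = e) :
    Runs updateExtremes σ 50 fun σ' _ => SameExcept [] σ σ' [smallCost, largeCost] ∧
      σ'.real smallCost 0 0 = min (c i e) (σ.real smallCost 0 0) ∧
      σ'.real largeCost 0 0 = max (c i e) (σ.real largeCost 0 0) := by
  have hcost : currentCost.eval σ = c i e := by simp_all
  refine .seq (.ite_skip (P := c i e ≤ σ.real smallCost 0 0) (by rw [← hcost]; rfl)
    (fun hmin => .setReal rfl rfl hcost ?_) fun hmin => ?_)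
  · refine .ite_skip (P := σ.real largeCost 0 0 ≤ c i e) (by simp_all)
      (fun hmax => .setReal rfl rfl (v := c i e) (by simp_all)
        ⟨SameExcept.refl.writeReal.writeReal, by simp [hmin], by simp [hmax]⟩)
      fun hmax => ⟨SameExcept.refl.writeReal, by simp [hmin], by simp [(not_le.1 hmax).le]⟩
  · refine .ite_skip (P := σ.real largeCost 0 0 ≤ c i e) (by rw [← hcost]; rfl)
      (fun hmax => .setReal rfl rfl hcost
        ⟨SameExcept.refl.writeReal, by simp [(not_le.1 hmin).le], by simp [hmax]⟩)
      fun hmax => ⟨.refl, by simp [(not_le.1 hmin).le], by simp [(not_le.1 hmax).le]⟩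

theorem runs_scanRow (hm : σ.nat 0 0 1 = m) (hc : σ.real 0 = c) (hrow : σ.nat row 0 0 = i)
    (h : Extremes c (scanned m i 0) (σ.real smallCost 0 0) (σ.real largeCost 0 0)) :
    Runs (forLoop counter numItems updateExtremes) σ (m * 66 + 13) fun σ' _ =>
      SameExcept [counter] σ σ' [smallCost, largeCost] ∧
      Extremes c (scanned m (i + 1) 0) (σ'.real smallCost 0 0) (σ'.real largeCost 0 0) := by
  refine .frame (.for_loop_const (N := m) (C := 50) (J := fun e σ₁ =>
    SameExcept [counter] σ σ₁ [smallCost, largeCost] ∧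
    Extremes c (scanned m i e) (σ₁.real smallCost 0 0) (σ₁.real largeCost 0 0)) ?_ ?_ ?_
    fun _ h => h) (by simp) fun _ h => by rwa [scanned_succ_row]
  · exact ⟨SameExcept.refl.write, by simpa using h⟩
  · rintro e σ₁ ⟨hsame, -⟩
    simpa [hsame.nat] using hm
  · rintro e σ₁ - hcounter ⟨hsame, hext⟩
    refine .frame (runs_updateExtremes (by rw [hsame.real 0 (by simp), hc])
      (by rw [hsame.nat _ (by simp), hrow]) hcounter) le_rfl ?_
    rintro σ₂ ⟨hsame₂, hmin, hmax⟩
    refine ⟨by rw [hsame₂.nat _ (by simp), hcounter], (hsame.trans hsame₂.mono).write, ?_⟩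
    rw [Store.real_writeNat, hmin, hmax, scanned_succ_column]
    exact hext.insert

theorem runs_findExtremes (hagents : σ.nat 0 0 0 = n) (hitems : σ.nat 0 0 1 = m) (hn : 0 < n)
    (hm : 0 < m) (hc : σ.real 0 = c) :
    Runs findExtremes σ (n * (m * 66 + 29) + 40) fun σ' _ =>
      SameExcept [row, counter] σ σ' [smallCost, largeCost] ∧
      Extremes c (Set.Iio n ×ˢ Set.Iio m) (σ'.real smallCost 0 0) (σ'.real largeCost 0 0) := by
  refine .seq (.setReal rfl rfl (v := c 0 0) (by simp [hc]) (.seq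
    (.setReal rfl rfl (v := c 0 0) (by simp [hc]) ?_)))
  refine .frame (.for_loop_const (N := n) (C := m * 66 + 13) (J := fun i σ₁ =>
    SameExcept [row, counter] σ σ₁ [smallCost, largeCost] ∧
    Extremes c (scanned m i 0) (σ₁.real smallCost 0 0) (σ₁.real largeCost 0 0)) ?_ ?_ ?_
    fun _ h => h) (by simp) fun _ h => by rwa [← scanned_all hn hm]
  · refine ⟨SameExcept.refl.writeReal.writeReal.write, ?_⟩
    rw [scanned_zero_zero]
    constructor <;> simp
  · rintro i σ₁ ⟨hsame, -⟩
    simpa [hsame.nat] using hagents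
  · rintro i σ₁ - hrow ⟨hsame, hext⟩
    refine .frame (runs_scanRow (by rw [hsame.nat 0 (by simp), hitems])
      (by rw [hsame.real 0 (by simp), hc]) hrow hext) le_rfl ?_
    rintro σ₂ ⟨hsame₂, hext₂⟩
    exact ⟨by rw [hsame₂.nat _ (by simp), hrow], (hsame.trans hsame₂.mono).write,
      by simpa using hext₂⟩

end Extremes

/-! ### Filling the tables -/

/-- Makes the item in scalar `counter` free and fills its column of `hitTable`. -/
def fillColumn : Program :=
  .seq (.setNat owner (.const 0) (scalar counter) numAgents)
    (.seq (.setNat hitTable numAgents (scalar counter) (.const 1))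
      (.seq (.setNat hitTable (.succ numAgents) (scalar counter) (.const 1))
        (forLoop row numAgents
          (.ite (.realLe currentCost (.cell smallCost (.const 0) (.const 0)))
            (.seq (.setNat hitTable (scalar row) (scalar counter) (.const 1))
              (.setNat hitTable numAgents (scalar counter) (.const 0)))
            (.setNat hitTable (scalar row) (scalar counter) (.const 0))))))

/-- Makes all items free and fills `hitTable`. -/
def fillTable : Program := forLoop counter numItems fillColumn

/-- Computes the entry of `availCount` for the preference in scalar `row`. -/
def countRow : Program :=
  .seq (.setNat availCount (scalar row) (.const 0) (.const 0))
    (forLoop counter numItems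
      (.ite (.natLe (.const 1) (.cell hitTable (scalar row) (scalar counter)))
        (.setNat availCount (scalar row) (.const 0)
          (.succ (.cell availCount (scalar row) (.const 0)))) .skip))

/-- Fills the array `availCount` when all items are free. -/
def countItems : Program := forLoop row (.succ (.succ numAgents)) countRow

section Tables

variable {n m : ℕ} {c : ℕ → ℕ → ℝ} {s : ℝ} {σ : Store} {e v : ℕ}

/-- The part of column `e` of the table `hitTable` in `σ'` that can be filled after looking at the
costs to the first `k` agents is correct, and the other columns are as in `σ`. -/
structure ColumnFilled (n : ℕ) (c : ℕ → ℕ → ℝ) (s : ℝ) (e k : ℕ) (σ σ' : Store) : Prop where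
  same : SameExcept [owner, hitTable, row] σ σ'
  owner_eq : σ'.nat owner 0 = Function.update (σ.nat owner 0) e n
  other : ∀ v, ∀ e' ≠ e, σ'.nat hitTable v e' = σ.nat hitTable v e'
  agent : ∀ v < k, 1 ≤ σ'.nat hitTable v e ↔ c v e = s
  none : 1 ≤ σ'.nat hitTable n e ↔ ∀ i < k, c i e ≠ s
  all : 1 ≤ σ'.nat hitTable (n + 1) e

theorem ColumnFilled.iff_hits {σ' : Store} (h : ColumnFilled n c s e n σ σ') (hv : v < n + 2) :
    1 ≤ σ'.nat hitTable v e ↔ Hits n c s v e := by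
  obtain hv | rfl | rfl : v < n ∨ v = n ∨ v = n + 1 := by omega
  · rw [h.agent v hv, hits_agent hv]
  · rw [h.none, hits_none]
  · exact iff_of_true h.all hits_all

theorem ColumnFilled.small {σ' : Store} {k : ℕ} (h : ColumnFilled n c s e k σ σ') (hk : k < n)
    (hsmall : c k e = s) : ColumnFilled n c s e (k + 1) σ
      (((σ'.writeNat hitTable k e 1).writeNat hitTable n e 0).writeNat row 0 0 (k + 1)) where
  same := h.same.write.write.write
  owner_eq := by simpa using h.owner_eq
  other v e' he := by simpa [he] using h.other v e' he
  agent v hv := by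
    rcases Nat.lt_succ_iff_lt_or_eq.1 hv with hv | rfl
    · simpa [hv.ne, (hv.trans hk).ne] using h.agent v hv
    · simp [hk.ne, hsmall]
  none := by simpa using ⟨k, le_rfl, hsmall⟩
  all := by simpa [show n + 1 ≠ k by omega] using h.all

theorem ColumnFilled.large {σ' : Store} {k : ℕ} (h : ColumnFilled n c s e k σ σ') (hk : k < n)
    (hlarge : c k e ≠ s) : ColumnFilled n c s e (k + 1) σ
      ((σ'.writeNat hitTable k e 0).writeNat row 0 0 (k + 1)) where
  same := h.same.write.write
  owner_eq := by simpa using h.owner_eq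
  other v e' he := by simpa [he] using h.other v e' he
  agent v hv := by
    rcases Nat.lt_succ_iff_lt_or_eq.1 hv with hv | rfl
    · simpa [hv.ne] using h.agent v hv
    · simp [hlarge]
  none := by
    rw [Nat.forall_lt_succ_right]
    simpa [hk.ne', hlarge] using h.none
  all := by simpa [show n + 1 ≠ k by omega] using h.all

theorem runs_fillColumn (hagents : σ.nat 0 0 0 = n) (hc : σ.real 0 = c)
    (hs : σ.real smallCost 0 0 = s) (hle : ∀ i < n, s ≤ c i e) (hcounter : σ.nat counter 0 0 = e) :
    Runs fillColumn σ (n * 56 + 60) fun σ' _ => ColumnFilled n c s e n σ σ' := by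
  refine .seq (.setNat rfl hcounter hagents (.seq (.setNat (by simpa) (by simpa) rfl
    (.seq (.setNat (i' := n + 1) (by simpa) (by simpa) rfl ?_)))))
  refine .frame (.for_loop_const (N := n) (C := 40) (J := fun k σ₁ => ColumnFilled n c s e k σ σ₁)
    ?_ ?_ ?_ fun _ h => h) (by simp) fun _ h => h
  · refine ⟨SameExcept.refl.write.write.write.write, ?_, fun v e' he => by simp [he], by simp,
      by simp, by simp⟩
    ext e'
    simp [Function.update_apply]
  · intro k σ₁ h
    simpa [h.same.nat] using hagents
  · intro k σ₁ hk hrow h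
    have hcounter₁ : σ₁.nat counter 0 0 = e := by rw [h.same.nat _ (by simp), hcounter]
    have hagents₁ : σ₁.nat 0 0 0 = n := by rw [h.same.nat _ (by simp), hagents]
    refine .ite (P := c k e ≤ s) ?_ (fun hsmall => .seq (.setNat hrow hcounter₁ rfl
      (.setNat (by simpa) (by simpa) rfl
        ⟨by simpa using hrow, h.small hk (hsmall.antisymm (hle k hk))⟩)))
      fun hlarge => .setNat hrow hcounter₁ rfl
        ⟨by simpa using hrow, h.large hk (not_le.1 hlarge).ne'⟩
    simp [hrow, hcounter₁, h.same.real, hc, hs]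

theorem runs_fillTable (hagents : σ.nat 0 0 0 = n) (hitems : σ.nat 0 0 1 = m)
    (hc : σ.real 0 = c) (hs : σ.real smallCost 0 0 = s) (hle : ∀ i < n, ∀ e < m, s ≤ c i e) :
    Runs fillTable σ (m * (n * 56 + 76) + 13) fun σ' _ =>
      SameExcept [owner, hitTable, row, counter] σ σ' ∧ (∀ e < m, σ'.nat owner 0 e = n) ∧
      ∀ v < n + 2, ∀ e < m, 1 ≤ σ'.nat hitTable v e ↔ Hits n c s v e := by
  refine .frame (.for_loop_const (N := m) (C := n * 56 + 60) (J := fun k σ₁ =>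
    SameExcept [owner, hitTable, row, counter] σ σ₁ ∧ (∀ e < k, σ₁.nat owner 0 e = n) ∧
    ∀ v < n + 2, ∀ e < k, 1 ≤ σ₁.nat hitTable v e ↔ Hits n c s v e) ?_ ?_ ?_ fun _ h => h)
    (by simp [add_assoc]) fun _ h => h
  · exact ⟨SameExcept.refl.write, by simp, by simp⟩
  · rintro k σ₁ ⟨hsame, -⟩
    simpa [hsame.nat] using hitems
  · rintro k σ₁ hk hcounter ⟨hsame, howner, hhits⟩
    refine .frame (runs_fillColumn (by rw [hsame.nat 0 (by simp), hagents])
      (by rw [hsame.real 0 (by simp), hc]) (by rw [hsame.real _ (by simp), hs])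
      (fun i hi => hle i hi k hk) hcounter) le_rfl fun σ₂ h => ?_
    refine ⟨by rw [h.same.nat _ (by simp), hcounter], (hsame.trans h.same.mono).write,
      fun e he => ?_, fun v hv e he => ?_⟩ <;> rw [Store.nat_writeNat_of_ne (by simp)]
    · rw [h.owner_eq, Function.update_apply]
      split_ifs with hek
      exacts [rfl, howner e (by omega)]
    · rcases Nat.lt_succ_iff_lt_or_eq.1 he with he | rfl
      · rw [h.other v e he.ne, hhits v hv e he]
      · exact h.iff_hits hv


theorem runs_countRow (hitems : σ.nat 0 0 1 = m) (hrow : σ.nat row 0 0 = v) :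
    Runs countRow σ (m * 40 + 20) fun σ' _ => SameExcept [availCount, counter] σ σ' ∧
      ∀ u, σ'.nat availCount u 0 =
        if u = v then Nat.count (1 ≤ σ.nat hitTable v ·) m else σ.nat availCount u 0 := by
  refine .seq (.setNat hrow rfl rfl ?_)
  refine .frame (.for_loop_const (N := m) (C := 24) (J := fun k σ₁ =>
    SameExcept [availCount, counter] σ σ₁ ∧ ∀ u, σ₁.nat availCount u 0 =
      if u = v then Nat.count (1 ≤ σ.nat hitTable v ·) k else σ.nat availCount u 0) ?_ ?_ ?_
    fun _ h => h) (by simp) fun _ h => h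
  · exact ⟨SameExcept.refl.write.write, by simp⟩
  · rintro k σ₁ ⟨hsame, -⟩
    simpa [hsame.nat] using hitems
  · rintro k σ₁ - hcounter ⟨hsame, hcount⟩
    have hrow₁ : σ₁.nat row 0 0 = v := by rw [hsame.nat _ (by simp), hrow]
    refine .ite_skip (P := 1 ≤ σ.nat hitTable v k) (by simp [hsame.nat, hrow, hcounter])
      (fun hhit => .setNat hrow₁ rfl rfl ⟨by simpa using hcounter, hsame.write.write, fun u => ?_⟩)
      fun hmiss => ⟨hcounter, hsame.write, fun u => ?_⟩
    · rcases eq_or_ne u v with rfl | hu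
      · simp [Nat.count_succ, hhit, hrow₁, hcount]
      · simp [hu, hcount]
    · simp [Nat.count_succ, hmiss, hcount]

theorem avail_eq_count (howner : ∀ e < m, σ.nat owner 0 e = n)
    (hhits : ∀ e < m, 1 ≤ σ.nat hitTable v e ↔ Hits n c s v e) :
    avail n c s (bundles m σ) v = Nat.count (1 ≤ σ.nat hitTable v ·) m := by
  classical
  rw [avail, Nat.count_eq_card_filter_range]
  congr 1
  ext e
  simp only [Finset.mem_filter, mem_bundle, Finset.mem_range]
  constructor
  · rintro ⟨⟨he, -⟩, h⟩
    exact ⟨he, (hhits e he).2 h⟩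
  · rintro ⟨he, h⟩
    exact ⟨⟨he, howner e he⟩, (hhits e he).1 h⟩

theorem runs_countItems (hagents : σ.nat 0 0 0 = n) (hitems : σ.nat 0 0 1 = m)
    (howner : ∀ e < m, σ.nat owner 0 e = n)
    (hhits : ∀ v < n + 2, ∀ e < m, 1 ≤ σ.nat hitTable v e ↔ Hits n c s v e) :
    Runs countItems σ ((n + 2) * (m * 40 + 38) + 15) fun σ' _ =>
      SameExcept [availCount, row, counter] σ σ' ∧
      ∀ v < n + 2, σ'.nat availCount v 0 = avail n c s (bundles m σ) v := by
  refine .frame (.for_loop_const (N := n + 2) (C := m * 40 + 20) (J := fun v σ₁ =>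
    SameExcept [availCount, row, counter] σ σ₁ ∧
    ∀ u < v, σ₁.nat availCount u 0 = avail n c s (bundles m σ) u) ?_ ?_ ?_ fun _ h => h)
    (by simp [add_assoc]) fun _ h => h
  · exact ⟨SameExcept.refl.write, by simp⟩
  · rintro v σ₁ ⟨hsame, -⟩
    simpa [hsame.nat] using hagents
  · rintro v σ₁ hv hrow ⟨hsame, hcount⟩
    refine .frame (runs_countRow (by rw [hsame.nat 0 (by simp), hitems]) hrow) le_rfl ?_
    rintro σ₂ ⟨hsame₂, hcount₂⟩
    refine ⟨by rw [hsame₂.nat _ (by simp), hrow], (hsame.trans hsame₂.mono).write, fun u hu => ?_⟩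
    rw [Store.nat_writeNat_of_ne (by simp), hcount₂, hsame.nat hitTable (by simp)]
    split_ifs with huv
    · rw [huv, avail_eq_count howner (hhits v hv)]
    · exact hcount u (by omega)

end Tables

/-! ### Dealing out the items in turn -/

/-- Scalar: the agent that receives the next item. -/
@[simp] abbrev nextAgent : ℕ := 23

/-- Gives item `e` to agent `e % n`. -/
def dealOut : Program :=
  .seq (assign nextAgent (.const 0)) (forLoop counter numItems
    (.seq (.setNat owner (.const 0) (scalar counter) (scalar nextAgent))
      (.seq (assign nextAgent (.succ (scalar nextAgent)))
        (.ite (.natLe numAgents (scalar nextAgent)) (assign nextAgent (.const 0)) .skip))))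

section DealOut

variable {n m : ℕ} {c : ℕ → ℕ → ℝ} {s l : ℝ} {X : ℕ → Finset ℕ} {o : ℕ → ℕ} {σ : Store} {i : ℕ}

theorem efx_of_card_le_one (hn : 1 ≤ n) (hc : ∀ i < n, ∀ j < n, ∀ e ∈ X j, 0 ≤ c i e)
    (hcard : ∀ i < n, (X i).card ≤ 1) : EFX n c X := by
  rintro i hi j hj - e he
  have hn' : (1 : ℝ) ≤ n := by exact_mod_cast hn
  have hself : X i = {e} := Finset.eq_singleton_iff_unique_mem.2
    ⟨he, fun f hf => Finset.card_le_one.1 (hcard i hi) f hf e he⟩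
  rw [hself, setCost_singleton, sub_self, add_zero]
  exact mul_nonneg (sub_nonneg.2 hn') (Finset.sum_nonneg (hc i hi j hj))

theorem efx_of_card_le_add_one (hn : 3 ≤ n)
    (hc : ∀ i < n, ∀ j < n, ∀ e ∈ X j, s ≤ c i e ∧ c i e ≤ l) (hl : l ≤ 2 * s)
    (hcard : ∀ i < n, ∀ j < n, (X i).card ≤ (X j).card + 1) : EFX n c X := by
  rintro i hi j hj - e he
  have hn' : (3 : ℝ) ≤ n := by exact_mod_cast hn
  have hs : 0 ≤ s := by linarith [hc i hi i hi e he]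
  have hsum : setCost c i ((X i).erase e) + c i e = setCost c i (X i) := Finset.sum_erase_add _ _ he
  have herase : (((X i).erase e).card : ℝ) ≤ (X j).card := by
    rw [Finset.card_erase_of_mem he]
    exact_mod_cast Nat.sub_le_of_le_add (hcard i hi j hj)
  have hlow : (X j).card * s ≤ setCost c i (X j) := by
    rw [← nsmul_eq_mul]
    exact Finset.card_nsmul_le_sum _ _ _ fun f hf => (hc i hi j hj f hf).1
  calc setCost c i (X i) - c i e + 0 = setCost c i ((X i).erase e) := by linarith
    _ ≤ ((X i).erase e).card * (2 * s) := by
      rw [← nsmul_eq_mul]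
      exact Finset.sum_le_card_nsmul _ _ _ fun f hf =>
        (hc i hi i hi f (Finset.mem_of_mem_erase hf)).2.trans hl
    _ ≤ (X j).card * (2 * s) := by gcongr
    _ = 2 * ((X j).card * s) := by ring
    _ ≤ (n - 1) * setCost c i (X j) :=
      mul_le_mul (by linarith) hlow (by positivity) (by linarith)

theorem card_bundle_of_mod (hi : i < n) (ho : ∀ e < m, o e = e % n) :
    (bundle m o i).card = m / n + if i < m % n then 1 else 0 := by
  have hcount := Nat.count_modEq_card m (by omega : 0 < n) i
  rw [Nat.mod_eq_of_lt hi, Nat.count_eq_card_filter_range] at hcount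
  rw [← hcount]
  refine congrArg Finset.card (Finset.filter_congr fun e he => ?_)
  rw [ho e (Finset.mem_range.1 he), Nat.ModEq, Nat.mod_eq_of_lt hi]

theorem efx_of_mod (hn : 3 ≤ n) (hs : 0 ≤ s) (hc : ∀ i < n, ∀ e < m, s ≤ c i e ∧ c i e ≤ l)
    (h : m ≤ n ∨ l ≤ 2 * s) (ho : ∀ e < m, o e = e % n) : EFX n c (bundle m o) := by
  have hbundle : ∀ i < n, ∀ j < n, ∀ e ∈ bundle m o j, s ≤ c i e ∧ c i e ≤ l :=
    fun i hi _ _ e he => hc i hi e (mem_bundle.1 he).1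
  rcases h with hmn | hl
  · refine efx_of_card_le_one (by omega) (fun i hi j hj e he => hs.trans (hbundle i hi j hj e he).1)
      fun i _ => Finset.card_le_one.2 fun e he f hf => ?_
    obtain ⟨hem, heo⟩ := mem_bundle.1 he
    obtain ⟨hfm, hfo⟩ := mem_bundle.1 hf
    rw [ho e hem, Nat.mod_eq_of_lt (by omega)] at heo
    rw [ho f hfm, Nat.mod_eq_of_lt (by omega)] at hfo
    rw [heo, hfo]
  · refine efx_of_card_le_add_one hn hbundle hl fun i hi j hj => ?_
    rw [card_bundle_of_mod hi ho, card_bundle_of_mod hj ho]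
    split_ifs <;> omega

theorem runs_dealOut (hn : 1 < n) (hagents : σ.nat 0 0 0 = n) (hitems : σ.nat 0 0 1 = m) :
    Runs dealOut σ (m * 56 + 30) fun σ' _ => ∀ e < m, σ'.nat owner 0 e = e % n := by
  refine .seq (.assign rfl ?_)
  refine .frame (.for_loop_const (N := m) (C := 40) (J := fun k σ₁ =>
    SameExcept [owner, nextAgent, counter] σ σ₁ ∧ σ₁.nat nextAgent 0 0 = k % n ∧
    ∀ e < k, σ₁.nat owner 0 e = e % n) ?_ ?_ ?_ fun _ h => h.2.2) (by simp) fun _ h => h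
  · exact ⟨SameExcept.refl.write.write, by simp, by simp⟩
  · rintro k σ₁ ⟨hsame, -⟩
    simpa [hsame.nat] using hitems
  · rintro k σ₁ - hcounter ⟨hsame, hnext, howner⟩
    refine .seq (.setNat rfl hcounter hnext (.seq (.assign (v := k % n + 1) (by simp [hnext]) ?_)))
    have howner' : ∀ e < k + 1, (if e = k then k % n else σ₁.nat owner 0 e) = e % n := by
      intro e he
      split_ifs with hek
      · rw [hek]
      · exact howner e (by omega)
    have hmod : (k + 1) % n = if n ≤ k % n + 1 then k % n + 1 - n else k % n + 1 := by
      rw [Nat.add_mod_eq_ite, Nat.mod_eq_of_lt hn]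
    have hlt := Nat.mod_lt k (by omega : 0 < n)
    refine .ite_skip (P := n ≤ k % n + 1) (by simp [hsame.nat, hagents])
      (fun hwrap => .assign rfl ⟨by simpa using hcounter, hsame.write.write.write.write, ?_, ?_⟩)
      fun hnowrap => ⟨by simpa using hcounter, hsame.write.write.write, ?_, ?_⟩
    · rw [hmod, if_pos hwrap, Nat.sub_eq_zero_of_le hlt]
      simp
    · simpa using howner'
    · rw [hmod, if_neg hnowrap]
      simp
    · simpa using howner'

end DealOut

/-! ### The complete program -/

/-- Sets up the data structure described by `State`, with all items free. -/
def makeTables : Program := .seq fillTable countItems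

/-- The program for many items and a large cost exceeding twice the small one. -/
def solveSeparated : Program := .seq makeTables (.seq mainPhase endPhase)

/-- Tests whether there are more items than agents and the large cost exceeds twice the small
one. -/
abbrev isSeparated : Test :=
  .and (.not (.natLe numItems numAgents))
    (.not (.realLe (.cell largeCost (.const 0) (.const 0))
      (.add (.cell smallCost (.const 0) (.const 0)) (.cell smallCost (.const 0) (.const 0)))))

/-- Computes an `(n - 1)`-EFX allocation of a bi-valued instance. -/
def efxProgram : Program := .seq findExtremes (.ite isSeparated solveSeparated dealOut)

section Complete

variable {n m : ℕ} {c : ℕ → ℕ → ℝ} {s l : ℝ} {σ σ' : Store}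

theorem bundle_of_forall_eq {o : ℕ → ℕ} {j : ℕ} (ho : ∀ e < m, o e = j) :
    bundle m o j = Finset.range m :=
  Finset.filter_true_of_mem fun e he => ho e (Finset.mem_range.1 he)

theorem bundle_eq_empty {o : ℕ → ℕ} {i j : ℕ} (ho : ∀ e < m, o e = j) (hij : i ≠ j) :
    bundle m o i = ∅ :=
  Finset.filter_false_of_mem fun e he h => hij (h.symm.trans (ho e (Finset.mem_range.1 he)))

theorem potential_le : potential n m σ ≤ n * m + (n + 2) * m := by
  refine Nat.add_le_add (Nat.mul_le_mul_left _ ?_) ?_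
  · exact (Finset.card_filter_le _ _).trans_eq (Finset.card_range m)
  · refine (Finset.sum_le_card_nsmul _ _ m fun v _ => Nat.sub_le _ _).trans_eq ?_
    rw [Finset.card_range, smul_eq_mul]

theorem separated_of_extremes {a b : ℝ} (hn : 4 ≤ n) (ha : 0 ≤ a) (hb : 0 ≤ b)
    (hab : ∀ i < n, ∀ e < m, c i e = a ∨ c i e = b)
    (h : Extremes c (Set.Iio n ×ˢ Set.Iio m) s l) (hsl : 2 * s < l) : Separated n m c s l := by
  have hmem : ∀ x ∈ Function.uncurry c '' (Set.Iio n ×ˢ Set.Iio m), x = a ∨ x = b := by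
    rintro _ ⟨⟨i, e⟩, ⟨hi, he⟩, rfl⟩
    exact hab i hi e he
  have hs := hmem s h.least.1
  have hl := hmem l h.greatest.1
  have hs₀ : 0 ≤ s := by rcases hs with rfl | rfl <;> assumption
  have hne : s ≠ l := by linarith
  refine ⟨hn, hs₀, hsl, fun i hi e he => ?_⟩
  rcases hs with rfl | rfl <;> rcases hl with rfl | rfl
  exacts [absurd rfl hne, hab i hi e he, (hab i hi e he).symm, absurd rfl hne]

theorem runs_makeTables (hagents : σ.nat 0 0 0 = n) (hitems : σ.nat 0 0 1 = m)
    (hpointer : ∀ v, σ.nat pointer v 0 = 0) (hc : σ.real 0 = c) (hs : σ.real smallCost 0 0 = s)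
    (hle : ∀ i < n, ∀ e < m, s ≤ c i e) :
    Runs makeTables σ (m * (n * 56 + 76) + 13 + ((n + 2) * (m * 40 + 38) + 15))
      fun σ' _ => SameExcept [owner, hitTable, availCount, row, counter] σ σ' ∧
        State n m c s σ' ∧ ∀ e < m, σ'.nat owner 0 e = n := by
  refine .seq (.frame (runs_fillTable hagents hitems hc hs hle) (by omega) ?_)
  rintro σ₁ ⟨hsame₁, howner, hhits⟩
  refine .frame (runs_countItems (by rw [hsame₁.nat 0 (by simp), hagents])
    (by rw [hsame₁.nat 0 (by simp), hitems]) howner hhits) (by omega) ?_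
  rintro σ₂ ⟨hsame₂, hcount⟩
  have hsame : SameExcept [owner, hitTable, availCount, row, counter] σ σ₂ :=
    hsame₁.mono.trans hsame₂.mono
  have howner₂ : ∀ e < m, σ₂.nat owner 0 e = n := by rwa [hsame₂.nat _ (by simp)]
  refine ⟨hsame, ?_, howner₂⟩
  have hpointer₂ : ∀ v, σ₂.nat pointer v 0 = 0 := by rwa [hsame.nat _ (by simp)]
  exact {
    agents := by rw [hsame.nat 0 (by simp), hagents]
    items := by rw [hsame.nat 0 (by simp), hitems]
    owner_le := fun e he => (howner₂ e he).le
    hits := by rwa [hsame₂.nat _ (by simp)]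
    count := by rwa [hsame₂.bundles_eq]
    pointer_le := by simp only [hpointer₂, zero_le, implies_true]
    passed := by simp only [hpointer₂, not_lt_zero, false_implies, implies_true] }

theorem runs_solveSeparated (hI : Separated n m c s l) (hnm : n < m) (hagents : σ.nat 0 0 0 = n)
    (hitems : σ.nat 0 0 1 = m) (hpointer : ∀ v, σ.nat pointer v 0 = 0)
    (hmarks : ∀ i, σ.nat marks i 0 = 0) (hc : σ.real 0 = c) (hs : σ.real smallCost 0 0 = s)
    (hl : σ.real largeCost 0 0 = l) :
    Runs solveSeparated σ (2500 * (n * m)) fun σ' _ => Solved n m c σ' := by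
  have hn := hI.four_le
  have hm : m ≤ n * m := Nat.le_mul_of_pos_left m (by omega)
  refine .seq (.frame (runs_makeTables hagents hitems hpointer hc hs
    fun _ hi _ he => hI.le_cost hi he) (by nlinarith) ?_)
  rintro σ₁ ⟨hsame₁, hσ₁, howner₁⟩
  refine .seq (.mono (runs_mainPhase hI hσ₁
    (x := 600 * (n + m) * n + 400 * (n + m) + 400) (fun i hi => bundle_eq_empty howner₁ hi.ne)
    ?_ ?_) ?_)
  · rw [avail_all, bundles, bundle_of_forall_eq howner₁, Finset.card_range]
    exact hnm.le
  · have hpotential := potential_le (n := n) (m := m) (σ := σ₁)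
    refine Nat.le_sub_of_add_le ?_
    nlinarith
  rintro σ₂ b₂ ⟨hsame₂, hσ₂, ⟨r, hM⟩, hav, hlt, hb₂⟩
  refine runs_endPhase hI hσ₂ hM hav hlt ?_ ?_ ?_ (by simpa only [add_assoc] using hb₂)
  · rwa [hsame₂.nat _ (by simp), hsame₁.nat _ (by simp)]
  · rw [hsame₂.real _ (by simp), hsame₁.real _ (by simp), hc]
  · rw [hsame₂.real _ (by simp), hsame₁.real _ (by simp), hl]

theorem runs_efxProgram {a b : ℝ} (hn : 4 ≤ n) (hm : 1 ≤ m) (ha : 0 ≤ a) (hb : 0 ≤ b)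
    (hab : ∀ i < n, ∀ e < m, c i e = a ∨ c i e = b) (hagents : σ.nat 0 0 0 = n)
    (hitems : σ.nat 0 0 1 = m) (hpointer : ∀ v, σ.nat pointer v 0 = 0)
    (hmarks : ∀ i, σ.nat marks i 0 = 0) (hc : σ.real 0 = c) :
    Runs efxProgram σ (3000 * (n * m)) fun σ' _ => Solved n m c σ' := by
  have hn1 : n ≤ n * m := Nat.le_mul_of_pos_right n hm
  have hm1 : m ≤ n * m := Nat.le_mul_of_pos_left m (by omega)
  have hbudget : n * (m * 66 + 29) + 40 + 30 + 2500 * (n * m) ≤ 3000 * (n * m) := by nlinarith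
  have htest : isSeparated.cost ≤ 29 := by simp
  refine .seq (.frame (runs_findExtremes hagents hitems (by omega) (by omega) hc) (by omega) ?_)
  rintro σ₁ ⟨hsame, hext⟩
  have hagents₁ : σ₁.nat 0 0 0 = n := by rw [hsame.nat 0 (by simp), hagents]
  have hitems₁ : σ₁.nat 0 0 1 = m := by rw [hsame.nat 0 (by simp), hitems]
  refine .ite (P := n < m ∧ 2 * σ₁.real smallCost 0 0 < σ₁.real largeCost 0 0)
    (by simp [hagents₁, hitems₁, two_mul]) (fun hsep => ?_) (fun hsep => ?_) (by omega)
  · exact .frame (runs_solveSeparated (separated_of_extremes hn ha hb hab hext hsep.2) hsep.1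
      hagents₁ hitems₁ (by rwa [hsame.nat _ (by simp)]) (by rwa [hsame.nat _ (by simp)])
      (by rw [hsame.real 0 (by simp), hc]) rfl rfl) (by omega) fun _ h => h
  · refine .frame (runs_dealOut (by omega) hagents₁ hitems₁) (by omega) fun σ' howner =>
      ⟨fun e he => ?_, efx_of_mod (by omega) ?_ (fun i hi e he => hext.bounds hi he) ?_ howner⟩
    · rw [howner e he]
      exact Nat.mod_lt _ (by omega)
    · obtain ⟨⟨i, e⟩, ⟨hi, he⟩, hie⟩ := hext.least.1
      rw [← hie]
      rcases hab i hi e he with h | h <;> simpa [h]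
    · rwa [not_and_or, not_lt, not_lt] at hsep

end Complete

/-! ### The output -/

/-- The bundle of agent `i` under the owner function `o`, as a set of indices. -/
def outputBundle (m : ℕ) (o : ℕ → ℕ) (i : ℕ) : Finset (Fin m) := {e | o e = i}

section Output

variable {n m : ℕ} {o : ℕ → ℕ}

theorem mem_outputBundle {i : ℕ} {e : Fin m} : e ∈ outputBundle m o i ↔ o e = i := by
  simp [outputBundle]

theorem inputStore_real (c : Fin n → Fin m → ℝ) (i : Fin n) (e : Fin m) :
    (inputStore c).real 0 i e = c i e := by
  simp [inputStore]

theorem inputStore_nat_of_ne_zero (c : Fin n → Fin m → ℝ) {a : ℕ} (ha : a ≠ 0) (i j : ℕ) :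
    (inputStore c).nat a i j = 0 := by
  simp [inputStore, ha]

theorem bundleCost_outputBundle (c : Fin n → Fin m → ℝ) (i : Fin n) (j : ℕ) :
    bundleCost c i (outputBundle m o j) = setCost ((inputStore c).real 0) i (bundle m o j) := by
  rw [bundleCost, setCost, outputBundle, bundle, Finset.sum_filter, Finset.sum_filter,
    Finset.sum_range]
  simp only [inputStore_real]

theorem isEFX_outputBundle {c : Fin n → Fin m → ℝ} (hn : 2 ≤ n) (hc : ∀ i e, 0 ≤ c i e)
    (h : EFX n ((inputStore c).real 0) (bundle m o)) :
    IsEFX ((n : ℝ) - 1) c fun i => outputBundle m o i := by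
  intro i j e he
  have hsum : bundleCost c i ((outputBundle m o i).erase e) + c i e =
    bundleCost c i (outputBundle m o i) := Finset.sum_erase_add _ _ he
  rcases eq_or_ne i j with rfl | hij
  · have hn' : (1 : ℝ) ≤ (n : ℝ) - 1 := by
      have : (2 : ℝ) ≤ n := by exact_mod_cast hn
      linarith
    have hnonneg : 0 ≤ bundleCost c i (outputBundle m o i) := Finset.sum_nonneg fun f _ => hc i f
    linarith [hc i e, le_mul_of_one_le_left hnonneg hn']
  · have henvy := h i i.2 j j.2 (Fin.val_ne_of_ne hij) e
      (mem_bundle.2 ⟨e.2, mem_outputBundle.1 he⟩)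
    rw [← bundleCost_outputBundle, ← bundleCost_outputBundle, inputStore_real] at henvy
    linarith

theorem isAllocation_outputBundle (h : ∀ e < m, o e < n) :
    IsAllocation fun i : Fin n => outputBundle m o i :=
  ⟨fun _ _ hij => Finset.disjoint_left.2 fun _ hi hj =>
    hij (Fin.ext ((mem_outputBundle.1 hi).symm.trans (mem_outputBundle.1 hj))),
    fun e => ⟨⟨o e, h e e.2⟩, mem_outputBundle.2 rfl⟩⟩

theorem runs_efxProgram_inputStore {c : Fin n → Fin m → ℝ} (hn : 4 ≤ n) (hm : 1 ≤ m)
    (hc : IsBivalued c) : Runs efxProgram (inputStore c) (3000 * (n * m)) fun σ _ =>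
      IsAllocation (fun i : Fin n => outputBundle m (σ.nat owner 0) i) ∧
      IsEFX ((n : ℝ) - 1) c fun i => outputBundle m (σ.nat owner 0) i := by
  obtain ⟨a, b, ha, hb, hab⟩ := hc
  have hnonneg : ∀ i e, 0 ≤ c i e := fun i e => by rcases hab i e with h | h <;> rwa [h]
  refine .mono (runs_efxProgram hn hm ha hb (fun i hi e he => ?_) (by simp [inputStore])
    (by simp [inputStore]) (fun _ => inputStore_nat_of_ne_zero c (by simp) _ _)
    (fun _ => inputStore_nat_of_ne_zero c (by simp) _ _) rfl) fun σ _ hσ =>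
    ⟨isAllocation_outputBundle hσ.owner_lt, isEFX_outputBundle (by omega) hnonneg hσ.efx⟩
  rw [inputStore_real c ⟨i, hi⟩ ⟨e, he⟩]
  exact hab _ _

end Output

end ChoreDivision

theorem theorem4 :
    ∃ (p : ChoreDivision.Program) (C : ℕ),
      ∀ (n m : ℕ), 4 ≤ n → 1 ≤ m →
        ∀ c : Fin n → Fin m → ℝ, ChoreDivision.IsBivalued c →
          ∃ (t : ℕ) (s : ChoreDivision.Store) (X : Fin n → Finset (Fin m)),
            ChoreDivision.Exec p (ChoreDivision.inputStore c) t s ∧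
            t ≤ C * (n * m) ∧
            ChoreDivision.Outputs s X ∧
            ChoreDivision.IsAllocation X ∧
            ChoreDivision.IsEFX ((n : ℝ) - 1) c X := by
  refine ⟨ChoreDivision.efxProgram, 3000, fun n m hn hm c hc => ?_⟩
  obtain ⟨t, s, _, hexec, hcost, halloc, hefx⟩ :=
    ChoreDivision.runs_efxProgram_inputStore hn hm hc
  exact ⟨t, s, _, hexec, (Nat.le_add_right _ _).trans hcost,
    fun _ _ => ChoreDivision.mem_outputBundle, halloc, hefx⟩
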